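/- Let $n\ge 1$ and let $\Omega\subset\mathbb R^n$ be a bounded domain with smooth boundary. Let $C_0^\infty(\overline\Omega)$ be the set of smooth functions on $\overline\Omega$ that vanish on $\partial\Omega$, and let $H^2_0(\Omega)$ be its completion in the norm $\bigl(\sum_{|m|\le 2}\|\partial_y^m u;L^2(\Omega)\|^2\bigr)^{1/2}$. Let $\Delta_\Omega=-\sum_{i=1}^n\partial_{y_i}^2$ be the selfadjoint Dirichlet Laplacian in $L^2(\Omega)$ with domain $H^2_0(\Omega)$, and let $\sigma(\Delta_\Omega)$ be its spectrum. For $R\in\mathbb R$ and $\beta\ge 0$, let $C_0^\infty\bigl((-\infty,R]\times\overline\Omega\bigr)$ be the set of smooth complex-valued functions with compact support in $(-\infty,R]\times\overline\Omega$ that vanish on the boundary of $(-\infty,R)\times\Omega$, let $H^2_{0,\beta}\bigl((-\infty,R)\times\Omega\bigr)$ be the completion of this set in the norm $$\bigl\|u;H^2_{0,\beta}\bigr\|=\Bigl(\sum_{\ell+|m|\le 2}\int_{-\infty}^R\|e^{-\beta x}\partial_x^\ell\partial_y^m u(x);L^2(\Omega)\|^2\,dx\Bigr)^{1/2},$$ and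 let $L^2_\beta\bigl((-\infty,R)\times\Omega\bigr)$ be the weighted $L^2$-space with norm $\|f;L^2_\beta\|=\bigl(\int_{-\infty}^R\|e^{-\beta x}f(x);L^2(\Omega)\|^2dx\bigr)^{1/2}$. Let $0<\alpha<\pi/4$, let $\lambda\in\mathbb C\setminus\mathbb R$ with $|\lambda|<\sin\alpha$, let $\mu_0\in\mathbb R\setminus\sigma(\Delta_\Omega)$, and let $$0\le\beta<\min_{\nu\in\sigma(\Delta_\Omega)}\bigl|\operatorname{Im}\{(1+\lambda)\sqrt{\mu_0-\nu}\}\bigr|.$$ Then there is a constant $C$, depending neither on $R$ nor on $f$, such that for every $R\in\mathbb R$ and every $f\in L^2_\beta\bigl((-\infty,R)\times\Omega\bigr)$ the equation $$\bigl(\Delta_\Omega-(1+\lambda)^{-2}\partial_x^2-\mu_0\bigr)u=f\quad\text{in }(-\infty,R)\times\Omega$$ has a unique solution $u\in H^2_{0,0}\bigl((-\infty,R)\times\Omega\bigr)$; moreover $u\in H^2_{0,\beta}\bigl((-\infty,R)\times\Omega\bigr)$ and $$\bigl\|u;H^2_{0,\beta}\bigl((-\infty,R)\times\Omega\bigr)\bigr\|\le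 C\,\bigl\|f;L^2_\beta\bigl((-\infty,R)\times\Omega\bigr)\bigr\|.$$ -/

import Mathlib

open MeasureTheory
open scoped ContDiff

/-- Derivative multi-indices of order at most two in `d` variables. -/
abbrev MultiIndex (d : ℕ) : Type :=
  {a : Fin d → Fin 3 // ∑ i, (a i : ℕ) ≤ 2}

/-- The multi-index `0` (no derivative). -/
def MultiIndex.none (d : ℕ) : MultiIndex d := ⟨fun _ => 0, by simp⟩

/-- The multi-index `2 eᵢ` (second derivative in the `i`-th variable). -/
def MultiIndex.second {d : ℕ} (i : Fin d) : MultiIndex d :=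
  ⟨Pi.single i 2, by
    rw [Finset.sum_eq_single i]
    · simp
    · intro j _ hj
      simp [hj]
    · simp⟩

section Sobolev

/-- Directional derivative of a complex-valued function. -/
noncomputable def dirDeriv {V : Type*} [NormedAddCommGroup V] [NormedSpace ℝ V]
    (v : V) (φ : V → ℂ) : V → ℂ :=
  fun p => fderiv ℝ φ p v

/-- The partial derivative `∂^a φ` in the coordinate directions `e 0, …, e (d-1)`. -/
noncomputable def partialDeriv {V : Type*} [NormedAddCommGroup V] [NormedSpace ℝ V]
    {d : ℕ} (e : Fin d → V) (a : MultiIndex d) (φ : V → ℂ) : V → ℂ :=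
  (List.finRange d).foldr (fun i g => (dirDeriv (e i))^[(a.1 i : ℕ)] g) φ

/-- The class `C₀^∞` on the closure of `G`: (restrictions of) smooth compactly supported
functions that vanish on the boundary of `G`. The support may reach the boundary. -/
def IsDirichletTest {V : Type*} [NormedAddCommGroup V] [NormedSpace ℝ V]
    (G : Set V) (φ : V → ℂ) : Prop :=
  ContDiff ℝ ∞ φ ∧ HasCompactSupport φ ∧ ∀ p ∈ frontier G, φ p = 0

/-- Families `(U a)`, `|a| ≤ 2`, of elements of `L²(μ)`, with the norm
`(∑ₐ ‖U a; L²(μ)‖²)^{1/2}`. -/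
abbrev Jet {V : Type*} [MeasurableSpace V] (d : ℕ) (μ : Measure V) : Type _ :=
  PiLp 2 (fun _ : MultiIndex d => Lp ℂ 2 μ)

/-- The completion `H²₀` of `C₀^∞` on the closure of `G` in the norm
`(∑_{|a| ≤ 2} ‖∂^a u; L²(μ)‖²)^{1/2}`. A function `u` is represented by the family
`(∂^a u)`, so that the completion is the closure, in a complete space, of the isometric image
of `C₀^∞`. The component at `a` of an element of `H²₀` is the weak derivative `∂^a u`, and the
component at `0` is `u` itself. -/
def H20 {V : Type*} [NormedAddCommGroup V] [NormedSpace ℝ V] [MeasurableSpace V]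
    {d : ℕ} (e : Fin d → V) (μ : Measure V) (G : Set V) : Set (Jet d μ) :=
  closure {U | ∃ φ : V → ℂ, IsDirichletTest G φ ∧ ∀ a, U a =ᵐ[μ] partialDeriv e a φ}

end Sobolev

section CrossSection

/-- The coordinate directions of `ℝⁿ`. -/
noncomputable def yDir (n : ℕ) (i : Fin n) : EuclideanSpace ℝ (Fin n) :=
  EuclideanSpace.single i 1

/-- `Ω` has smooth boundary: near each boundary point, `Ω` is the sublevel set of a smooth
function whose differential does not vanish there. -/
def HasSmoothBoundary {n : ℕ} (Ω : Set (EuclideanSpace ℝ (Fin n))) : Prop :=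
  ∀ p ∈ frontier Ω, ∃ (W : Set (EuclideanSpace ℝ (Fin n))) (ρ : EuclideanSpace ℝ (Fin n) → ℝ),
    IsOpen W ∧ p ∈ W ∧ ContDiffOn ℝ ∞ ρ W ∧ fderiv ℝ ρ p ≠ 0 ∧ Ω ∩ W = {x ∈ W | ρ x < 0}

/-- The domain `H²₀(Ω)` of the Dirichlet Laplacian in `L²(Ω)`. -/
def H20CrossSection {n : ℕ} (Ω : Set (EuclideanSpace ℝ (Fin n))) :
    Set (Jet n (volume.restrict Ω)) :=
  H20 (yDir n) (volume.restrict Ω) Ω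

/-- `(Δ_Ω - μ) u`, where `Δ_Ω = -∑ᵢ ∂²/∂yᵢ²`. -/
noncomputable def crossLaplacianSub {n : ℕ} {Ω : Set (EuclideanSpace ℝ (Fin n))} (μ : ℂ)
    (U : Jet n (volume.restrict Ω)) : Lp ℂ 2 (volume.restrict Ω) :=
  -(∑ i, U (MultiIndex.second i)) - μ • U (MultiIndex.none n)

/-- The spectrum of the Dirichlet Laplacian `Δ_Ω` in `L²(Ω)` with domain `H²₀(Ω)`: the complex
`μ` for which `Δ_Ω - μ` has no bounded two-sided inverse `T` on `L²(Ω)`. -/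
def dirichletSpectrum {n : ℕ} (Ω : Set (EuclideanSpace ℝ (Fin n))) : Set ℂ :=
  {μ | ¬ ∃ T : Lp ℂ 2 (volume.restrict Ω) →L[ℂ] Lp ℂ 2 (volume.restrict Ω),
    (∀ f, ∃ U ∈ H20CrossSection Ω,
      U (MultiIndex.none n) = T f ∧ crossLaplacianSub μ U = f) ∧
    (∀ U ∈ H20CrossSection Ω, T (crossLaplacianSub μ U) = U (MultiIndex.none n))}

end CrossSection

section Cylinder

/-- The coordinate directions of `ℝ × ℝⁿ`: the `x`-direction has index `0`, the
`yᵢ`-direction has index `i + 1`. -/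
noncomputable def xyDir (n : ℕ) : Fin (n + 1) → ℝ × EuclideanSpace ℝ (Fin n) :=
  Fin.cons (1, 0) (fun i => (0, yDir n i))

/-- The semi-cylinder `(-∞, R) × Ω`. -/
def semiCylinder {n : ℕ} (R : ℝ) (Ω : Set (EuclideanSpace ℝ (Fin n))) :
    Set (ℝ × EuclideanSpace ℝ (Fin n)) :=
  Set.Iio R ×ˢ Ω

/-- The measure `e^{-2βx} dx dy` on `(-∞, R) × Ω`; its `L²`-space is `L²_β`, with norm
`(∫ ‖e^{-βx} f(x); L²(Ω)‖² dx)^{1/2}`. -/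
noncomputable def weightedMeasure {n : ℕ} (β R : ℝ) (Ω : Set (EuclideanSpace ℝ (Fin n))) :
    Measure (ℝ × EuclideanSpace ℝ (Fin n)) :=
  (volume.restrict (semiCylinder R Ω)).withDensity
    (fun p => ENNReal.ofReal (Real.exp (-2 * β * p.1)))

/-- The weighted space `L²_β((-∞, R) × Ω)`. -/
abbrev L2Weighted {n : ℕ} (β R : ℝ) (Ω : Set (EuclideanSpace ℝ (Fin n))) : Type :=
  Lp ℂ 2 (weightedMeasure β R Ω)

/-- The weighted Sobolev space `H²_{0,β}((-∞, R) × Ω)`. -/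
def H20Weighted {n : ℕ} (β R : ℝ) (Ω : Set (EuclideanSpace ℝ (Fin n))) :
    Set (Jet (n + 1) (weightedMeasure β R Ω)) :=
  H20 (xyDir n) (weightedMeasure β R Ω) (semiCylinder R Ω)

/-- `u` satisfies `(Δ_Ω - (1+λ)⁻² ∂ₓ² - μ₀) u = f` almost everywhere in `(-∞, R) × Ω`. -/
def SolvesModel {n : ℕ} {Ω : Set (EuclideanSpace ℝ (Fin n))} {R β₁ β₂ : ℝ} (lam : ℂ) (μ₀ : ℝ)
    (U : Jet (n + 1) (weightedMeasure β₁ R Ω)) (f : L2Weighted β₂ R Ω) : Prop :=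
  ∀ᵐ p ∂(volume.restrict (semiCylinder R Ω)),
    -(∑ i : Fin n, U (MultiIndex.second i.succ) p)
      - ((1 + lam) ^ 2)⁻¹ * U (MultiIndex.second 0) p
      - (μ₀ : ℂ) * U (MultiIndex.none (n + 1)) p = f p

/-- The disk `|λ| < sin α` of complex scaling parameters. -/
def scalingDisk (α : ℝ) : Set ℂ := {lam | ‖lam‖ < Real.sin α}

end Cylinder

/-! The proof separates variables. The resolvent T = (Δ_Ω - μ₀)⁻¹ is compact and symmetric, so L²(Ω)
has a Hilbert basis of eigenfunctions; write a = ν - μ₀ for the eigenvalues of Δ_Ω - μ₀. Along an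
eigenfunction the problem becomes a c - (1+λ)⁻² c'' = f on (-∞, R) with c(R) = 0, that is κ² c - c''
= (1+λ)² f with κ² = a (1+λ)² and Re κ > 0. This root satisfies Re κ = |Im((1+λ)√(μ₀-ν))|, so the
condition on the weight says β < Re κ for every mode. Compactness of the spectrum of T improves it
to β ≤ q Re κ with a single q < 1 (`exists_uniform_gap`).

A priori estimate. The mode equation is multiplied by e^{-2βx} c̄ κ̄ / Re κ. The real part is a
positive combination of |κ|²|c|² and |c' - βc|², up to an exact x-derivative whose integral vanishes
because c(R) = 0 (`mode_energy_pointwise`, `mode_boundary_term`). No constant depends on R or on the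
mode, so Parseval's identity allows summation. Derivatives of u are then recovered according to the
number of x-derivatives: none, from (Δ_Ω - μ₀)u and the H² bound that the bounded inverse theorem
supplies (`IsDirichletResolvent.exists_norm_le`); one, from |a||c'|² through the quadratic form of
Δ_Ω (`ModeData.enorm_sq_le_tsum`); two, from c'' directly. By density the estimate holds on H²_{0,β}
(`ModeData.exists_norm_le`).

Existence. The estimate makes the range closed. An element orthogonal to the range is tested on
products of a function ψ(x) with an eigenfunction; its mode coefficients then annihilate κ²ψ - ψ''
whenever ψ(R) = 0. Solving κ²ψ - ψ'' = η with ψ decaying like e^{Re κ x} and cutting off at -∞ shows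
that they vanish; this uses β < Re κ (`ae_eq_zero_of_mode_orthogonal`).

Since β ≥ 0 and x < R, the solution in H²_{0,β} also lies in H²_{0,0}, and uniqueness there is the
same estimate with β = 0. The supporting analysis is integration by parts on an open set by
extension by zero (`setIntegral_dirDeriv_eq_zero`) and Rellich's theorem by Fourier series on a box
(`exists_rellich_functionals`). -/

section Calculus

/-! ### Calculus of directional and partial derivatives -/

variable {V : Type*} [NormedAddCommGroup V] [NormedSpace ℝ V]

theorem ContDiff.dirDeriv {φ : V → ℂ} (hφ : ContDiff ℝ ∞ φ) (v : V) :
    ContDiff ℝ ∞ (dirDeriv v φ) :=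
  (hφ.fderiv_right (m := ∞) (by simp)).clm_apply contDiff_const

theorem HasCompactSupport.dirDeriv {φ : V → ℂ} (hφ : HasCompactSupport φ) (v : V) :
    HasCompactSupport (dirDeriv v φ) :=
  (hφ.fderiv ℝ).comp_left (g := fun L : V →L[ℝ] ℂ => L v) (by simp)

theorem tsupport_dirDeriv_subset (φ : V → ℂ) (v : V) :
    tsupport (dirDeriv v φ) ⊆ tsupport φ := by
  refine (closure_mono ?_).trans (tsupport_fderiv_subset ℝ (f := φ))
  intro x hx hx'
  exact hx (by simp [dirDeriv, hx'])

theorem contDiff_dirDeriv_iterate {φ : V → ℂ} (hφ : ContDiff ℝ ∞ φ) (v : V) (k : ℕ) :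
    ContDiff ℝ ∞ ((dirDeriv v)^[k] φ) := by
  induction k with
  | zero => simpa
  | succ k ih => rw [Function.iterate_succ_apply']; exact ih.dirDeriv v

theorem dirDeriv_add {φ ψ : V → ℂ} (hφ : ContDiff ℝ ∞ φ) (hψ : ContDiff ℝ ∞ ψ) (v : V) :
    dirDeriv v (φ + ψ) = dirDeriv v φ + dirDeriv v ψ := by
  ext p
  simp [dirDeriv, fderiv_add (hφ.differentiable (by simp) p) (hψ.differentiable (by simp) p)]

theorem dirDeriv_smul (c : ℂ) (φ : V → ℂ) (v : V) :
    dirDeriv v (c • φ) = c • dirDeriv v φ := by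
  ext p
  simp [dirDeriv, fderiv_const_smul_field]

theorem dirDeriv_mul {φ ψ : V → ℂ} (hφ : ContDiff ℝ ∞ φ) (hψ : ContDiff ℝ ∞ ψ) (v : V) :
    dirDeriv v (φ * ψ) = φ * dirDeriv v ψ + ψ * dirDeriv v φ := by
  ext p
  simp [dirDeriv, fderiv_mul (hφ.differentiable (by simp) p) (hψ.differentiable (by simp) p)]

theorem dirDeriv_star (φ : V → ℂ) (v : V) (p : V) :
    dirDeriv v (fun q => starRingEnd ℂ (φ q)) p = starRingEnd ℂ (dirDeriv v φ p) := by
  have h : (fun q => starRingEnd ℂ (φ q)) = Complex.conjCLE ∘ φ := by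
    ext; simp
  rw [dirDeriv, h, ContinuousLinearEquiv.comp_fderiv]
  simp [dirDeriv]

theorem ContDiff.starRingEnd_comp {φ : V → ℂ} (hφ : ContDiff ℝ ∞ φ) :
    ContDiff ℝ ∞ (fun q => starRingEnd ℂ (φ q)) :=
  Complex.conjCLE.contDiff.comp hφ

theorem dirDeriv_comm {φ : V → ℂ} (hφ : ContDiff ℝ ∞ φ) (v w : V) :
    dirDeriv v (dirDeriv w φ) = dirDeriv w (dirDeriv v φ) := by
  ext p
  have hd : DifferentiableAt ℝ (fderiv ℝ φ) p :=
    ((hφ.fderiv_right (m := ∞) (by simp)).differentiable (by simp)) p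
  have h : IsSymmSndFDerivAt ℝ φ p :=
    hφ.contDiffAt.isSymmSndFDerivAt (by
      rw [minSmoothness_of_isRCLikeNormedField]
      exact WithTop.coe_le_coe.2 (le_top : (2 : ℕ∞) ≤ ⊤))
  have key : ∀ u u' : V, dirDeriv u (dirDeriv u' φ) p = fderiv ℝ (fderiv ℝ φ) p u u' := by
    intro u u'
    have : fderiv ℝ (fun q => fderiv ℝ φ q u') p
        = (fderiv ℝ (fderiv ℝ φ) p).flip u' := by
      rw [fderiv_clm_apply hd (differentiableAt_const _)]
      simp
    change fderiv ℝ (fun q => fderiv ℝ φ q u') p u = _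
    rw [this]; rfl
  rw [key, key]
  exact h v w

/-- Serves to pass smoothness and compact support through the nested iteration that defines
`partialDeriv`. -/
theorem foldr_dirDeriv_induction {d : ℕ} (e : Fin d → V) (k : Fin d → ℕ) (P : (V → ℂ) → Prop)
    (hP : ∀ φ i, P φ → P (dirDeriv (e i) φ)) {φ : V → ℂ} (hφ : P φ) (l : List (Fin d)) :
    P (l.foldr (fun i g => (dirDeriv (e i))^[k i] g) φ) := by
  induction l with
  | nil => simpa
  | cons i l ih =>
    rw [List.foldr_cons]
    generalize List.foldr _ _ _ = g at ih
    generalize k i = m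
    induction m with
    | zero => simpa
    | succ m ihm => rw [Function.iterate_succ_apply']; exact hP _ _ ihm

theorem ContDiff.partialDeriv {d : ℕ} (e : Fin d → V) (a : MultiIndex d) {φ : V → ℂ}
    (hφ : ContDiff ℝ ∞ φ) : ContDiff ℝ ∞ (partialDeriv e a φ) :=
  foldr_dirDeriv_induction e _ (fun φ => ContDiff ℝ ∞ φ) (fun _ _ h => h.dirDeriv _) hφ _

theorem HasCompactSupport.partialDeriv {d : ℕ} (e : Fin d → V) (a : MultiIndex d) {φ : V → ℂ}
    (hφ : HasCompactSupport φ) : HasCompactSupport (partialDeriv e a φ) :=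
  foldr_dirDeriv_induction e _ (fun φ => HasCompactSupport φ) (fun _ _ h => h.dirDeriv _) hφ _

theorem dirDeriv_iterate_add {φ ψ : V → ℂ} (hφ : ContDiff ℝ ∞ φ) (hψ : ContDiff ℝ ∞ ψ) (v : V)
    (k : ℕ) : (dirDeriv v)^[k] (φ + ψ) = (dirDeriv v)^[k] φ + (dirDeriv v)^[k] ψ := by
  induction k with
  | zero => rfl
  | succ k ih =>
    simp only [Function.iterate_succ_apply', ih]
    exact dirDeriv_add (contDiff_dirDeriv_iterate hφ v k) (contDiff_dirDeriv_iterate hψ v k) v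

theorem dirDeriv_iterate_smul (c : ℂ) (φ : V → ℂ) (v : V) (k : ℕ) :
    (dirDeriv v)^[k] (c • φ) = c • (dirDeriv v)^[k] φ := by
  induction k with
  | zero => rfl
  | succ k ih => simp only [Function.iterate_succ_apply', ih, dirDeriv_smul]

theorem partialDeriv_add {d : ℕ} (e : Fin d → V) (a : MultiIndex d) {φ ψ : V → ℂ}
    (hφ : ContDiff ℝ ∞ φ) (hψ : ContDiff ℝ ∞ ψ) :
    partialDeriv e a (φ + ψ) = partialDeriv e a φ + partialDeriv e a ψ := by
  unfold partialDeriv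
  induction List.finRange d with
  | nil => rfl
  | cons i l ih =>
    simp only [List.foldr_cons, ih]
    exact dirDeriv_iterate_add
      (foldr_dirDeriv_induction e _ (fun φ => ContDiff ℝ ∞ φ) (fun _ _ h => h.dirDeriv _) hφ _)
      (foldr_dirDeriv_induction e _ (fun φ => ContDiff ℝ ∞ φ) (fun _ _ h => h.dirDeriv _) hψ _) _ _

theorem partialDeriv_smul {d : ℕ} (e : Fin d → V) (a : MultiIndex d) (c : ℂ) (φ : V → ℂ) :
    partialDeriv e a (c • φ) = c • partialDeriv e a φ := by
  unfold partialDeriv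
  induction List.finRange d with
  | nil => rfl
  | cons i l ih => simp only [List.foldr_cons, ih, dirDeriv_iterate_smul]

/-- The multi-index `eᵢ` (first derivative in the `i`-th variable). -/
def MultiIndex.first {d : ℕ} (i : Fin d) : MultiIndex d :=
  ⟨Pi.single i 1, by
    rw [Finset.sum_eq_single i]
    · simp
    · intro j _ hj
      simp [hj]
    · simp⟩

theorem partialDeriv_none {d : ℕ} (e : Fin d → V) (φ : V → ℂ) :
    partialDeriv e (MultiIndex.none d) φ = φ := by
  unfold partialDeriv
  induction List.finRange d with
  | nil => rfl
  | cons i l ih => simp only [List.foldr_cons, ih]; rfl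

/-- Only the index `i` has a nonzero exponent, and without repetitions it acts at most once. The
membership test is what lets the induction run over an arbitrary list. -/
theorem foldr_dirDeriv_single {d : ℕ} (e : Fin d → V) (i : Fin d) (c : Fin 3) (φ : V → ℂ)
    (l : List (Fin d)) (hl : l.Nodup) :
    l.foldr (fun j g => (dirDeriv (e j))^[((Pi.single i c : Fin d → Fin 3) j : ℕ)] g) φ
      = if i ∈ l then (dirDeriv (e i))^[(c : ℕ)] φ else φ := by
  induction l with
  | nil => simp
  | cons j l ih =>
    rw [List.nodup_cons] at hl
    rw [List.foldr_cons, ih hl.2]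
    by_cases hj : j = i
    · subst hj
      simp [hl.1]
    · simp [hj, Ne.symm hj]

theorem partialDeriv_first {d : ℕ} (e : Fin d → V) (i : Fin d) (φ : V → ℂ) :
    partialDeriv e (MultiIndex.first i) φ = dirDeriv (e i) φ := by
  have := foldr_dirDeriv_single e i 1 φ (List.finRange d) (List.nodup_finRange d)
  rw [if_pos (List.mem_finRange i)] at this
  exact this

theorem partialDeriv_second {d : ℕ} (e : Fin d → V) (i : Fin d) (φ : V → ℂ) :
    partialDeriv e (MultiIndex.second i) φ = dirDeriv (e i) (dirDeriv (e i) φ) := by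
  have := foldr_dirDeriv_single e i 2 φ (List.finRange d) (List.nodup_finRange d)
  rw [if_pos (List.mem_finRange i)] at this
  exact this

theorem IsDirichletTest.zero (G : Set V) : IsDirichletTest G (0 : V → ℂ) :=
  ⟨contDiff_const, HasCompactSupport.zero, fun _ _ => rfl⟩

theorem IsDirichletTest.add {G : Set V} {φ ψ : V → ℂ} (hφ : IsDirichletTest G φ)
    (hψ : IsDirichletTest G ψ) : IsDirichletTest G (φ + ψ) :=
  ⟨hφ.1.add hψ.1, hφ.2.1.add hψ.2.1, fun p hp => by simp [hφ.2.2 p hp, hψ.2.2 p hp]⟩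

theorem IsDirichletTest.smul {G : Set V} {φ : V → ℂ} (hφ : IsDirichletTest G φ) (c : ℂ) :
    IsDirichletTest G (c • φ) :=
  ⟨hφ.1.const_smul c, hφ.2.1.smul_left (f := fun _ => c), fun p hp => by simp [hφ.2.2 p hp]⟩

end Calculus

/-! ### The space H²₀ as a closure of jets of test functions -/

section SobolevSpace

variable {V : Type*} [NormedAddCommGroup V] [NormedSpace ℝ V] [MeasurableSpace V]
  {d : ℕ}

/-- The jets of test functions form a subspace. -/
noncomputable def testJets (e : Fin d → V) (μ : Measure V) (G : Set V) : Submodule ℂ (Jet d μ) where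
  carrier := {U | ∃ φ : V → ℂ, IsDirichletTest G φ ∧ ∀ a, U a =ᵐ[μ] partialDeriv e a φ}
  zero_mem' := ⟨0, .zero G, fun a => by
    have h0 : partialDeriv e a (0 : V → ℂ) = 0 := by
      simpa using partialDeriv_smul e a 0 (0 : V → ℂ)
    rw [h0]
    exact Lp.coeFn_zero ℂ 2 μ⟩
  add_mem' := by
    rintro U W ⟨φ, hφ, hU⟩ ⟨ψ, hψ, hW⟩
    refine ⟨φ + ψ, hφ.add hψ, fun a => ?_⟩
    rw [partialDeriv_add e a hφ.1 hψ.1]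
    exact (Lp.coeFn_add (U a) (W a)).trans ((hU a).add (hW a))
  smul_mem' := by
    rintro c U ⟨φ, hφ, hU⟩
    refine ⟨c • φ, hφ.smul c, fun a => ?_⟩
    rw [partialDeriv_smul]
    exact (Lp.coeFn_smul c (U a)).trans ((hU a).const_smul c)

/-- `H²₀` as a closed subspace of the space of jets. -/
noncomputable def H20Submodule (e : Fin d → V) (μ : Measure V) (G : Set V) : Submodule ℂ (Jet d μ) :=
  (testJets e μ G).topologicalClosure

/-- The density principle behind every statement on H²₀ below: a closed condition only has to be
checked on jets of test functions. -/
theorem H20_induction {e : Fin d → V} {μ : Measure V} {G : Set V} {P : Jet d μ → Prop}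
    (hP : IsClosed {U | P U})
    (h : ∀ U φ, IsDirichletTest G φ → (∀ a, U a =ᵐ[μ] partialDeriv e a φ) → P U)
    {U : Jet d μ} (hU : U ∈ H20 e μ G) : P U := by
  refine closure_minimal (s := {U | _}) (t := {U | P U}) ?_ hP hU
  rintro U ⟨φ, hφ, hU⟩
  exact h U φ hφ hU

theorem exists_testJet [BorelSpace V] (e : Fin d → V) (μ : Measure V) [IsFiniteMeasureOnCompacts μ]
    {G : Set V} {φ : V → ℂ} (hφ : IsDirichletTest G φ) :
    ∃ U ∈ H20 e μ G, ∀ a, U a =ᵐ[μ] partialDeriv e a φ := by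
  have hm : ∀ a : MultiIndex d, MemLp (partialDeriv e a φ) 2 μ := fun a =>
    (hφ.1.partialDeriv e a).continuous.memLp_of_hasCompactSupport (hφ.2.1.partialDeriv e a)
  let U : Jet d μ := WithLp.toLp 2 fun a => (hm a).toLp
  have hU : ∀ a, U a =ᵐ[μ] partialDeriv e a φ := fun a => (hm a).coeFn_toLp
  exact ⟨U, subset_closure ⟨φ, hφ, hU⟩, hU⟩

end SobolevSpace

/-! ### Integration by parts on an open set, by extension by zero -/

section Green

open Filter Topology

variable {V : Type*} [NormedAddCommGroup V] [NormedSpace ℝ V]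

/-- At a zero of `f` the function ‖f‖ has a minimum, so its derivative there is zero. Hence ‖f‖, and
with it `f`, is o of the increment. -/
theorem hasFDerivAt_zero_of_norm {f : V → ℂ} {x : V} (hx : f x = 0)
    (h : DifferentiableAt ℝ (fun y => ‖f y‖) x) : HasFDerivAt f (0 : V →L[ℝ] ℂ) x := by
  have hmin : IsLocalMin (fun y => ‖f y‖) x :=
    Eventually.of_forall fun y => by simp [hx]
  have h0 := h.hasFDerivAt
  rw [hmin.fderiv_eq_zero] at h0
  rw [hasFDerivAt_iff_isLittleO] at h0 ⊢
  simp only [hx, norm_zero, sub_zero, zero_apply] at h0 ⊢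
  exact h0.of_norm_left

theorem exists_mem_segment_inter_frontier {G : Set V} {x y : V} (hx : x ∈ G) (hy : y ∉ G) :
    ∃ z ∈ segment ℝ x y, z ∈ frontier G := by
  have hc : IsPreconnected (segment ℝ x y) := (convex_segment x y).isPreconnected
  by_contra! hcon
  obtain ⟨z, -, hz1, hz2⟩ := hc (interior G) (closure G)ᶜ isOpen_interior
    isClosed_closure.isOpen_compl (fun z hz => by
      by_cases h : z ∈ closure G
      · exact Or.inl (by_contra fun h' => hcon z hz ⟨h, h'⟩)
      · exact Or.inr h)
    ⟨x, left_mem_segment ℝ x y, by_contra fun h' =>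
      hcon x (left_mem_segment ℝ x y) ⟨subset_closure hx, h'⟩⟩
    ⟨y, right_mem_segment ℝ x y, fun h =>
      hcon y (right_mem_segment ℝ x y) ⟨h, fun h' => hy (interior_subset h')⟩⟩
  exact hz2 (subset_closure (interior_subset hz1))

/-- A segment leaving `G` meets the frontier, where `χ` vanishes. The Lipschitz bound up to that
point suffices, since it is no farther away than the end of the segment. -/
theorem LipschitzWith.indicator_of_frontier {G : Set V} {χ : V → ℂ} {C : NNReal}
    (hχ : LipschitzWith C χ) (h0 : ∀ p ∈ frontier G, χ p = 0) :
    LipschitzWith C (G.indicator χ) := by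
  have key : ∀ x y, x ∈ G → y ∉ G → dist (G.indicator χ x) (G.indicator χ y) ≤ C * dist x y := by
    intro x y hx hy
    obtain ⟨z, hz, hzG⟩ := exists_mem_segment_inter_frontier hx hy
    rw [Set.indicator_of_mem hx, Set.indicator_of_notMem hy, ← h0 z hzG]
    refine (hχ.dist_le_mul x z).trans ?_
    gcongr
    have := dist_add_dist_of_mem_segment hz
    linarith [dist_nonneg (x := z) (y := y)]
  refine LipschitzWith.of_dist_le_mul fun x y => ?_
  by_cases hx : x ∈ G <;> by_cases hy : y ∈ G
  · simpa [hx, hy] using hχ.dist_le_mul x y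
  · exact key x y hx hy
  · rw [dist_comm, dist_comm x y]
    exact key y x hy hx
  · simp [hx, hy]; positivity

variable [FiniteDimensional ℝ V] [MeasurableSpace V] [BorelSpace V] (μ : Measure V)
  [μ.IsAddHaarMeasure]

theorem ae_hasFDerivAt_zero_of_eq_zero {χ : V → ℂ} {C : NNReal} (hχ : LipschitzWith C χ) :
    ∀ᵐ x ∂μ, χ x = 0 → HasFDerivAt χ (0 : V →L[ℝ] ℂ) x := by
  have hn : LipschitzWith (1 * C) (fun y => ‖χ y‖) := lipschitzWith_one_norm.comp hχ
  filter_upwards [hn.ae_differentiableAt (μ := μ)] with x hx h0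
  exact hasFDerivAt_zero_of_norm h0 hx

/-- The frontier may have positive measure. On it `χ = 0`, and Rademacher's theorem for ‖χ‖ shows
that almost everywhere on the zero set the derivative is zero, so no boundary contribution appears.
-/
theorem ae_hasFDerivAt_indicator {G : Set V} (hG : IsOpen G) {χ : V → ℂ} {C : NNReal}
    (hL : LipschitzWith C χ) (hχ : Differentiable ℝ χ) (h0 : ∀ p ∈ frontier G, χ p = 0) :
    ∀ᵐ x ∂μ, HasFDerivAt (G.indicator χ) (G.indicator (fderiv ℝ χ) x) x := by
  filter_upwards [ae_hasFDerivAt_zero_of_eq_zero μ hL] with x hx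
  by_cases hxG : x ∈ G
  · rw [Set.indicator_of_mem hxG]
    refine (hχ x).hasFDerivAt.congr_of_eventuallyEq ?_
    filter_upwards [hG.mem_nhds hxG] with y hy
    rw [Set.indicator_of_mem hy]
  · rw [Set.indicator_of_notMem hxG]
    by_cases hxc : x ∈ closure G
    · have hxf : x ∈ frontier G := by
        rw [frontier, hG.interior_eq]; exact ⟨hxc, hxG⟩
      have h1 := hx (h0 x hxf)
      rw [hasFDerivAt_iff_isLittleO] at h1 ⊢
      simp only [h0 x hxf, Set.indicator_of_notMem hxG, sub_zero,
        zero_apply] at h1 ⊢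
      refine (Asymptotics.isBigO_of_le _ fun y => ?_).trans_isLittleO h1
      exact norm_indicator_le_norm_self _ _
    · refine (hasFDerivAt_const (0 : ℂ) x).congr_of_eventuallyEq ?_
      filter_upwards [isClosed_closure.isOpen_compl.mem_nhds hxc] with y hy
      rw [Set.indicator_of_notMem fun h => hy (subset_closure h)]

/-- The integral over an open set of a derivative of a function vanishing on the boundary. -/
theorem setIntegral_dirDeriv_eq_zero {G : Set V} (hG : IsOpen G) {χ : V → ℂ}
    (hχ : ContDiff ℝ ∞ χ) (hs : HasCompactSupport χ) (h0 : ∀ p ∈ frontier G, χ p = 0) (v : V) :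
    ∫ x in G, dirDeriv v χ x ∂μ = 0 := by
  obtain ⟨C, hL⟩ := ContDiff.lipschitzWith_of_hasCompactSupport hs hχ (by simp)
  -- The zero extension of `χ` is Lipschitz on the whole space. The integral of its derivative is
  -- the limit of the integrals of its difference quotients.
  set h := G.indicator χ with hh
  have hhL : LipschitzWith C h := hL.indicator_of_frontier h0
  have hhs : HasCompactSupport h := hs.mono' (by
    rw [hh, Set.support_indicator]
    exact Set.inter_subset_right.trans subset_closure)
  have hhi : Integrable h μ := hhL.continuous.integrable_of_hasCompactSupport hhs
  let t : ℕ → ℝ := fun n => 1 / ((n : ℝ) + 1)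
  have htpos : ∀ n, 0 < t n := fun n => by positivity
  have htle : ∀ n, t n ≤ 1 := fun n => by
    rw [div_le_one (by positivity)]; linarith [(Nat.cast_nonneg n : (0:ℝ) ≤ n)]
  have ht0 : Tendsto t atTop (𝓝 0) := tendsto_one_div_add_atTop_nhds_zero_nat
  let F : ℕ → V → ℂ := fun n x => (t n)⁻¹ • (h (x + t n • v) - h x)
  -- Translation invariance of Haar measure.
  have hFint : ∀ n, ∫ x, F n x ∂μ = 0 := by
    intro n
    rw [integral_smul, integral_sub (hhi.comp_add_right _) hhi, integral_add_right_eq_self h]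
    simp
  -- All steps satisfy `t n ≤ 1`, so this compact set contains the supports of all difference
  -- quotients.
  let K := Metric.cthickening ‖v‖ (tsupport χ)
  have hK : IsCompact K := hs.isCompact.cthickening
  have hlim : Tendsto (fun n => ∫ x, F n x ∂μ) atTop
      (𝓝 (∫ x, G.indicator (dirDeriv v χ) x ∂μ)) := by
    refine tendsto_integral_of_dominated_convergence (K.indicator fun _ => (C : ℝ) * ‖v‖)
      (fun n => ?_) ?_ (fun n => Eventually.of_forall fun x => ?_) ?_
    · have : Continuous (F n) := by
        have := hhL.continuous
        fun_prop
      exact this.aestronglyMeasurable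
    · rw [integrable_indicator_iff hK.measurableSet]
      exact integrableOn_const hK.measure_lt_top.ne
    · by_cases hxK : x ∈ K
      · rw [Set.indicator_of_mem hxK, norm_smul, norm_inv, Real.norm_of_nonneg (htpos n).le]
        have := hhL.dist_le_mul (x + t n • v) x
        rw [dist_eq_norm, dist_eq_norm, add_sub_cancel_left, norm_smul,
          Real.norm_of_nonneg (htpos n).le] at this
        rw [inv_mul_le_iff₀ (htpos n)]
        linarith
      · have hzero : ∀ y, dist y x ≤ ‖v‖ → h y = 0 := by
          intro y hy
          have : y ∉ tsupport χ := fun hy' => hxK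
            (Metric.mem_cthickening_of_dist_le x y _ _ hy' (by rwa [dist_comm]))
          exact Set.indicator_apply_eq_zero.2 fun _ => image_eq_zero_of_notMem_tsupport this
        have h1 : h x = 0 := hzero x (by simp)
        have h2 : h (x + t n • v) = 0 := hzero _ (by
          rw [dist_eq_norm, add_sub_cancel_left, norm_smul, Real.norm_of_nonneg (htpos n).le]
          exact mul_le_of_le_one_left (norm_nonneg _) (htle n))
        simp [F, h1, h2, hxK]
    · filter_upwards [ae_hasFDerivAt_indicator μ hG hL (hχ.differentiable (by simp)) h0] with x hx
      have h1 := (hx.hasLineDerivAt v)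
      have h2 : (G.indicator (fderiv ℝ χ) x) v = G.indicator (dirDeriv v χ) x := by
        by_cases hxG : x ∈ G <;> simp [hxG, dirDeriv]
      rw [h2] at h1
      have h3 := hasDerivAt_iff_tendsto_slope_zero.1 h1
      have ht : Tendsto t atTop (𝓝[≠] 0) :=
        tendsto_nhdsWithin_iff.2 ⟨ht0, Eventually.of_forall fun n => (htpos n).ne'⟩
      simpa [Function.comp_def, F] using h3.comp ht
  simp only [hFint] at hlim
  rw [← integral_indicator hG.measurableSet]
  exact tendsto_nhds_unique hlim tendsto_const_nhds

end Green

/-! ### Inner products in L² as integrals -/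

section L2

variable {X : Type*} [MeasurableSpace X] {μ : Measure X}

theorem MeasureTheory.MemLp.starRingEnd {f : X → ℂ} {p : ENNReal} (hf : MemLp f p μ) :
    MemLp (fun x => starRingEnd ℂ (f x)) p μ := by
  have := hf.star
  exact this

theorem L2_inner_eq_integral (f g : Lp ℂ 2 μ) :
    inner ℂ f g = ∫ x, starRingEnd ℂ (f x) * g x ∂μ := by
  rw [L2.inner_def]
  simp only [RCLike.inner_apply']

theorem L2_inner_eq_integral_of_ae {f g : Lp ℂ 2 μ} {φ ψ : X → ℂ} (hf : f =ᵐ[μ] φ)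
    (hg : g =ᵐ[μ] ψ) : inner ℂ f g = ∫ x, starRingEnd ℂ (φ x) * ψ x ∂μ := by
  rw [L2_inner_eq_integral]
  refine integral_congr_ae ?_
  filter_upwards [hf, hg] with x h1 h2
  rw [h1, h2]

theorem integral_mul_eq_inner {ψ : X → ℂ} (hψ : MemLp ψ 2 μ) (f : Lp ℂ 2 μ) :
    ∫ x, f x * ψ x ∂μ = inner ℂ (hψ.starRingEnd.toLp) f := by
  rw [L2_inner_eq_integral_of_ae hψ.starRingEnd.coeFn_toLp (Filter.EventuallyEq.refl _ f)]
  simp [mul_comm]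

end L2

/-! ### Weak derivatives of elements of H²₀ -/

section WeakDerivative

variable {V : Type*} [NormedAddCommGroup V] [NormedSpace ℝ V] [FiniteDimensional ℝ V]
  [MeasurableSpace V] [BorelSpace V] (μ : Measure V) [μ.IsAddHaarMeasure] {G : Set V}

theorem setIntegral_dirDeriv_mul (hG : IsOpen G) {φ ψ : V → ℂ} (hφ : ContDiff ℝ ∞ φ)
    (hψ : ContDiff ℝ ∞ ψ) (hs : HasCompactSupport ψ) (h0 : ∀ p ∈ frontier G, ψ p = 0) (v : V) :
    ∫ x in G, dirDeriv v φ x * ψ x ∂μ = ∫ x in G, φ x * -dirDeriv v ψ x ∂μ := by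
  have h := setIntegral_dirDeriv_eq_zero μ hG (hφ.mul hψ) (hs.mul_left (f := φ))
    (fun p hp => by simp [h0 p hp]) v
  have e : (fun x => φ x * ψ x) = φ * ψ := rfl
  rw [e, dirDeriv_mul hφ hψ] at h
  have i1 : Integrable (fun x => φ x * dirDeriv v ψ x) (μ.restrict G) :=
    ((hφ.continuous.mul (hψ.dirDeriv v).continuous).integrable_of_hasCompactSupport
      ((hs.dirDeriv v).mul_left (f := φ))).restrict
  have i2 : Integrable (fun x => ψ x * dirDeriv v φ x) (μ.restrict G) :=
    ((hψ.continuous.mul (hφ.dirDeriv v).continuous).integrable_of_hasCompactSupport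
      (hs.mul_right (f' := dirDeriv v φ))).restrict
  simp only [Pi.add_apply, Pi.mul_apply] at h
  rw [integral_add i1 i2] at h
  simp only [mul_neg, integral_neg]
  rw [eq_neg_iff_add_eq_zero, add_comm, ← h]
  simp only [mul_comm]

/-- Iterated integration by parts. The support inside `G` is preserved at each step, so there are no
boundary terms even though `φ` is not required to vanish on the frontier. -/
theorem exists_formal_adjoint (hG : IsOpen G) {d : ℕ} (e : Fin d → V) (a : MultiIndex d)
    {ψ : V → ℂ} (hψ : ContDiff ℝ ∞ ψ) (hs : HasCompactSupport ψ) (ht : tsupport ψ ⊆ G) :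
    ∃ ψ' : V → ℂ, ContDiff ℝ ∞ ψ' ∧ HasCompactSupport ψ' ∧
      ∀ φ, ContDiff ℝ ∞ φ →
        ∫ x in G, partialDeriv e a φ x * ψ x ∂μ = ∫ x in G, φ x * ψ' x ∂μ := by
  have vanish : ∀ {ψ : V → ℂ}, tsupport ψ ⊆ G → ∀ p ∈ frontier G, ψ p = 0 := by
    intro ψ ht p hp
    rw [frontier, hG.interior_eq] at hp
    exact image_eq_zero_of_notMem_tsupport fun h => hp.2 (ht h)
  have step : ∀ (v : V) (k : ℕ) {ψ : V → ℂ}, ContDiff ℝ ∞ ψ → HasCompactSupport ψ →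
      tsupport ψ ⊆ G → ∃ ψ' : V → ℂ, ContDiff ℝ ∞ ψ' ∧ HasCompactSupport ψ' ∧ tsupport ψ' ⊆ G ∧
      ∀ φ, ContDiff ℝ ∞ φ →
        ∫ x in G, (dirDeriv v)^[k] φ x * ψ x ∂μ = ∫ x in G, φ x * ψ' x ∂μ := by
    intro v k
    induction k with
    | zero => intro ψ h1 h2 h3; exact ⟨ψ, h1, h2, h3, fun φ _ => rfl⟩
    | succ k ih =>
      intro ψ h1 h2 h3
      obtain ⟨ψ', g1, g2, g3, g4⟩ := ih h1 h2 h3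
      refine ⟨fun x => -dirDeriv v ψ' x, (g1.dirDeriv v).neg, (g2.dirDeriv v).comp_left (g := fun z => -z) (by simp), ?_, ?_⟩
      · have : tsupport (fun x => -dirDeriv v ψ' x) = tsupport (dirDeriv v ψ') := by
          simp [tsupport, Function.support_fun_neg]
        rw [this]
        exact (tsupport_dirDeriv_subset ψ' v).trans g3
      · intro φ hφ
        rw [Function.iterate_succ_apply, g4 _ (hφ.dirDeriv v)]
        exact setIntegral_dirDeriv_mul μ hG hφ g1 g2 (vanish g3) v
  unfold partialDeriv
  have main : ∀ (l : List (Fin d)) {ψ : V → ℂ}, ContDiff ℝ ∞ ψ → HasCompactSupport ψ →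
      tsupport ψ ⊆ G → ∃ ψ' : V → ℂ, ContDiff ℝ ∞ ψ' ∧ HasCompactSupport ψ' ∧ tsupport ψ' ⊆ G ∧
      ∀ φ, ContDiff ℝ ∞ φ →
        ∫ x in G, l.foldr (fun i g => (dirDeriv (e i))^[(a.1 i : ℕ)] g) φ x * ψ x ∂μ
          = ∫ x in G, φ x * ψ' x ∂μ := by
    intro l
    induction l with
    | nil => intro ψ h1 h2 h3; exact ⟨ψ, h1, h2, h3, fun φ _ => rfl⟩
    | cons i l ih =>
      intro ψ h1 h2 h3
      obtain ⟨ψ', g1, g2, g3, g4⟩ := step (e i) (a.1 i) h1 h2 h3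
      obtain ⟨ψ'', k1, k2, k3, k4⟩ := ih g1 g2 g3
      refine ⟨ψ'', k1, k2, k3, fun φ hφ => ?_⟩
      rw [List.foldr_cons, g4 _ ?_, k4 φ hφ]
      exact foldr_dirDeriv_induction e _ (fun φ => ContDiff ℝ ∞ φ)
        (fun _ _ h => h.dirDeriv _) hφ _
  obtain ⟨ψ', h1, h2, -, h4⟩ := main (List.finRange d) hψ hs ht
  exact ⟨ψ', h1, h2, h4⟩

/-- An element of `H²₀` is determined by its function component. -/
theorem H20_eq_zero_of_none (hG : IsOpen G) {d : ℕ} {e : Fin d → V}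
    {U : Jet d (μ.restrict G)} (hU : U ∈ H20 e (μ.restrict G) G)
    (h0 : U (MultiIndex.none d) = 0) : U = 0 := by
  ext1 a
  rw [PiLp.zero_apply, Lp.eq_zero_iff_ae_eq_zero]
  -- Fundamental lemma of the calculus of variations: against a test function supported in `G`, the
  -- component at `a` reduces to the component at the multi-index zero.
  have key : ∀ᵐ x ∂μ, x ∈ G → U a x = 0 := by
    refine hG.ae_eq_zero_of_integral_contDiff_smul_eq_zero ?_ ?_
    · exact locallyIntegrableOn_of_locallyIntegrable_restrict
        ((Lp.memLp (U a)).locallyIntegrable (by norm_num))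
    · intro g hg hs ht
      let ψ : V → ℂ := fun x => (g x : ℂ)
      have hψ : ContDiff ℝ ∞ ψ := Complex.ofRealCLM.contDiff.comp hg
      have hψs : HasCompactSupport ψ := hs.comp_left (g := ((↑) : ℝ → ℂ)) (by simp)
      have hψt : tsupport ψ ⊆ G := (closure_mono (Function.support_comp_subset (g := ((↑) : ℝ → ℂ))
        (by simp) g)).trans ht
      obtain ⟨ψ', h1, h2, h4⟩ := exists_formal_adjoint μ hG e a hψ hψs hψt
      have m1 : MemLp ψ 2 (μ.restrict G) := hψ.continuous.memLp_of_hasCompactSupport hψs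
      have m2 : MemLp ψ' 2 (μ.restrict G) := h1.continuous.memLp_of_hasCompactSupport h2
      have hUa : ∫ x in G, U a x * ψ x ∂μ = ∫ x in G, U (MultiIndex.none d) x * ψ' x ∂μ := by
        refine H20_induction (P := fun U => ∫ x in G, U a x * ψ x ∂μ
          = ∫ x in G, U (MultiIndex.none d) x * ψ' x ∂μ) ?_ ?_ hU
        · simp only [integral_mul_eq_inner m1, integral_mul_eq_inner m2]
          exact isClosed_eq (by fun_prop) (by fun_prop)
        · intro U φ hφ hUφ
          have e1 : ∫ x in G, U a x * ψ x ∂μ = ∫ x in G, partialDeriv e a φ x * ψ x ∂μ :=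
            integral_congr_ae ((hUφ a).mul (Filter.EventuallyEq.refl _ ψ))
          have e2 : ∫ x in G, U (MultiIndex.none d) x * ψ' x ∂μ = ∫ x in G, φ x * ψ' x ∂μ := by
            have := hUφ (MultiIndex.none d)
            rw [partialDeriv_none] at this
            exact integral_congr_ae (this.mul (Filter.EventuallyEq.refl _ ψ'))
          rw [e1, e2, h4 φ hφ.1]
      have hz : ∫ x in G, U (MultiIndex.none d) x * ψ' x ∂μ = 0 := by
        rw [integral_mul_eq_inner m2, h0, inner_zero_right]
      rw [hz] at hUa
      rw [← hUa, ← setIntegral_eq_integral_of_forall_compl_eq_zero (s := G)]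
      · refine integral_congr_ae (Filter.Eventually.of_forall fun x => ?_)
        simp [ψ, mul_comm]
      · intro x hx
        have : g x = 0 := image_eq_zero_of_notMem_tsupport fun h => hx (ht h)
        simp [this]
  rw [Filter.EventuallyEq, ae_restrict_iff' hG.measurableSet]
  exact key

/-- Density is applied first in `U` and then in `W`. For test functions the identity is an
integration by parts in which the conjugate of the second one vanishes on the frontier. -/
theorem H20_inner_second (hG : IsOpen G) {d : ℕ} {e : Fin d → V}
    {U W : Jet d (μ.restrict G)} (hU : U ∈ H20 e (μ.restrict G) G)
    (hW : W ∈ H20 e (μ.restrict G) G) (i : Fin d) :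
    inner ℂ (W (MultiIndex.none d)) (U (MultiIndex.second i))
      = -inner ℂ (W (MultiIndex.first i)) (U (MultiIndex.first i)) := by
  refine H20_induction (P := fun U => inner ℂ (W (MultiIndex.none d)) (U (MultiIndex.second i))
      = -inner ℂ (W (MultiIndex.first i)) (U (MultiIndex.first i))) ?_ ?_ hU
  · exact isClosed_eq (by fun_prop) (by fun_prop)
  intro U φ hφ hUφ
  refine H20_induction (P := fun W => inner ℂ (W (MultiIndex.none d)) (U (MultiIndex.second i))
      = -inner ℂ (W (MultiIndex.first i)) (U (MultiIndex.first i))) ?_ ?_ hW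
  · exact isClosed_eq (by fun_prop) (by fun_prop)
  intro W ψ hψ hWψ
  rw [L2_inner_eq_integral_of_ae (hWψ _) (hUφ _), L2_inner_eq_integral_of_ae (hWψ _) (hUφ _),
    partialDeriv_none, partialDeriv_second, partialDeriv_first, partialDeriv_first]
  have h := setIntegral_dirDeriv_mul μ hG (hφ.1.dirDeriv (e i)) hψ.1.starRingEnd_comp
    (hψ.2.1.comp_left (g := starRingEnd ℂ) (by simp)) (fun p hp => by simp [hψ.2.2 p hp]) (e i)
  simp only [dirDeriv_star, mul_neg, integral_neg] at h
  simp only [mul_comm (starRingEnd ℂ _)]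
  exact h

end WeakDerivative

/-! ### The Dirichlet resolvent of the cross-section -/

section CrossSection

/-- Bounded inverse theorem on a closed subspace. -/
theorem exists_norm_le_of_bijOn {E F : Type*} [NormedAddCommGroup E] [NormedSpace ℂ E]
    [CompleteSpace E] [NormedAddCommGroup F] [NormedSpace ℂ F] [CompleteSpace F]
    (A : E →L[ℂ] F) {X : Submodule ℂ E} (hX : IsClosed (X : Set E))
    (hinj : ∀ x ∈ X, A x = 0 → x = 0) (hsurj : ∀ y, ∃ x ∈ X, A x = y) :
    ∃ C : ℝ, 0 ≤ C ∧ ∀ x ∈ X, ‖x‖ ≤ C * ‖A x‖ := by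
  have : CompleteSpace X := hX.completeSpace_coe
  let S : X →L[ℂ] F := A.comp X.subtypeL
  have hker : S.ker = ⊥ := by
    rw [Submodule.eq_bot_iff]
    exact fun x hx => Subtype.ext (hinj x.1 x.2 hx)
  have hrange : S.range = ⊤ := by
    rw [Submodule.eq_top_iff']
    intro y
    obtain ⟨x, hx, hy⟩ := hsurj y
    exact ⟨⟨x, hx⟩, hy⟩
  let e := ContinuousLinearEquiv.ofBijective S hker hrange
  refine ⟨‖(e.symm : F →L[ℂ] X)‖, norm_nonneg _, fun x hx => ?_⟩
  have h := (e.symm : F →L[ℂ] X).le_opNorm (S ⟨x, hx⟩)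
  have h2 : e.symm (S ⟨x, hx⟩) = ⟨x, hx⟩ := e.symm_apply_apply _
  rw [ContinuousLinearEquiv.coe_coe, h2] at h
  exact h

variable {n : ℕ} {Ω : Set (EuclideanSpace ℝ (Fin n))}

/-- `Δ_Ω - μ` as a continuous linear map on jets. -/
noncomputable def crossLaplacianSubCLM (Ω : Set (EuclideanSpace ℝ (Fin n))) (μ : ℂ) :
    Jet n (volume.restrict Ω) →L[ℂ] Lp ℂ 2 (volume.restrict Ω) :=
  -(∑ i, PiLp.proj 2 _ (MultiIndex.second i)) - μ • PiLp.proj 2 _ (MultiIndex.none n)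

theorem crossLaplacianSubCLM_apply (μ : ℂ) (U : Jet n (volume.restrict Ω)) :
    crossLaplacianSubCLM Ω μ U = crossLaplacianSub μ U := by
  simp [crossLaplacianSubCLM, crossLaplacianSub]

theorem inner_crossLaplacianSub (hΩ : IsOpen Ω) (μ : ℂ) {U W : Jet n (volume.restrict Ω)}
    (hU : U ∈ H20CrossSection Ω) (hW : W ∈ H20CrossSection Ω) :
    inner ℂ (W (MultiIndex.none n)) (crossLaplacianSub μ U)
      = ∑ i, inner ℂ (W (MultiIndex.first i)) (U (MultiIndex.first i))
        - μ * inner ℂ (W (MultiIndex.none n)) (U (MultiIndex.none n)) := by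
  rw [crossLaplacianSub, inner_sub_right, inner_neg_right, inner_sum, inner_smul_right]
  simp only [H20_inner_second volume hΩ hU hW, Finset.sum_neg_distrib, neg_neg]

/-- `T` is the inverse of `Δ_Ω - μ` with domain `H²₀(Ω)`. -/
structure IsDirichletResolvent (Ω : Set (EuclideanSpace ℝ (Fin n))) (μ : ℂ)
    (T : Lp ℂ 2 (volume.restrict Ω) →L[ℂ] Lp ℂ 2 (volume.restrict Ω)) : Prop where
  right_inv : ∀ f, ∃ U ∈ H20CrossSection Ω,
    U (MultiIndex.none n) = T f ∧ crossLaplacianSub μ U = f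
  left_inv : ∀ U ∈ H20CrossSection Ω, T (crossLaplacianSub μ U) = U (MultiIndex.none n)

theorem notMem_dirichletSpectrum_iff {μ : ℂ} :
    μ ∉ dirichletSpectrum Ω ↔ ∃ T, IsDirichletResolvent Ω μ T := by
  rw [dirichletSpectrum, Set.mem_ofPred_eq, not_not]
  exact ⟨fun ⟨T, h1, h2⟩ => ⟨T, h1, h2⟩, fun ⟨T, h1, h2⟩ => ⟨T, h1, h2⟩⟩

namespace IsDirichletResolvent

variable {μ : ℂ} {T : Lp ℂ 2 (volume.restrict Ω) →L[ℂ] Lp ℂ 2 (volume.restrict Ω)}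

/-- Regularity: the `H²` norm is controlled by the Laplacian. -/
theorem exists_norm_le (hT : IsDirichletResolvent Ω μ T) (hΩ : IsOpen Ω) :
    ∃ C : ℝ, 0 ≤ C ∧ ∀ U ∈ H20CrossSection Ω, ‖U‖ ≤ C * ‖crossLaplacianSub μ U‖ := by
  -- The domain H²₀(Ω) is complete in the full H² norm, and Δ_Ω - μ maps it bijectively onto L²(Ω).
  -- The bounded inverse theorem therefore bounds all second derivatives.
  have hinj : ∀ U ∈ H20Submodule (yDir n) (volume.restrict Ω) Ω,
      crossLaplacianSubCLM Ω μ U = 0 → U = 0 := by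
    intro U hU h1
    rw [crossLaplacianSubCLM_apply] at h1
    have h2 := hT.left_inv U hU
    rw [h1, map_zero] at h2
    exact H20_eq_zero_of_none volume hΩ hU h2.symm
  have hsurj : ∀ f, ∃ U ∈ H20Submodule (yDir n) (volume.restrict Ω) Ω,
      crossLaplacianSubCLM Ω μ U = f := by
    intro f
    obtain ⟨U, hU, -, hf⟩ := hT.right_inv f
    exact ⟨U, hU, (crossLaplacianSubCLM_apply _ _).trans hf⟩
  obtain ⟨C, hC, h⟩ := exists_norm_le_of_bijOn (crossLaplacianSubCLM Ω μ)
    (testJets _ _ _).isClosed_topologicalClosure hinj hsurj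
  exact ⟨C, hC, fun U hU => by simpa only [crossLaplacianSubCLM_apply] using h U hU⟩

/-- For real `μ₀` the form of Δ_Ω - μ₀ is Hermitian on H²₀(Ω), and this passes to the inverse. -/
theorem isSymmetric {μ₀ : ℝ} (hT : IsDirichletResolvent Ω μ₀ T) (hΩ : IsOpen Ω) :
    T.IsSymmetric := by
  intro f g
  obtain ⟨W, hW, hW0, rfl⟩ := hT.right_inv f
  obtain ⟨U, hU, hU0, rfl⟩ := hT.right_inv g
  change inner ℂ (T _) _ = inner ℂ _ (T _)
  rw [← hW0, ← hU0, inner_crossLaplacianSub hΩ _ hU hW,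
    ← inner_conj_symm (crossLaplacianSub _ W), inner_crossLaplacianSub hΩ _ hW hU]
  simp [map_sub, map_sum, inner_conj_symm]

theorem injective (hT : IsDirichletResolvent Ω μ T) (hΩ : IsOpen Ω) {f}
    (h : T f = 0) : f = 0 := by
  obtain ⟨U, hU, hU0, rfl⟩ := hT.right_inv f
  rw [H20_eq_zero_of_none volume hΩ hU (hU0.trans h), ← crossLaplacianSubCLM_apply, map_zero]

end IsDirichletResolvent

end CrossSection

/-! ### A criterion for compactness -/

section CompactOperator

/-- Finitely many functionals send the unit ball to a bounded, hence totally bounded, set in finite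
dimension. Points of the ball whose functional values are close have close images, so a finite net
of values yields a finite net for the image of `T`. -/
theorem isCompactOperator_of_forall_norm_sq_le {X H ι : Type*} [NormedAddCommGroup X]
    [NormedSpace ℂ X] [NormedAddCommGroup H] [NormedSpace ℂ H] [CompleteSpace H]
    (T : X →L[ℂ] H) (φ : ι → X →L[ℂ] ℂ)
    (h : ∀ ε : ℝ, 0 < ε → ∃ s : Finset ι, ∀ x, ‖T x‖ ^ 2 ≤ ∑ k ∈ s, ‖φ k x‖ ^ 2 + ε * ‖x‖ ^ 2) :
    IsCompactOperator T := by
  refine (isCompactOperator_iff_isCompact_closure_image_ball (T : X →ₗ[ℂ] H) one_pos).2 ?_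
  refine isCompact_iff_totallyBounded_isComplete.2
    ⟨TotallyBounded.closure ?_, isClosed_closure.isComplete⟩
  rw [Metric.totallyBounded_iff]
  intro ε hε
  -- Differences of points of the unit ball have norm at most 2, so the error term is at most ε²/2.
  -- The choice of `δ` below keeps the functionals at ε²/4, and the total stays under ε².
  obtain ⟨s, hs⟩ := h (ε ^ 2 / 8) (by positivity)
  let P : X →L[ℂ] (s → ℂ) := ContinuousLinearMap.pi fun k => φ k
  have hb : TotallyBounded (P '' Metric.ball 0 1) := by
    have : Bornology.IsBounded (P '' Metric.ball 0 1) :=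
      P.lipschitz.isBounded_image Metric.isBounded_ball
    exact this.isCompact_closure.totallyBounded.subset subset_closure
  let δ : ℝ := ε / (2 * (s.card + 1))
  have hδ : 0 < δ := by positivity
  obtain ⟨t, hts, htf, hcov⟩ := Metric.finite_approx_of_totallyBounded hb δ hδ
  have hts' : ∀ p ∈ t, ∃ x ∈ Metric.ball (0 : X) 1, P x = p := hts
  choose! x hx using hts'
  refine ⟨(fun p => T (x p)) '' t, htf.image _, ?_⟩
  rintro _ ⟨y, hy, rfl⟩
  obtain ⟨p, hp, hyp⟩ := Set.mem_iUnion₂.1 (hcov ⟨y, hy, rfl⟩)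
  refine Set.mem_iUnion₂.2 ⟨_, ⟨p, hp, rfl⟩, ?_⟩
  rw [Metric.mem_ball, dist_eq_norm] at hyp ⊢
  change ‖T y - T (x p)‖ < ε
  rw [← (hx p hp).2, ← map_sub] at hyp
  rw [← map_sub]
  have h1 : ‖y - x p‖ ≤ 2 := by
    have h3 := (hx p hp).1
    rw [mem_ball_zero_iff] at h3 hy
    linarith [norm_sub_le y (x p)]
  have h2 : ∑ k ∈ s, ‖φ k (y - x p)‖ ^ 2 ≤ s.card * δ ^ 2 := by
    rw [← nsmul_eq_mul]
    refine Finset.sum_le_card_nsmul _ _ _ fun k hk => ?_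
    have h3 := (norm_le_pi_norm (P (y - x p)) ⟨k, hk⟩).trans hyp.le
    exact pow_le_pow_left₀ (norm_nonneg _) h3 2
  have h3 : (s.card : ℝ) * δ ^ 2 ≤ ε ^ 2 / 4 := by
    have hc : (0 : ℝ) ≤ s.card := Nat.cast_nonneg _
    have : (s.card : ℝ) * δ ^ 2 = ε ^ 2 / 4 * (s.card / (s.card + 1) ^ 2) := by
      simp only [δ]; field_simp; ring
    rw [this]
    refine mul_le_of_le_one_right (by positivity) ?_
    rw [div_le_one (by positivity)]
    nlinarith
  have h4 := hs (y - x p)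
  have h5 : ‖y - x p‖ ^ 2 ≤ 4 := by nlinarith [norm_nonneg (y - x p)]
  have h6 : ‖T (y - x p)‖ ^ 2 < ε ^ 2 := by nlinarith
  exact lt_of_pow_lt_pow_left₀ 2 hε.le h6

end CompactOperator

/-! ### Fourier series on a box -/

section Fourier

open UnitAddTorus Complex

attribute [local instance] instMeasureSpaceUnitAddCircle

variable {n : ℕ}

/-- The torus is cut open to the cube (-1/2, 1/2]ⁿ and dilated by `2 * r`. Since `f` vanishes off
the open box, the integral over the cube is one over the whole space. -/
theorem torus_integral_rescale {F : Type*} [NormedAddCommGroup F] [NormedSpace ℝ F]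
    {r : ℝ} (hr : 0 < r) (f : EuclideanSpace ℝ (Fin n) → F)
    (hf : ∀ y, f y ≠ 0 → ∀ i, |y i| < r) :
    ∫ t : UnitAddTorus (Fin n), f (WithLp.toLp 2
        ((2 * r) • (measurableEquivPiIoc (fun _ : Fin n => (-1 / 2 : ℝ)) t).1))
      = ((2 * r) ^ n)⁻¹ • ∫ y, f y := by
  set a : Fin n → ℝ := fun _ => -1 / 2
  rw [integral_preimage _ a]
  have h1 : ∀ x ∈ {x : Fin n → ℝ | ∀ i, x i ∈ Set.Ioc (a i) (a i + 1)},
      f (WithLp.toLp 2 ((2 * r) • (measurableEquivPiIoc a (fun i => (x i : UnitAddCircle))).1))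
        = f (WithLp.toLp 2 ((2 * r) • x)) := by
    intro x hx
    have := (measurableEquivPiIoc a).apply_symm_apply ⟨x, hx⟩
    rw [coe_symm_measurableEquivPiIoc_apply] at this
    rw [this]
  have hm : MeasurableSet {x : Fin n → ℝ | ∀ i, x i ∈ Set.Ioc (a i) (a i + 1)} :=
    MeasurableSet.univ_pi' fun i => measurableSet_Ioc
  rw [setIntegral_congr_fun hm h1, setIntegral_eq_integral_of_forall_compl_eq_zero,
    Measure.integral_comp_smul volume (fun x : Fin n → ℝ => f (WithLp.toLp 2 x)),
    ← (EuclideanSpace.volume_preserving_symm_measurableEquiv_toLp (Fin n)).integral_comp'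
      (fun x => f (WithLp.toLp 2 x))]
  · simp only [Module.finrank_fintype_fun_eq_card, Fintype.card_fin]
    rw [abs_of_nonneg (by positivity)]
    rfl
  · intro x hx
    by_contra hne
    refine hx fun i => ?_
    have := hf _ hne i
    simp only [Pi.smul_apply, smul_eq_mul, abs_mul, abs_of_pos hr] at this
    rw [abs_of_pos (by norm_num : (0:ℝ) < 2)] at this
    have h2 : |x i| < 1 / 2 := by nlinarith
    rw [abs_lt] at h2
    constructor <;> simp only [a] <;> linarith

/-- The plane wave of frequency `k` and period `2 r`. -/
noncomputable def planeWave (r : ℝ) (k : Fin n → ℤ) (y : EuclideanSpace ℝ (Fin n)) : ℂ :=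
  cexp ((Real.pi / r * ∑ i, (k i : ℝ) * y i : ℝ) * I)

theorem planeWave_contDiff (r : ℝ) (k : Fin n → ℤ) : ContDiff ℝ ∞ (planeWave r k) := by
  unfold planeWave
  have : ContDiff ℝ ∞ fun y : EuclideanSpace ℝ (Fin n) =>
      (Real.pi / r * ∑ i, (k i : ℝ) * y i : ℝ) := by fun_prop
  exact ((Complex.ofRealCLM.contDiff.comp this).mul contDiff_const).cexp

theorem planeWave_norm (r : ℝ) (k : Fin n → ℤ) (y : EuclideanSpace ℝ (Fin n)) :
    ‖planeWave r k y‖ = 1 := norm_exp_ofReal_mul_I _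

theorem dirDeriv_planeWave (r : ℝ) (k : Fin n → ℤ) (j : Fin n) (y : EuclideanSpace ℝ (Fin n)) :
    dirDeriv (yDir n j) (planeWave r k) y = (Real.pi / r * k j : ℝ) * I * planeWave r k y := by
  let ℓ : EuclideanSpace ℝ (Fin n) →L[ℝ] ℝ :=
    (Real.pi / r) • ∑ i, (k i : ℝ) • (EuclideanSpace.proj i : EuclideanSpace ℝ (Fin n) →L[ℝ] ℝ)
  have hℓ : ∀ y, ℓ y = Real.pi / r * ∑ i, (k i : ℝ) * y i := fun y => by
    simp [ℓ]
  have hw : planeWave r k = fun y => cexp (ofRealCLM (ℓ y) * I) := by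
    ext y; simp only [planeWave, hℓ, ofRealCLM_apply]
  have hd : HasFDerivAt (fun y => ofRealCLM (ℓ y) * I)
      (I • ofRealCLM.comp ℓ) y := by
    have := (ofRealCLM.comp ℓ).hasFDerivAt (x := y)
    simpa using this.mul_const' I
  have hd2 := hd.cexp
  have hv : ℓ (yDir n j) = Real.pi / r * k j := by
    rw [hℓ, Finset.sum_eq_single j]
    · simp [yDir]
    · intro i _ hi; simp [yDir, hi]
    · simp
  rw [dirDeriv, hw, hd2.fderiv]
  simp [hv]
  ring

theorem planeWave_eq_mFourier {r : ℝ} (hr : 0 < r) (k : Fin n → ℤ) (t : UnitAddTorus (Fin n)) :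
    planeWave r k (WithLp.toLp 2
      ((2 * r) • (measurableEquivPiIoc (fun _ : Fin n => (-1 / 2 : ℝ)) t).1)) = mFourier k t := by
  set a : Fin n → ℝ := fun _ => -1 / 2
  set x := measurableEquivPiIoc a t with hx
  have ht : t = fun i => (x.1 i : UnitAddCircle) := by
    rw [← coe_symm_measurableEquivPiIoc_apply a x, hx, MeasurableEquiv.symm_apply_apply]
  conv_rhs => rw [ht]
  simp only [mFourier, ContinuousMap.coe_mk, fourier_coe_apply, planeWave]
  rw [← Complex.exp_sum]
  congr 1
  push_cast
  simp only [Pi.smul_apply, smul_eq_mul, Finset.mul_sum, Finset.sum_mul]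
  refine Finset.sum_congr rfl fun i _ => ?_
  have : (r : ℂ) ≠ 0 := by exact_mod_cast hr.ne'
  push_cast
  field_simp

/-- **Parseval's identity** on a bounded set contained in a box. -/
theorem hasSum_sq_planeWave {Ω : Set (EuclideanSpace ℝ (Fin n))} (hΩ : MeasurableSet Ω)
    {r : ℝ} (hr : 0 < r) (hΩr : ∀ y ∈ Ω, ∀ i, |y i| < r) (hΩb : Bornology.IsBounded Ω)
    {g : EuclideanSpace ℝ (Fin n) → ℂ} (hg : Continuous g) :
    HasSum (fun k : Fin n → ℤ => ‖∫ y in Ω, planeWave r (-k) y * g y‖ ^ 2)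
      ((2 * r) ^ n * ∫ y in Ω, ‖g y‖ ^ 2) := by
  let ρ : UnitAddTorus (Fin n) → EuclideanSpace ℝ (Fin n) := fun t => WithLp.toLp 2
    ((2 * r) • (measurableEquivPiIoc (fun _ : Fin n => (-1 / 2 : ℝ)) t).1)
  have hρ : Measurable ρ := by
    refine (MeasurableEquiv.toLp 2 (Fin n → ℝ)).measurable.comp ?_
    exact (measurable_subtype_coe.comp (measurableEquivPiIoc _).measurable).const_smul (2 * r)
  let G : UnitAddTorus (Fin n) → ℂ := fun t => Ω.indicator g (ρ t)
  have hGm : Measurable G := (hg.measurable.indicator hΩ).comp hρ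
  obtain ⟨C, hC⟩ : ∃ C, ∀ y ∈ Ω, ‖g y‖ ≤ C := by
    obtain ⟨C, hC⟩ := hΩb.isCompact_closure.exists_bound_of_continuousOn hg.continuousOn
    exact ⟨C, fun y hy => hC y (subset_closure hy)⟩
  have : IsProbabilityMeasure (volume : Measure UnitAddCircle) :=
    inferInstanceAs (IsProbabilityMeasure AddCircle.haarAddCircle)
  have hGL : MemLp G 2 := by
    refine MemLp.of_bound hGm.aestronglyMeasurable (max C 0) (Filter.Eventually.of_forall fun t => ?_)
    by_cases h : ρ t ∈ Ω
    · simp only [G, Set.indicator_of_mem h]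
      exact (hC _ h).trans (le_max_left _ _)
    · simp only [G, Set.indicator_of_notMem h, norm_zero]
      exact le_max_right _ _
  have hsum := hasSum_sq_mFourierCoeff (hGL.toLp G)
  have hI : ∫ t, ‖hGL.toLp G t‖ ^ 2 = ((2 * r) ^ n)⁻¹ * ∫ y in Ω, ‖g y‖ ^ 2 := by
    have h1 : ∫ t, ‖hGL.toLp G t‖ ^ 2 = ∫ t, (fun y => ‖Ω.indicator g y‖ ^ 2) (ρ t) := by
      refine integral_congr_ae ?_
      filter_upwards [hGL.coeFn_toLp] with t ht
      rw [ht]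
    rw [h1, torus_integral_rescale hr (fun y => ‖Ω.indicator g y‖ ^ 2), smul_eq_mul,
      ← integral_indicator hΩ]
    · congr 1
      refine integral_congr_ae (Filter.Eventually.of_forall fun y => ?_)
      by_cases hy : y ∈ Ω <;> simp [hy]
    · intro y hy
      have : y ∈ Ω := by
        by_contra h
        simp [h] at hy
      exact hΩr y this
  have hc : ∀ k, mFourierCoeff (hGL.toLp G) k
      = (((2 * r) ^ n)⁻¹ : ℝ) • ∫ y in Ω, planeWave r (-k) y * g y := by
    intro k
    have h1 : mFourierCoeff (hGL.toLp G) k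
        = ∫ t, (fun y => planeWave r (-k) y * Ω.indicator g y) (ρ t) := by
      refine integral_congr_ae ?_
      filter_upwards [hGL.coeFn_toLp] with t ht
      rw [ht, smul_eq_mul]
      simp only [ρ, planeWave_eq_mFourier hr, G]
    rw [h1, torus_integral_rescale hr (fun y => planeWave r (-k) y * Ω.indicator g y),
      ← integral_indicator hΩ]
    · congr 1
      refine integral_congr_ae (Filter.Eventually.of_forall fun y => ?_)
      by_cases hy : y ∈ Ω <;> simp [hy]
    · intro y hy
      have : y ∈ Ω := by
        by_contra h
        simp [h] at hy
      exact hΩr y this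
  rw [hI] at hsum
  have hpos : (0 : ℝ) < (2 * r) ^ n := by positivity
  -- The torus has mass one and the box has volume (2r)ⁿ. Squared coefficients scale by the square
  -- of this volume, the squared norm only by its first power.
  have h2 := hsum.mul_left (((2 * r) ^ n) ^ 2)
  have e1 : (fun k : Fin n → ℤ => ‖∫ y in Ω, planeWave r (-k) y * g y‖ ^ 2)
      = fun k => ((2 * r) ^ n) ^ 2 * ‖mFourierCoeff (hGL.toLp G) k‖ ^ 2 := by
    ext k
    rw [hc, norm_smul, Real.norm_of_nonneg (by positivity)]
    field_simp
  have e2 : (2 * r) ^ n * ∫ y in Ω, ‖g y‖ ^ 2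
      = ((2 * r) ^ n) ^ 2 * (((2 * r) ^ n)⁻¹ * ∫ y in Ω, ‖g y‖ ^ 2) := by
    field_simp
  rw [e1, e2]
  exact h2

/-- The boundary condition on `φ` removes the boundary terms, so the derivative acts on Fourier
coefficients by multiplication although the plane wave does not vanish on the frontier. -/
theorem setIntegral_planeWave_mul_dirDeriv {Ω : Set (EuclideanSpace ℝ (Fin n))} (hΩ : IsOpen Ω)
    {φ : EuclideanSpace ℝ (Fin n) → ℂ} (hφ : IsDirichletTest Ω φ) (r : ℝ) (k : Fin n → ℤ)
    (j : Fin n) :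
    ∫ y in Ω, planeWave r (-k) y * dirDeriv (yDir n j) φ y
      = (Real.pi / r * k j : ℝ) * I * ∫ y in Ω, planeWave r (-k) y * φ y := by
  have h := setIntegral_dirDeriv_mul volume hΩ (planeWave_contDiff r (-k)) hφ.1 hφ.2.1 hφ.2.2
    (yDir n j)
  simp only [mul_neg, integral_neg, dirDeriv_planeWave] at h
  rw [← neg_eq_iff_eq_neg] at h
  rw [← h, ← integral_const_mul, ← integral_neg]
  refine integral_congr_ae (Filter.Eventually.of_forall fun y => ?_)
  simp only [Pi.neg_apply]
  push_cast
  ring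

end Fourier

/-! ### Rellich's theorem -/

section Rellich

variable {n : ℕ} {Ω : Set (EuclideanSpace ℝ (Fin n))}

theorem L2_norm_sq_eq_integral {X : Type*} [MeasurableSpace X] {μ : Measure X} {f : Lp ℂ 2 μ}
    {φ : X → ℂ} (hf : f =ᵐ[μ] φ) : ‖f‖ ^ 2 = ∫ x, ‖φ x‖ ^ 2 ∂μ := by
  have h := L2_inner_eq_integral_of_ae hf hf
  rw [inner_self_eq_norm_sq_to_K] at h
  have h2 : ∫ x, starRingEnd ℂ (φ x) * φ x ∂μ = ((∫ x, ‖φ x‖ ^ 2 ∂μ : ℝ) : ℂ) := by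
    rw [← integral_complex_ofReal]
    refine integral_congr_ae (Filter.Eventually.of_forall fun x => ?_)
    simp only [Complex.conj_mul']
    push_cast; rfl
  rw [h2] at h
  exact Complex.ofReal_injective (by simpa using h)

/-- By Parseval both sides are sums over frequencies. A frequency outside the cube of half-width `N`
has some |k j| ≥ N, and its coefficient is then at most r/(πN) times that of the j-th derivative. -/
theorem norm_sq_le_sum_planeWave (hΩ : IsOpen Ω) (hΩb : Bornology.IsBounded Ω) {r : ℝ}
    (hr : 0 < r) (hΩr : ∀ y ∈ Ω, ∀ i, |y i| < r) {φ : EuclideanSpace ℝ (Fin n) → ℂ}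
    (hφ : IsDirichletTest Ω φ) {N : ℕ} (hN : 0 < N) :
    (2 * r) ^ n * ∫ y in Ω, ‖φ y‖ ^ 2
      ≤ ∑ k ∈ Finset.Icc (fun _ => -(N : ℤ)) (fun _ => (N : ℤ)),
          ‖∫ y in Ω, planeWave r (-k) y * φ y‖ ^ 2
        + (r / (Real.pi * N)) ^ 2 * ∑ j, (2 * r) ^ n * ∫ y in Ω, ‖dirDeriv (yDir n j) φ y‖ ^ 2 := by
  classical
  set s : Finset (Fin n → ℤ) := Finset.Icc (fun _ => -(N : ℤ)) (fun _ => (N : ℤ))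
  set c : (Fin n → ℤ) → ℝ := fun k => ‖∫ y in Ω, planeWave r (-k) y * φ y‖ ^ 2
  set d : Fin n → (Fin n → ℤ) → ℝ :=
    fun j k => ‖∫ y in Ω, planeWave r (-k) y * dirDeriv (yDir n j) φ y‖ ^ 2
  have hc := hasSum_sq_planeWave hΩ.measurableSet hr hΩr hΩb hφ.1.continuous
  have hd := fun j => hasSum_sq_planeWave hΩ.measurableSet hr hΩr hΩb
    (hφ.1.dirDeriv (yDir n j)).continuous
  have hR := (hasSum_sum_of_ne_finset_zero (f := fun k => if k ∈ s then c k else 0) (s := s)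
    (fun k hk => by simp [hk])).add
    ((hasSum_sum fun j (_ : j ∈ Finset.univ) => hd j).mul_left ((r / (Real.pi * N)) ^ 2))
  refine (hasSum_le (fun k => ?_) hc hR).trans (le_of_eq ?_)
  · have hd0 : ∀ j, 0 ≤ d j k := fun j => by positivity
    by_cases hk : k ∈ s
    · simp only [hk, if_true]
      have : 0 ≤ (r / (Real.pi * N)) ^ 2 * ∑ j, d j k :=
        mul_nonneg (by positivity) (Finset.sum_nonneg fun j _ => hd0 j)
      change c k ≤ c k + _
      linarith
    · simp only [hk, if_false, zero_add]
      obtain ⟨j, hj⟩ : ∃ j, (N : ℝ) ≤ |(k j : ℝ)| := by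
        by_contra! h
        refine hk (Finset.mem_Icc.2 ⟨fun j => ?_, fun j => ?_⟩)
        · have := (abs_lt.1 (h j)).1
          exact_mod_cast this.le
        · have := (abs_lt.1 (h j)).2
          exact_mod_cast this.le
      have h1 : d j k = (Real.pi / r * |(k j : ℝ)|) ^ 2 * c k := by
        simp only [d, c]
        rw [setIntegral_planeWave_mul_dirDeriv hΩ hφ, norm_mul, mul_pow]
        congr 2
        rw [norm_mul, Complex.norm_I, mul_one, Complex.norm_real, Real.norm_eq_abs, abs_mul,
          abs_of_pos (by positivity)]
      have h2 : c k ≤ (r / (Real.pi * N)) ^ 2 * d j k := by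
        have hN' : (0 : ℝ) < N := by exact_mod_cast hN
        have hpi := Real.pi_pos
        have h3 : (1 : ℝ) ≤ (|(k j : ℝ)| / N) ^ 2 := by
          have : (1 : ℝ) ≤ |(k j : ℝ)| / N := by rwa [le_div_iff₀ hN', one_mul]
          nlinarith
        have h4 : (r / (Real.pi * N)) ^ 2 * d j k = (|(k j : ℝ)| / N) ^ 2 * c k := by
          rw [h1]; field_simp
        rw [h4]
        exact le_mul_of_one_le_left (by positivity) h3
      refine h2.trans ?_
      gcongr
      exact Finset.single_le_sum (f := fun j => d j k) (fun j _ => hd0 j) (Finset.mem_univ j)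
  · congr 1
    exact Finset.sum_congr rfl fun k hk => by simp [hk, c]

/-- **Rellich's inequality**: up to small errors, the `L²` norm on `H²₀(Ω)` is controlled by
finitely many functionals. -/
theorem exists_rellich_functionals (hΩ : IsOpen Ω) (hΩb : Bornology.IsBounded Ω) :
    ∃ w : (Fin n → ℤ) → Lp ℂ 2 (volume.restrict Ω), ∀ ε : ℝ, 0 < ε →
      ∃ s : Finset (Fin n → ℤ), ∀ U ∈ H20CrossSection Ω,
        ‖U (MultiIndex.none n)‖ ^ 2
          ≤ ∑ k ∈ s, ‖inner ℂ (w k) (U (MultiIndex.none n))‖ ^ 2 + ε * ‖U‖ ^ 2 := by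
  have : IsFiniteMeasure (volume.restrict Ω) := isFiniteMeasure_restrict.2 hΩb.measure_lt_top.ne
  obtain ⟨r, hr, hΩr⟩ := hΩb.subset_ball_lt 0 0
  have hΩr' : ∀ y ∈ Ω, ∀ i, |y i| < r := fun y hy i => by
    have := hΩr hy
    rw [mem_ball_zero_iff] at this
    exact (PiLp.norm_apply_le y i).trans_lt this
  set L : ℝ := (2 * r) ^ n with hL
  have hLpos : 0 < L := by positivity
  have hm : ∀ k : Fin n → ℤ, MemLp (planeWave r (-k)) 2 (volume.restrict Ω) := fun k =>
    MemLp.of_bound (planeWave_contDiff r (-k)).continuous.aestronglyMeasurable 1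
      (Filter.Eventually.of_forall fun y => (planeWave_norm r (-k) y).le)
  refine ⟨fun k => ((Real.sqrt L)⁻¹ : ℂ) • (hm k).starRingEnd.toLp _, fun ε hε => ?_⟩
  -- The tail constant (r/(πN))² n has to be at most ε. The summand 1 forces N > 1, so that N ≤ N²
  -- and a linear lower bound on N suffices.
  obtain ⟨N, hN⟩ := exists_nat_gt (n * (r / Real.pi) ^ 2 / ε + 1)
  have hN1 : (1 : ℝ) < N := lt_of_le_of_lt (by
    have : 0 ≤ n * (r / Real.pi) ^ 2 / ε := by positivity
    linarith) hN
  have hN0 : 0 < N := by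
    have : (0 : ℝ) < N := by linarith
    exact_mod_cast this
  have hNε : (r / (Real.pi * N)) ^ 2 * n ≤ ε := by
    have h1 : n * (r / Real.pi) ^ 2 / ε ≤ (N : ℝ) ^ 2 := by nlinarith
    rw [div_le_iff₀ hε] at h1
    have h2 : (r / (Real.pi * N)) ^ 2 * n = n * (r / Real.pi) ^ 2 / (N : ℝ) ^ 2 := by
      field_simp
    rw [h2, div_le_iff₀ (by positivity)]
    linarith
  refine ⟨Finset.Icc (fun _ => -(N : ℤ)) (fun _ => (N : ℤ)), fun U hU => ?_⟩
  refine H20_induction (P := fun U : Jet n (volume.restrict Ω) => ‖U (MultiIndex.none n)‖ ^ 2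
    ≤ ∑ k ∈ Finset.Icc (fun _ => -(N : ℤ)) (fun _ => (N : ℤ)),
      ‖inner ℂ (((Real.sqrt L)⁻¹ : ℂ) • (hm k).starRingEnd.toLp _)
        (U (MultiIndex.none n))‖ ^ 2 + ε * ‖U‖ ^ 2) ?_ ?_ hU
  · exact isClosed_le (by fun_prop) (by fun_prop)
  intro U φ hφ hUφ
  have hU0 := hUφ (MultiIndex.none n)
  rw [partialDeriv_none] at hU0
  have key := norm_sq_le_sum_planeWave hΩ hΩb hr hΩr' hφ hN0
  rw [← L2_norm_sq_eq_integral hU0] at key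
  have hj : ∀ j, ∫ y in Ω, ‖dirDeriv (yDir n j) φ y‖ ^ 2 ≤ ‖U‖ ^ 2 := fun j => by
    have h1 := hUφ (MultiIndex.first j)
    rw [partialDeriv_first] at h1
    rw [← L2_norm_sq_eq_integral h1]
    exact pow_le_pow_left₀ (norm_nonneg _) (PiLp.norm_apply_le U _) 2
  have hk : ∀ k, ‖inner ℂ (((Real.sqrt L)⁻¹ : ℂ) • (hm k).starRingEnd.toLp _)
      (U (MultiIndex.none n))‖ ^ 2 = L⁻¹ * ‖∫ y in Ω, planeWave r (-k) y * φ y‖ ^ 2 := fun k => by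
    rw [inner_smul_left, ← integral_mul_eq_inner (hm k), norm_mul, mul_pow]
    congr 1
    · rw [RCLike.norm_conj, norm_inv, Complex.norm_real, Real.norm_of_nonneg (Real.sqrt_nonneg _),
        inv_pow, Real.sq_sqrt hLpos.le]
    · congr 2
      refine integral_congr_ae ?_
      filter_upwards [hU0] with y hy
      rw [hy, mul_comm]
  simp only [hk]
  rw [← Finset.mul_sum]
  have h5 : ∑ j, L * ∫ y in Ω, ‖dirDeriv (yDir n j) φ y‖ ^ 2 ≤ n * (L * ‖U‖ ^ 2) := by
    refine (Finset.sum_le_card_nsmul Finset.univ _ (L * ‖U‖ ^ 2) fun j _ => ?_).trans (le_of_eq ?_)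
    · exact mul_le_mul_of_nonneg_left (hj j) hLpos.le
    · simp
  have h6 : (r / (Real.pi * N)) ^ 2 * ∑ j, L * ∫ y in Ω, ‖dirDeriv (yDir n j) φ y‖ ^ 2
      ≤ L * (ε * ‖U‖ ^ 2) := by
    calc _ ≤ (r / (Real.pi * N)) ^ 2 * (n * (L * ‖U‖ ^ 2)) := by gcongr
      _ = (r / (Real.pi * N)) ^ 2 * n * (L * ‖U‖ ^ 2) := by ring
      _ ≤ ε * (L * ‖U‖ ^ 2) := by gcongr
      _ = _ := by ring
  have h7 := key.trans (add_le_add_right h6 _)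
  have h8 := mul_le_mul_of_nonneg_left h7 (inv_pos.2 hLpos).le
  rw [mul_add, inv_mul_cancel_left₀ hLpos.ne', inv_mul_cancel_left₀ hLpos.ne'] at h8
  exact h8

/-- The Dirichlet resolvent of a bounded open set is compact. -/
theorem IsDirichletResolvent.isCompactOperator {μ : ℂ}
    {T : Lp ℂ 2 (volume.restrict Ω) →L[ℂ] Lp ℂ 2 (volume.restrict Ω)}
    (hT : IsDirichletResolvent Ω μ T) (hΩ : IsOpen Ω) (hΩb : Bornology.IsBounded Ω) :
    IsCompactOperator T := by
  obtain ⟨w, hw⟩ := exists_rellich_functionals hΩ hΩb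
  obtain ⟨C, hC0, hC⟩ := hT.exists_norm_le hΩ
  refine isCompactOperator_of_forall_norm_sq_le T (fun k => (innerSL ℂ (w k)).comp T) ?_
  intro ε hε
  -- The jet of `T f` has norm at most C‖f‖, which converts the error in ‖U‖² into one in ‖f‖². The
  -- summand 1 covers the case C = 0.
  obtain ⟨s, hs⟩ := hw (ε / (C ^ 2 + 1)) (by positivity)
  refine ⟨s, fun f => ?_⟩
  obtain ⟨U, hU, hU0, hf⟩ := hT.right_inv f
  have h1 := hs U hU
  have h2 := hC U hU
  rw [hf] at h2
  rw [hU0] at h1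
  refine h1.trans (add_le_add le_rfl ?_)
  have h3 : ‖U‖ ^ 2 ≤ (C ^ 2 + 1) * ‖f‖ ^ 2 := by
    have := pow_le_pow_left₀ (norm_nonneg _) h2 2
    nlinarith [sq_nonneg ‖f‖]
  calc ε / (C ^ 2 + 1) * ‖U‖ ^ 2 ≤ ε / (C ^ 2 + 1) * ((C ^ 2 + 1) * ‖f‖ ^ 2) := by gcongr
    _ = ε * ‖f‖ ^ 2 := by field_simp

end Rellich

/-! ### Hilbert bases of eigenvectors -/

section EigenBasis

open Module.End

/-- Hilbert bases of the pieces together form an orthonormal family. A vector orthogonal to all of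
them is orthogonal to each `K i` by density, hence zero. -/
theorem OrthogonalFamily.exists_adapted_hilbertBasis.{u, v} {H : Type u} {ι : Type v} [NormedAddCommGroup H]
    [InnerProductSpace ℂ H] [CompleteSpace H] (K : ι → Submodule ℂ H)
    (hK : OrthogonalFamily ℂ (fun i => K i) fun i => (K i).subtypeₗᵢ)
    (hcl : ∀ i, IsClosed (K i : Set H)) (htop : (⨆ i, K i)ᗮ = ⊥) :
    ∃ (κ : Type (max u v)) (b : HilbertBasis κ ℂ H) (t : κ → ι), ∀ a, b a ∈ K (t a) := by
  have : ∀ i, CompleteSpace (K i) := fun i => (hcl i).completeSpace_coe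
  choose w b hb using fun i => exists_hilbertBasis ℂ (K i)
  let v : (Σ i, w i) → H := fun a => (K a.1).subtypeₗᵢ (b a.1 a.2)
  have hv : Orthonormal ℂ v :=
    hK.orthonormal_sigma_orthonormal (v_family := fun i => ⇑(b i)) (fun i => (b i).orthonormal)
  have hsp : (Submodule.span ℂ (Set.range v))ᗮ = ⊥ := by
    rw [Submodule.eq_bot_iff]
    intro x hx
    have hx' : x ∈ (⨆ i, K i)ᗮ := by
      rw [← Submodule.iInf_orthogonal, Submodule.mem_iInf]
      intro i
      rw [Submodule.mem_orthogonal]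
      intro u hu
      have hdense : (⟨u, hu⟩ : K i) ∈ (Submodule.span ℂ (Set.range (b i))).topologicalClosure := by
        rw [(b i).dense_span]; trivial
      refine closure_minimal (t := {u : K i | inner ℂ (u : H) x = 0})
        ?_ (isClosed_eq (by fun_prop) continuous_const) hdense
      intro z hz
      induction hz using Submodule.span_induction with
      | mem z hz =>
        obtain ⟨j, rfl⟩ := hz
        exact (Submodule.mem_orthogonal _ _).1 hx _ (Submodule.subset_span ⟨⟨i, j⟩, rfl⟩)
      | zero => simp
      | add p q _ _ h1 h2 =>
        simp only [Set.mem_ofPred_eq, Submodule.coe_add, inner_add_left] at h1 h2 ⊢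
        rw [h1, h2, add_zero]
      | smul c p _ h1 =>
        simp only [Set.mem_ofPred_eq, Submodule.coe_smul, inner_smul_left] at h1 ⊢
        rw [h1, mul_zero]
    rwa [htop, Submodule.mem_bot] at hx'
  refine ⟨_, HilbertBasis.mkOfOrthogonalEqBot hv hsp, fun a => a.1, fun a => ?_⟩
  rw [HilbertBasis.coe_mkOfOrthogonalEqBot]
  exact (b a.1 a.2).2

/-- A compact symmetric operator has a Hilbert basis of eigenvectors. -/
theorem exists_eigenvector_hilbertBasis.{u} {H : Type u} [NormedAddCommGroup H]
    [InnerProductSpace ℂ H] [CompleteSpace H] {T : H →L[ℂ] H} (hT : IsCompactOperator T)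
    (hs : T.IsSymmetric) :
    ∃ (ι : Type u) (b : HilbertBasis ι ℂ H) (t : ι → ℂ), ∀ i, T (b i) = t i • b i := by
  have hcl : ∀ μ : ℂ, IsClosed (eigenspace (T : Module.End ℂ H) μ : Set H) := fun μ => by
    have : (eigenspace (T : Module.End ℂ H) μ : Set H) = {x | T x = μ • x} :=
      Set.ext fun x => mem_eigenspace_iff
    rw [this]
    exact isClosed_eq T.continuous (by fun_prop)
  obtain ⟨κ, b, t, h⟩ := OrthogonalFamily.exists_adapted_hilbertBasis
    (fun μ => eigenspace (T : Module.End ℂ H) μ) hs.orthogonalFamily_eigenspaces hcl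
    (T.orthogonalComplement_iSup_eigenspaces_eq_bot hT hs)
  exact ⟨κ, b, t, fun i => mem_eigenspace_iff.1 (h i)⟩

/-- Distinct basis vectors lie √2 apart, so the balls of radius 1/2 around them are disjoint open
sets in a separable space. -/
theorem HilbertBasis.countable {ι H : Type*} [NormedAddCommGroup H] [InnerProductSpace ℂ H]
    [TopologicalSpace.SeparableSpace H] (b : HilbertBasis ι ℂ H) : Countable ι := by
  refine Pairwise.countable_of_isOpen_disjoint (s := fun i => Metric.ball (b i) (1 / 2)) ?_
    (fun i => Metric.isOpen_ball) (fun i => ⟨b i, Metric.mem_ball_self (by norm_num)⟩)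
  intro i j hij
  refine Metric.ball_disjoint_ball ?_
  have h0 : inner ℂ (b i) (b j) = 0 := b.orthonormal.2 hij
  have h1 : ‖b i - b j‖ ^ 2 = 2 := by
    rw [@norm_sub_sq ℂ, h0, b.orthonormal.1, b.orthonormal.1]
    norm_num
  rw [dist_eq_norm]
  nlinarith [norm_nonneg (b i - b j)]

end EigenBasis

/-! ### Exponents of the modes and the uniform gap -/

section SpectralData

/-- For real x the root is √x or i√|x|, so only Im λ or 1 + Re λ enters. Both are nonzero for the
parameters considered, and the quantity then grows like √|x|. -/
theorem abs_im_mul_cpow_half (lam : ℂ) (x : ℝ) :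
    |((1 + lam) * (x : ℂ) ^ (1 / 2 : ℂ)).im|
      = √|x| * (if 0 ≤ x then |lam.im| else |1 + lam.re|) := by
  split_ifs with hx
  · have h : (x : ℂ) ^ (1 / 2 : ℂ) = ((√x : ℝ) : ℂ) := by
      rw [Real.sqrt_eq_rpow, Complex.ofReal_cpow hx]; norm_num
    rw [h, abs_of_nonneg hx, Complex.im_mul_ofReal, abs_mul, abs_of_nonneg (Real.sqrt_nonneg x)]
    simp [mul_comm]
  · push Not at hx
    have h : (x : ℂ) ^ (1 / 2 : ℂ) = ((√(-x) : ℝ) : ℂ) * Complex.I := by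
      rw [Complex.ofReal_cpow_of_nonpos hx.le, Real.sqrt_eq_rpow,
        Complex.ofReal_cpow (by linarith : (0 : ℝ) ≤ -x)]
      congr 1
      · norm_num
      · rw [mul_one_div, show (Real.pi * Complex.I / 2 : ℂ) = (Real.pi / 2) * Complex.I by ring,
          Complex.exp_pi_div_two_mul_I]
    rw [h, abs_of_neg hx]
    have : ((1 + lam) * (((√(-x) : ℝ) : ℂ) * Complex.I)).im = √(-x) * (1 + lam.re) := by
      simp; ring
    rw [this, abs_mul, abs_of_nonneg (Real.sqrt_nonneg _)]

variable {n : ℕ} {Ω : Set (EuclideanSpace ℝ (Fin n))}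
  {T : Lp ℂ 2 (volume.restrict Ω) →L[ℂ] Lp ℂ 2 (volume.restrict Ω)} {μ₀ : ℝ}

/-- An eigenvector `f` of `T` for t is an eigenfunction of Δ_Ω for μ₀ + 1/t, which rules out a left
inverse of the operator shifted by that number. -/
theorem IsDirichletResolvent.mem_dirichletSpectrum (hT : IsDirichletResolvent Ω μ₀ T)
    {t : ℂ} (ht : t ≠ 0) {f : Lp ℂ 2 (volume.restrict Ω)} (hf : f ≠ 0) (h : T f = t • f) :
    (μ₀ : ℂ) + t⁻¹ ∈ dirichletSpectrum Ω := by
  by_contra hcon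
  obtain ⟨S, hS⟩ := notMem_dirichletSpectrum_iff.1 hcon
  obtain ⟨U, hU, hU0, hUf⟩ := hT.right_inv f
  have h1 : crossLaplacianSub (μ₀ + t⁻¹) U = 0 := by
    have : crossLaplacianSub (μ₀ + t⁻¹) U
        = crossLaplacianSub (μ₀ : ℂ) U - t⁻¹ • U (MultiIndex.none n) := by
      simp only [crossLaplacianSub, add_smul]; abel
    rw [this, hUf, hU0, h, smul_smul, inv_mul_cancel₀ ht, one_smul, sub_self]
  have h2 := hS.left_inv U hU
  rw [h1, map_zero, hU0, h] at h2
  exact (smul_ne_zero ht hf) h2.symm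

/-- Uniform version of the bound on the weight exponent. -/
theorem exists_uniform_gap (hT : IsDirichletResolvent Ω μ₀ T) (hΩ : IsOpen Ω)
    (hΩb : Bornology.IsBounded Ω) {lam : ℂ} (hlam : ‖lam‖ < 1) (him : lam.im ≠ 0) {β : ℝ}
    (hβ₀ : 0 ≤ β) (hβ : ∀ ν ∈ dirichletSpectrum Ω,
      β < |((1 + lam) * ((μ₀ : ℂ) - ν) ^ (1 / 2 : ℂ)).im|) :
    ∃ q : ℝ, q < 1 ∧ ∀ (t : ℝ), t ≠ 0 → ∀ f, f ≠ 0 → T f = (t : ℂ) • f →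
      β ≤ q * |((1 + lam) * ((-t⁻¹ : ℝ) : ℂ) ^ (1 / 2 : ℂ)).im| := by
  have hre : 0 < |1 + lam.re| := by
    have := (abs_lt.1 ((Complex.abs_re_le_norm lam).trans_lt hlam)).1
    exact abs_pos.2 (by linarith)
  have him' : 0 < |lam.im| := abs_pos.2 him
  -- For an eigenvalue t = 1/(ν - μ₀) of `T`, this is the ratio of β to |Im((1+λ)√(μ₀-ν))|. It is
  -- continuous also at t = 0, the point corresponding to ν = ∞, with value 0. So the strict
  -- inequality F < 1 becomes uniform on the compact spectrum of `T`.
  let F : ℂ → ℝ := fun t => β * (√(max t.re 0) / |1 + lam.re| + √(max (-t.re) 0) / |lam.im|)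
  have hF : ∀ t : ℝ, t ≠ 0 → F t * |((1 + lam) * ((-t⁻¹ : ℝ) : ℂ) ^ (1 / 2 : ℂ)).im| = β := by
    intro t ht
    rw [abs_im_mul_cpow_half]
    have hs : √|t| * √|-t⁻¹| = 1 := by
      rw [← Real.sqrt_mul (abs_nonneg _), abs_neg, ← abs_mul, mul_inv_cancel₀ ht]; simp
    rcases lt_or_gt_of_ne ht with h | h
    · have h1 : (0 : ℝ) ≤ -t⁻¹ := by
        have := inv_lt_zero.2 h; linarith
      rw [if_pos h1]
      simp only [F, Complex.ofReal_re, max_eq_right h.le, max_eq_left (by linarith : (0:ℝ) ≤ -t),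
        Real.sqrt_zero, zero_div, zero_add]
      rw [← abs_of_neg h]
      calc β * (√|t| / |lam.im|) * (√|-t⁻¹| * |lam.im|) = β * (√|t| * √|-t⁻¹|) := by
            field_simp
        _ = β := by rw [hs, mul_one]
    · have h1 : ¬ (0 : ℝ) ≤ -t⁻¹ := by
        have := inv_pos.2 h; linarith
      rw [if_neg h1]
      simp only [F, Complex.ofReal_re, max_eq_left h.le, max_eq_right (by linarith : -t ≤ (0:ℝ)),
        Real.sqrt_zero, zero_div, add_zero]
      nth_rw 1 [← abs_of_pos h]
      calc β * (√|t| / |1 + lam.re|) * (√|-t⁻¹| * |1 + lam.re|) = β * (√|t| * √|-t⁻¹|) := by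
            field_simp
        _ = β := by rw [hs, mul_one]
  have hFc : Continuous F := by fun_prop
  have hFnn : ∀ t, 0 ≤ F t := fun t => by positivity
  have hsym := hT.isSymmetric hΩ
  have hFlt : ∀ t ∈ spectrum ℂ T, F t < 1 := by
    intro t ht
    by_cases h0 : t = 0
    · simp [h0, F]
    -- A nonzero spectral point of a compact operator is an eigenvalue; by symmetry it is also real.
    obtain ⟨f, hf, hf0⟩ := ((hT.isCompactOperator hΩ hΩb).hasEigenvalue_iff_mem_spectrum h0).2 ht
      |>.exists_hasEigenvector
    have hf1 : T f = t • f := Module.End.mem_eigenspace_iff.1 hf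
    have htr : t = (t.re : ℂ) := by
      have := hsym.isSelfAdjoint.mem_spectrum_eq_re ht
      exact this
    have htr0 : t.re ≠ 0 := fun h => h0 (by rw [htr, h]; simp)
    have h2 := hβ _ (hT.mem_dirichletSpectrum h0 hf0 hf1)
    have h3 : (μ₀ : ℂ) - (μ₀ + t⁻¹) = ((-t.re⁻¹ : ℝ) : ℂ) := by
      rw [htr]; push_cast; simp
    rw [h3] at h2
    have h4 := hF t.re htr0
    rw [← htr] at h4
    by_contra! h5
    nlinarith [abs_nonneg ((1 + lam) * ((-t.re⁻¹ : ℝ) : ℂ) ^ (1 / 2 : ℂ)).im]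
  obtain ⟨q, hq1, hq⟩ : ∃ q < 1, ∀ t ∈ spectrum ℂ T, F t ≤ q := by
    by_cases hne : (spectrum ℂ T).Nonempty
    · obtain ⟨t, ht, hmax⟩ := (spectrum.isCompact T).exists_isMaxOn hne hFc.continuousOn
      exact ⟨F t, hFlt t ht, fun s hs => hmax hs⟩
    · exact ⟨0, one_pos, fun t ht => (hne ⟨t, ht⟩).elim⟩
  refine ⟨q, hq1, fun t ht f hf hTf => ?_⟩
  have hmem : (t : ℂ) ∈ spectrum ℂ T := by
    refine ((hT.isCompactOperator hΩ hΩb).hasEigenvalue_iff_mem_spectrum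
      (by exact_mod_cast ht)).1 ?_
    exact Module.End.hasEigenvalue_of_hasEigenvector
      (x := f) ⟨Module.End.mem_eigenspace_iff.2 hTf, hf⟩
  rw [← hF t ht]
  exact mul_le_mul_of_nonneg_right (hq _ hmem) (abs_nonneg _)

/-- Diagonalization of the Dirichlet resolvent, together with the roots of the characteristic
equations of the modes. -/
structure ModeData (Ω : Set (EuclideanSpace ℝ (Fin n)))
    (T : Lp ℂ 2 (volume.restrict Ω) →L[ℂ] Lp ℂ 2 (volume.restrict Ω)) (lam : ℂ) (β : ℝ) where
  /-- index set of the modes -/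
  ι : Type
  countable : Countable ι
  /-- eigenfunctions -/
  b : HilbertBasis ι ℂ (Lp ℂ 2 (volume.restrict Ω))
  /-- eigenvalues of the shifted Laplacian -/
  a : ι → ℝ
  /-- exponents of the modes -/
  κ : ι → ℂ
  /-- relative gap -/
  q : ℝ
  /-- bound on the slope of the exponents -/
  r : ℝ
  /-- lower bound on the eigenvalues -/
  δ : ℝ
  q_lt_one : q < 1
  r_pos : 0 < r
  δ_pos : 0 < δ
  le_abs_a : ∀ k, δ ≤ |a k|
  apply_b : ∀ k, T (b k) = ((a k)⁻¹ : ℂ) • b k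
  κ_sq : ∀ k, κ k ^ 2 = a k * (1 + lam) ^ 2
  re_pos : ∀ k, 0 < (κ k).re
  le_re : ∀ k, β ≤ q * (κ k).re
  norm_le : ∀ k, ‖κ k‖ ≤ r * (κ k).re

theorem exists_modeData (hT : IsDirichletResolvent Ω μ₀ T) (hΩ : IsOpen Ω)
    (hΩb : Bornology.IsBounded Ω) {lam : ℂ} (hlam : ‖lam‖ < 1) (him : lam.im ≠ 0) {β : ℝ}
    (hβ₀ : 0 ≤ β) (hβ : ∀ ν ∈ dirichletSpectrum Ω,
      β < |((1 + lam) * ((μ₀ : ℂ) - ν) ^ (1 / 2 : ℂ)).im|) :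
    Nonempty (ModeData Ω T lam β) := by
  obtain ⟨q, hq1, hq⟩ := exists_uniform_gap hT hΩ hΩb hlam him hβ₀ hβ
  have hsym := hT.isSymmetric hΩ
  obtain ⟨ι, b, t, ht⟩ := exists_eigenvector_hilbertBasis (hT.isCompactOperator hΩ hΩb) hsym
  have hb0 : ∀ k, b k ≠ 0 := fun k => b.orthonormal.ne_zero k
  have ht0 : ∀ k, t k ≠ 0 := fun k h => hb0 k (hT.injective hΩ (by rw [ht, h, zero_smul]))
  have htr : ∀ k, t k = ((t k).re : ℂ) := fun k => by
    have h := hsym.conj_eigenvalue_eq_self (Module.End.hasEigenvalue_of_hasEigenvector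
      (x := b k) ⟨Module.End.mem_eigenspace_iff.2 (ht k), hb0 k⟩)
    exact (Complex.conj_eq_iff_re.1 h).symm
  have htr0 : ∀ k, (t k).re ≠ 0 := fun k h => ht0 k (by rw [htr, h]; simp)
  let a : ι → ℝ := fun k => (t k).re⁻¹
  let s : ι → ℂ := fun k => (1 + lam) * ((-a k : ℝ) : ℂ) ^ (1 / 2 : ℂ)
  -- Of the two roots ±i s, the one with real part |Im s|.
  let κ : ι → ℂ := fun k => if 0 ≤ (s k).im then -(Complex.I * s k) else Complex.I * s k
  have hκre : ∀ k, (κ k).re = |(s k).im| := fun k => by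
    by_cases h : 0 ≤ (s k).im
    · simp [κ, h, abs_of_nonneg h]
    · simp [κ, h, abs_of_neg (not_le.1 h)]
  have hκn : ∀ k, ‖κ k‖ = ‖s k‖ := fun k => by
    by_cases h : 0 ≤ (s k).im <;> simp [κ, h]
  have hκsq : ∀ k, κ k ^ 2 = -(s k) ^ 2 := fun k => by
    by_cases h : 0 ≤ (s k).im <;> simp [κ, h, mul_pow]
  have hssq : ∀ k, (s k) ^ 2 = (1 + lam) ^ 2 * (-a k : ℝ) := fun k => by
    simp only [s, one_div]
    rw [mul_pow, Complex.cpow_ofNat_inv_pow]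
  have : Fact ((2 : ENNReal) ≠ ⊤) := ⟨by simp⟩
  -- The smaller of the two factors in `abs_im_mul_cpow_half`. From γ√|a| ≤ Re κ and |κ| ≤ 2√|a|
  -- comes the slope bound r = 2/γ.
  set γ : ℝ := min |lam.im| |1 + lam.re| with hγ
  have hre : 0 < |1 + lam.re| := by
    have := (abs_lt.1 ((Complex.abs_re_le_norm lam).trans_lt hlam)).1
    exact abs_pos.2 (by linarith)
  have hγpos : 0 < γ := lt_min (abs_pos.2 him) hre
  have hsim : ∀ k, √|a k| * γ ≤ |(s k).im| := fun k => by
    simp only [s]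
    rw [abs_im_mul_cpow_half, abs_neg]
    gcongr
    split_ifs
    · exact min_le_left _ _
    · exact min_le_right _ _
  have ha0 : ∀ k, 0 < |a k| := fun k => abs_pos.2 (inv_ne_zero (htr0 k))
  have hsn : ∀ k, ‖s k‖ ≤ 2 * √|a k| := fun k => by
    have h1 : ‖s k‖ ^ 2 = ‖1 + lam‖ ^ 2 * |a k| := by
      rw [← norm_pow, hssq, norm_mul, norm_pow, Complex.norm_real, Real.norm_eq_abs, abs_neg]
    have h2 : ‖1 + lam‖ ≤ 2 := (norm_add_le _ _).trans (by rw [norm_one]; linarith)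
    refine le_of_sq_le_sq ?_ (by positivity)
    rw [h1, mul_pow, Real.sq_sqrt (abs_nonneg _)]
    gcongr
  refine ⟨⟨ι, b.countable, b, a, κ, q, 2 / γ, (‖T‖ + 1)⁻¹, hq1, by positivity, by positivity,
    fun k => ?_, fun k => ?_, fun k => ?_, fun k => ?_, fun k => ?_, fun k => ?_⟩⟩
  -- The reciprocals of the `a k` are eigenvalues of `T`, hence bounded by its norm. This yields the
  -- lower bound δ.
  · have h1 := T.le_opNorm (b k)
    rw [ht, norm_smul, b.orthonormal.1, mul_one, mul_one, htr, Complex.norm_real,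
      Real.norm_eq_abs] at h1
    simp only [a, abs_inv]
    exact inv_anti₀ (abs_pos.2 (htr0 k)) (by linarith)
  · rw [ht, htr k]
    simp [a]
  · rw [hκsq, hssq]; push_cast; ring
  · rw [hκre]
    exact lt_of_lt_of_le (mul_pos (Real.sqrt_pos.2 (ha0 k)) hγpos) (hsim k)
  · rw [hκre]
    exact hq _ (htr0 k) (b k) (hb0 k) (by rw [ht, ← htr])
  · rw [hκn, hκre]
    refine (hsn k).trans ?_
    rw [div_mul_eq_mul_div, le_div_iff₀ hγpos]
    nlinarith [hsim k]

end SpectralData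

/-! ### Weighted energy estimate for a single mode -/

section ModeEstimate

/-- Put t = β / Re κ, so that 0 ≤ t ≤ q, and w = c₁ - βc. The right-hand side equals (1-t)(|κ|²|c|²
+ |w|²) + t((1-t)(Re κ)²|c|² + |w - i (Im κ) c|²). The multiplier κ̄ / Re κ is chosen so that |c₁|²
and κ²|c|² contribute the real parts |c₁|² and |κ|²|c|². -/
theorem mode_energy_pointwise {κ c c₁ c₂ : ℂ} {β q : ℝ} (hβ : 0 ≤ β) (hp : 0 < κ.re) (hq : q < 1)
    (hβq : β ≤ q * κ.re) :
    (1 - q) * (‖κ‖ ^ 2 * ‖c‖ ^ 2 + ‖c₁ - β * c‖ ^ 2)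
      ≤ (starRingEnd ℂ κ / κ.re * ((κ ^ 2 * c - c₂) * starRingEnd ℂ c)).re
        + (starRingEnd ℂ κ / κ.re * (c₂ * starRingEnd ℂ c + c₁ * starRingEnd ℂ c₁
          - 2 * β * (c₁ * starRingEnd ℂ c))).re := by
  obtain ⟨p, s⟩ := κ
  obtain ⟨x, y⟩ := c
  obtain ⟨x₁, y₁⟩ := c₁
  obtain ⟨x₂, y₂⟩ := c₂
  simp only at hp hβq
  obtain ⟨t, rfl⟩ : ∃ t, β = t * p := ⟨β / p, by field_simp⟩
  have ht0 : 0 ≤ t := nonneg_of_mul_nonneg_left hβ hp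
  have htq : t ≤ q := le_of_mul_le_mul_right hβq hp
  obtain ⟨u, rfl⟩ : ∃ u, x₁ = u + t * p * x := ⟨x₁ - t * p * x, by ring⟩
  obtain ⟨v, rfl⟩ : ∃ v, y₁ = v + t * p * y := ⟨y₁ - t * p * y, by ring⟩
  have e1 : ‖(⟨p, s⟩ : ℂ)‖ ^ 2 = p ^ 2 + s ^ 2 := by
    rw [Complex.sq_norm, Complex.normSq_mk]; ring
  have e2 : ‖(⟨x, y⟩ : ℂ)‖ ^ 2 = x ^ 2 + y ^ 2 := by
    rw [Complex.sq_norm, Complex.normSq_mk]; ring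
  have e3 : ‖(⟨u + t * p * x, v + t * p * y⟩ : ℂ) - (t * p : ℝ) * ⟨x, y⟩‖ ^ 2
      = u ^ 2 + v ^ 2 := by
    have : (⟨u + t * p * x, v + t * p * y⟩ : ℂ) - (t * p : ℝ) * ⟨x, y⟩ = ⟨u, v⟩ := by
      apply Complex.ext <;> simp
    rw [this, Complex.sq_norm, Complex.normSq_mk]; ring
  rw [e1, e2, e3, ← Complex.add_re, ← mul_add]
  have e4 : ∀ P X Y Z : ℂ, P = ⟨p, s⟩ → X = ⟨x, y⟩ → Y = ⟨u + t * p * x, v + t * p * y⟩ →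
      Z = ⟨x₂, y₂⟩ → (starRingEnd ℂ P / (p : ℂ) * ((P ^ 2 * X - Z) * starRingEnd ℂ X
      + (Z * starRingEnd ℂ X + Y * starRingEnd ℂ Y
      - 2 * (t * p : ℝ) * (Y * starRingEnd ℂ X)))).re
      = (1 - t) * ((p ^ 2 + s ^ 2) * (x ^ 2 + y ^ 2) + (u ^ 2 + v ^ 2))
        + t * (p ^ 2 * (1 - t) * (x ^ 2 + y ^ 2) + (u + s * y) ^ 2 + (v - s * x) ^ 2) := by
    rintro P X Y Z rfl rfl rfl rfl
    rw [div_mul_eq_mul_div, Complex.div_ofReal_re, div_eq_iff hp.ne']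
    simp [pow_two]
    ring
  rw [e4 _ _ _ _ rfl rfl rfl rfl]
  have h1 : (1 - q) * ((p ^ 2 + s ^ 2) * (x ^ 2 + y ^ 2) + (u ^ 2 + v ^ 2))
      ≤ (1 - t) * ((p ^ 2 + s ^ 2) * (x ^ 2 + y ^ 2) + (u ^ 2 + v ^ 2)) := by
    gcongr
  have h2 : 0 ≤ t * (p ^ 2 * (1 - t) * (x ^ 2 + y ^ 2) + (u + s * y) ^ 2 + (v - s * x) ^ 2) := by
    have : 0 ≤ 1 - t := by linarith
    positivity
  linarith

/-- The last term, times e^{-2βx}, is an exact derivative that will integrate to zero, so its large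
factor is harmless. Otherwise this is the energy inequality with Young's inequality. The factor 5 =
1 + 2 + 2 counts the copies of |κ|⁴|c|² coming from c, from c₁ = w + βc with β ≤ |κ|, and from c₂ =
κ²c - g. -/
theorem mode_estimate_pointwise {κ c c₁ c₂ : ℂ} {β q r : ℝ} (hβ : 0 ≤ β) (hp : 0 < κ.re)
    (hq : q < 1) (hβq : β ≤ q * κ.re) (hr : ‖κ‖ ≤ r * κ.re) :
    ‖κ‖ ^ 4 * ‖c‖ ^ 2 + ‖κ‖ ^ 2 * ‖c₁‖ ^ 2 + ‖c₂‖ ^ 2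
      ≤ (5 * (r / (1 - q)) ^ 2 + 2) * ‖κ ^ 2 * c - c₂‖ ^ 2
        + 10 * ‖κ‖ ^ 2 / (1 - q) * (starRingEnd ℂ κ / κ.re * (c₂ * starRingEnd ℂ c
          + c₁ * starRingEnd ℂ c₁ - 2 * β * (c₁ * starRingEnd ℂ c))).re := by
  have key := mode_energy_pointwise (c := c) (c₁ := c₁) (c₂ := c₂) hβ hp hq hβq
  set D := (starRingEnd ℂ κ / κ.re * (c₂ * starRingEnd ℂ c
          + c₁ * starRingEnd ℂ c₁ - 2 * β * (c₁ * starRingEnd ℂ c))).re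
  set g := κ ^ 2 * c - c₂ with hg
  set δ := 1 - q with hδ
  have hδ0 : 0 < δ := by linarith
  set k := ‖κ‖ with hk
  have hpk : κ.re ≤ k := (le_abs_self _).trans (Complex.abs_re_le_norm κ)
  have hk0 : 0 < k := hp.trans_le hpk
  have hβk : β ≤ k := by nlinarith
  have h1 : (starRingEnd ℂ κ / κ.re * (g * starRingEnd ℂ c)).re ≤ r * (‖g‖ * ‖c‖) := by
    refine (Complex.re_le_norm _).trans ?_
    rw [norm_mul, norm_mul, RCLike.norm_conj, norm_div, RCLike.norm_conj, Complex.norm_real,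
      Real.norm_of_nonneg hp.le]
    gcongr
    rwa [div_le_iff₀ hp]
  set W := ‖c₁ - β * c‖
  have h2 : 2 * k ^ 4 * ‖c‖ ^ 2 + 2 * k ^ 2 * W ^ 2
      ≤ 2 * (k ^ 2 * ‖c‖) * (r / δ * ‖g‖) + 2 * k ^ 2 / δ * D := by
    have h3 : δ * (k ^ 2 * ‖c‖ ^ 2 + W ^ 2) ≤ r * (‖g‖ * ‖c‖) + D := by linarith
    have h4 := mul_le_mul_of_nonneg_left h3 (by positivity : 0 ≤ 2 * k ^ 2 / δ)
    have e1 : 2 * k ^ 2 / δ * (δ * (k ^ 2 * ‖c‖ ^ 2 + W ^ 2))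
        = 2 * k ^ 4 * ‖c‖ ^ 2 + 2 * k ^ 2 * W ^ 2 := by field_simp
    have e2 : 2 * k ^ 2 / δ * (r * (‖g‖ * ‖c‖) + D)
        = 2 * (k ^ 2 * ‖c‖) * (r / δ * ‖g‖) + 2 * k ^ 2 / δ * D := by field_simp
    linarith
  have h3 : 2 * (k ^ 2 * ‖c‖) * (r / δ * ‖g‖) ≤ k ^ 4 * ‖c‖ ^ 2 + (r / δ) ^ 2 * ‖g‖ ^ 2 := by
    nlinarith [sq_nonneg (k ^ 2 * ‖c‖ - r / δ * ‖g‖)]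
  have h4 : ‖c₁‖ ^ 2 ≤ 2 * W ^ 2 + 2 * k ^ 2 * ‖c‖ ^ 2 := by
    have : ‖c₁‖ ≤ W + k * ‖c‖ := by
      calc ‖c₁‖ = ‖(c₁ - β * c) + β * c‖ := by rw [sub_add_cancel]
        _ ≤ W + ‖(β : ℂ) * c‖ := norm_add_le _ _
        _ ≤ W + k * ‖c‖ := by
          rw [norm_mul, Complex.norm_real, Real.norm_of_nonneg hβ]; gcongr
    have h5 := pow_le_pow_left₀ (norm_nonneg _) this 2
    nlinarith [sq_nonneg (W - k * ‖c‖)]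
  have h5 : ‖c₂‖ ^ 2 ≤ 2 * k ^ 4 * ‖c‖ ^ 2 + 2 * ‖g‖ ^ 2 := by
    have : ‖c₂‖ ≤ k ^ 2 * ‖c‖ + ‖g‖ := by
      calc ‖c₂‖ = ‖κ ^ 2 * c - g‖ := by rw [hg, sub_sub_cancel]
        _ ≤ ‖κ ^ 2 * c‖ + ‖g‖ := norm_sub_le _ _
        _ = _ := by rw [norm_mul, norm_pow]
    have h5 := pow_le_pow_left₀ (norm_nonneg _) this 2
    nlinarith [sq_nonneg (k ^ 2 * ‖c‖ - ‖g‖)]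
  have h6 : k ^ 2 * ‖c₁‖ ^ 2 ≤ 2 * k ^ 2 * W ^ 2 + 2 * k ^ 4 * ‖c‖ ^ 2 := by
    have := mul_le_mul_of_nonneg_left h4 (sq_nonneg k)
    linarith
  have e : 10 * k ^ 2 / δ * D = 5 * (2 * k ^ 2 / δ * D) := by ring
  have h7 : 0 ≤ 2 * k ^ 2 * W ^ 2 := by positivity
  rw [e]
  linarith

variable {c c₁ c₂ : ℝ → ℂ}

theorem integrableOn_exp_mul {f : ℝ → ℝ} (hf : Continuous f) (hs : HasCompactSupport f)
    (β : ℝ) (s : Set ℝ) : IntegrableOn (fun x => Real.exp (-2 * β * x) * f x) s :=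
  ((by fun_prop : Continuous fun x => Real.exp (-2 * β * x) * f x).integrable_of_hasCompactSupport
    hs.mul_left).integrableOn

/-- The integrand is the derivative of e^{-2βx} Re(η c₁ c̄), which vanishes at R together with c and
near -∞ by compact support. Nothing is needed on c₁(R). -/
theorem mode_boundary_term (hc : ∀ x, HasDerivAt c (c₁ x) x) (hc₁ : ∀ x, HasDerivAt c₁ (c₂ x) x)
    (hc₂ : Continuous c₂) (hs : HasCompactSupport c) {R : ℝ} (hR : c R = 0) (β : ℝ) (η : ℂ) :
    ∫ x in Set.Iic R, Real.exp (-2 * β * x) * (η * (c₂ x * starRingEnd ℂ (c x)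
      + c₁ x * starRingEnd ℂ (c₁ x) - 2 * β * (c₁ x * starRingEnd ℂ (c x)))).re = 0 := by
  have hcc : Continuous c := continuous_iff_continuousAt.2 fun x => (hc x).continuousAt
  have hcc₁ : Continuous c₁ := continuous_iff_continuousAt.2 fun x => (hc₁ x).continuousAt
  have hd : ∀ x, HasDerivAt (fun x => starRingEnd ℂ (c x)) (starRingEnd ℂ (c₁ x)) x :=
    fun x => (hc x).star
  have hs₁ : HasCompactSupport c₁ := by
    have : c₁ = deriv c := funext fun x => (hc x).deriv.symm
    rw [this]; exact hs.deriv
  let F : ℝ → ℝ := fun x => Real.exp (-2 * β * x) * (η * (c₁ x * starRingEnd ℂ (c x))).re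
  have hF : ∀ x, HasDerivAt F (Real.exp (-2 * β * x) * (η * (c₂ x * starRingEnd ℂ (c x)
      + c₁ x * starRingEnd ℂ (c₁ x) - 2 * β * (c₁ x * starRingEnd ℂ (c x)))).re) x := by
    intro x
    have h1 : HasDerivAt (fun x => Real.exp (-2 * β * x)) (Real.exp (-2 * β * x) * (-2 * β)) x := by
      simpa using ((hasDerivAt_id x).const_mul (-2 * β)).exp
    have h2 : HasDerivAt (fun x => (η * (c₁ x * starRingEnd ℂ (c x))).re)
        (η * (c₂ x * starRingEnd ℂ (c x) + c₁ x * starRingEnd ℂ (c₁ x))).re x :=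
      (Complex.reCLM.hasFDerivAt.comp_hasDerivAt x (((hc₁ x).mul (hd x)).const_mul η))
    refine (h1.mul h2).congr_deriv ?_
    have e : (η * (c₂ x * starRingEnd ℂ (c x)
      + c₁ x * starRingEnd ℂ (c₁ x) - 2 * β * (c₁ x * starRingEnd ℂ (c x)))).re
      = (η * (c₂ x * starRingEnd ℂ (c x) + c₁ x * starRingEnd ℂ (c₁ x))).re
        - 2 * β * (η * (c₁ x * starRingEnd ℂ (c x))).re := by
      rw [← Complex.re_ofReal_mul, ← Complex.sub_re]
      congr 1
      push_cast
      ring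
    rw [e]; ring
  have hsF : HasCompactSupport F := by
    refine HasCompactSupport.intro hs fun x hx => ?_
    simp [F, image_eq_zero_of_notMem_tsupport hx]
  have hI : IntegrableOn (fun x => Real.exp (-2 * β * x) * (η * (c₂ x * starRingEnd ℂ (c x)
      + c₁ x * starRingEnd ℂ (c₁ x) - 2 * β * (c₁ x * starRingEnd ℂ (c x)))).re)
      (Set.Iic R) := by
    refine integrableOn_exp_mul ?_ ?_ β _
    · exact Complex.continuous_re.comp (by fun_prop)
    · refine HasCompactSupport.intro (hs.isCompact.union hs₁.isCompact) fun x hx => ?_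
      rw [Set.mem_union, not_or] at hx
      simp [image_eq_zero_of_notMem_tsupport hx.1, image_eq_zero_of_notMem_tsupport hx.2]
  have hlim : Filter.Tendsto F Filter.atBot (nhds 0) :=
    (hsF.is_zero_at_infty).mono_left atBot_le_cocompact
  rw [integral_Iic_of_hasDerivAt_of_tendsto (hF R).continuousAt.continuousWithinAt
    (fun x _ => hF x) hI hlim]
  simp [F, hR]

/-- Weighted a priori estimate for the boundary value problem of a single mode. -/
theorem mode_estimate {κ : ℂ} {β q r : ℝ} (hβ : 0 ≤ β) (hp : 0 < κ.re)
    (hq : q < 1) (hβq : β ≤ q * κ.re) (hr : ‖κ‖ ≤ r * κ.re)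
    (hc : ∀ x, HasDerivAt c (c₁ x) x) (hc₁ : ∀ x, HasDerivAt c₁ (c₂ x) x)
    (hc₂ : Continuous c₂) (hs : HasCompactSupport c) {R : ℝ} (hR : c R = 0) :
    ‖κ‖ ^ 4 * (∫ x in Set.Iic R, Real.exp (-2 * β * x) * ‖c x‖ ^ 2)
      + ‖κ‖ ^ 2 * (∫ x in Set.Iic R, Real.exp (-2 * β * x) * ‖c₁ x‖ ^ 2)
      + (∫ x in Set.Iic R, Real.exp (-2 * β * x) * ‖c₂ x‖ ^ 2)
      ≤ (5 * (r / (1 - q)) ^ 2 + 2)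
        * ∫ x in Set.Iic R, Real.exp (-2 * β * x) * ‖κ ^ 2 * c x - c₂ x‖ ^ 2 := by
  have hcc : Continuous c := continuous_iff_continuousAt.2 fun x => (hc x).continuousAt
  have hcc₁ : Continuous c₁ := continuous_iff_continuousAt.2 fun x => (hc₁ x).continuousAt
  have hs₁ : HasCompactSupport c₁ := by
    have : c₁ = deriv c := funext fun x => (hc x).deriv.symm
    rw [this]; exact hs.deriv
  have hs₂ : HasCompactSupport c₂ := by
    have : c₂ = deriv c₁ := funext fun x => (hc₁ x).deriv.symm
    rw [this]; exact hs₁.deriv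
  have sq : ∀ {f : ℝ → ℂ}, Continuous f → HasCompactSupport f →
      IntegrableOn (fun x => Real.exp (-2 * β * x) * ‖f x‖ ^ 2) (Set.Iic R) := fun hf hs =>
    integrableOn_exp_mul (by fun_prop) (hs.comp_left (g := fun z : ℂ => ‖z‖ ^ 2) (by simp)) β _
  have i0 := sq hcc hs
  have i1 := sq hcc₁ hs₁
  have i2 := sq hc₂ hs₂
  have ig : IntegrableOn (fun x => Real.exp (-2 * β * x) * ‖κ ^ 2 * c x - c₂ x‖ ^ 2)
      (Set.Iic R) := sq (by fun_prop) (HasCompactSupport.sub hs.mul_left hs₂)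
  set η : ℂ := starRingEnd ℂ κ / κ.re
  have hb := mode_boundary_term hc hc₁ hc₂ hs hR β η
  have iD : IntegrableOn (fun x => Real.exp (-2 * β * x) * (η * (c₂ x * starRingEnd ℂ (c x)
      + c₁ x * starRingEnd ℂ (c₁ x) - 2 * β * (c₁ x * starRingEnd ℂ (c x)))).re)
      (Set.Iic R) := by
    refine integrableOn_exp_mul ?_ ?_ β _
    · exact Complex.continuous_re.comp (by fun_prop)
    · refine HasCompactSupport.intro (hs.isCompact.union hs₁.isCompact) fun x hx => ?_
      rw [Set.mem_union, not_or] at hx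
      simp [image_eq_zero_of_notMem_tsupport hx.1, image_eq_zero_of_notMem_tsupport hx.2]
  have hle := setIntegral_mono_on
    (((i0.const_mul (‖κ‖ ^ 4)).add (i1.const_mul (‖κ‖ ^ 2))).add i2)
    ((ig.const_mul (5 * (r / (1 - q)) ^ 2 + 2)).add (iD.const_mul (10 * ‖κ‖ ^ 2 / (1 - q))))
    (measurableSet_Iic (a := R)) (fun x _ => by
      have h := mul_le_mul_of_nonneg_left (mode_estimate_pointwise (c := c x) (c₁ := c₁ x)
        (c₂ := c₂ x) hβ hp hq hβq hr) (Real.exp_pos (-2 * β * x)).le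
      simp only [Pi.add_apply]
      refine le_trans (le_of_eq ?_) (h.trans (le_of_eq ?_)) <;> ring)
  simp only [Pi.add_apply] at hle
  rw [integral_add (by exact (i0.const_mul (‖κ‖ ^ 4)).add (i1.const_mul (‖κ‖ ^ 2))) i2,
    integral_add (i0.const_mul (‖κ‖ ^ 4)) (i1.const_mul (‖κ‖ ^ 2)),
    integral_add (ig.const_mul _) (iD.const_mul _), integral_const_mul, integral_const_mul,
    integral_const_mul, integral_const_mul, hb, mul_zero, add_zero] at hle
  exact hle

end ModeEstimate

/-! ### Density of the range for a single mode -/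

section ModeDensity

theorem contDiff_primitive {g : ℝ → ℂ} (hg : ContDiff ℝ ∞ g) (a : ℝ) :
    ContDiff ℝ ∞ (fun x => ∫ s in a..x, g s) := by
  have hd : ∀ x, HasDerivAt (fun x => ∫ s in a..x, g s) (g x) x := fun x =>
    (hg.continuous.integral_hasStrictDerivAt a x).hasDerivAt
  rw [contDiff_infty_iff_deriv]
  refine ⟨fun x => (hd x).differentiableAt, ?_⟩
  rw [show deriv (fun x => ∫ s in a..x, g s) = g from funext fun x => (hd x).deriv]
  exact hg

theorem norm_cexp_mul_real (κ : ℂ) (x : ℝ) : ‖Complex.exp (κ * x)‖ = Real.exp (κ.re * x) := by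
  rw [Complex.norm_exp]; simp

/-- A decaying solution of the boundary value problem for a single mode. -/
theorem exists_mode_solution (κ : ℂ) (R : ℝ) {η : ℝ → ℂ} (hη : ContDiff ℝ ∞ η)
    (hs : HasCompactSupport η) :
    ∃ ψ : ℝ → ℂ, ContDiff ℝ ∞ ψ ∧ ψ R = 0 ∧ (∀ x, κ ^ 2 * ψ x - deriv (deriv ψ) x = η x) ∧
      ∃ C : ℝ, 0 ≤ C ∧ ∀ x ≤ R, ‖ψ x‖ ≤ C * Real.exp (κ.re * x) ∧
        ‖deriv ψ x‖ ≤ C * Real.exp (κ.re * x) := by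
  obtain ⟨A, hA⟩ : ∃ A, ∀ x ≤ A, η x = 0 := by
    obtain ⟨A, hA⟩ := hs.isCompact.bddBelow
    refine ⟨A - 1, fun x hx => image_eq_zero_of_notMem_tsupport fun h => ?_⟩
    linarith [hA h]
  have hexp : ∀ k : ℂ, ContDiff ℝ ∞ fun x : ℝ => Complex.exp (k * x) := fun k =>
    (contDiff_const.mul Complex.ofRealCLM.contDiff).cexp
  have hexpd : ∀ (k : ℂ) (x : ℝ), HasDerivAt (fun x : ℝ => Complex.exp (k * x))
      (k * Complex.exp (k * x)) x := fun k x => by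
    have : HasDerivAt (fun x : ℝ => k * (x : ℂ)) k x := by
      simpa using (Complex.ofRealCLM.hasDerivAt (x := x)).const_mul k
    simpa [mul_comm] using this.cexp
  -- Variation of constants: with ψ = e^{κx} θ, the equation (∂ + κ)(∂ - κ)ψ = -η amounts to θ' =
  -- -e^{-2κx} E and E' = e^{κx} η. To the left of the support of η, E is zero and θ constant, so ψ
  -- is there a multiple of e^{κx}.
  let E : ℝ → ℂ := fun x => ∫ s in A..x, Complex.exp (κ * s) * η s
  have hgE : ContDiff ℝ ∞ fun x : ℝ => Complex.exp (κ * x) * η x := (hexp κ).mul hη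
  have hE : ContDiff ℝ ∞ E := contDiff_primitive hgE A
  have hEd : ∀ x : ℝ, HasDerivAt E (Complex.exp (κ * x) * η x) x := fun x =>
    (hgE.continuous.integral_hasStrictDerivAt A x).hasDerivAt
  have hE0 : ∀ x ≤ A, E x = 0 := fun x hx => by
    refine (intervalIntegral.integral_congr (g := fun _ => 0) fun s hs => ?_).trans (by simp)
    rw [Set.uIcc_of_ge hx] at hs
    simp [hA s hs.2]
  let th : ℝ → ℂ := fun x => -(Complex.exp (-(2 * κ) * x) * E x)
  have hth : ContDiff ℝ ∞ th := ((hexp _).mul hE).neg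
  -- The subtracted constant arranges θ(R) = 0 without affecting the equation.
  let θ : ℝ → ℂ := fun x => (∫ s in A..x, th s) - ∫ s in A..R, th s
  have hθ : ContDiff ℝ ∞ θ := (contDiff_primitive hth A).sub contDiff_const
  have hθd : ∀ x, HasDerivAt θ (th x) x := fun x =>
    (hth.continuous.integral_hasStrictDerivAt A x).hasDerivAt.sub_const _
  have hθ0 : ∀ x ≤ A, θ x = θ A := fun x hx => by
    have : ∫ s in A..x, th s = 0 := by
      refine (intervalIntegral.integral_congr (g := fun _ => 0) fun s hs => ?_).trans (by simp)
      rw [Set.uIcc_of_ge hx] at hs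
      simp [th, hE0 s hs.2]
    simp [θ, this]
  have hbound : ∀ f : ℝ → ℂ, Continuous f → (∀ x ≤ A, f x = f A) →
      ∃ M : ℝ, 0 ≤ M ∧ ∀ x ≤ R, ‖f x‖ ≤ M := by
    intro f hf hfA
    obtain ⟨M, hM⟩ := (isCompact_Icc (a := A) (b := R)).exists_bound_of_continuousOn hf.continuousOn
    refine ⟨max M ‖f A‖, le_max_of_le_right (norm_nonneg _), fun x hx => ?_⟩
    by_cases hxA : x ≤ A
    · rw [hfA x hxA]; exact le_max_right _ _
    · exact (hM x ⟨(not_le.1 hxA).le, hx⟩).trans (le_max_left _ _)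
  obtain ⟨M₁, hM₁, h1⟩ := hbound θ hθ.continuous hθ0
  obtain ⟨M₂, hM₂, h2⟩ := hbound th hth.continuous fun x hx => by
    simp [th, hE0 x hx, hE0 A le_rfl]
  have hψd : ∀ x : ℝ, HasDerivAt (fun x : ℝ => Complex.exp (κ * x) * θ x)
      (κ * (Complex.exp (κ * x) * θ x) + Complex.exp (κ * x) * th x) x := fun x =>
    ((hexpd κ x).mul (hθd x)).congr_deriv (by ring)
  have hψd1 : deriv (fun x : ℝ => Complex.exp (κ * x) * θ x)
      = fun x : ℝ => κ * (Complex.exp (κ * x) * θ x) + Complex.exp (κ * x) * th x :=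
    funext fun x => (hψd x).deriv
  have hsimp : ∀ x : ℝ, Complex.exp (κ * x) * th x = -(Complex.exp (-κ * x) * E x) := fun x => by
    simp only [th]
    rw [mul_neg, ← mul_assoc, ← Complex.exp_add]
    congr 3; ring
  refine ⟨fun x => Complex.exp (κ * x) * θ x, (hexp κ).mul hθ, by simp [θ], fun x => ?_,
    (‖κ‖ + 1) * M₁ + M₂, by positivity, fun x hx => ?_⟩
  · have h3 : HasDerivAt (fun x : ℝ => κ * (Complex.exp (κ * x) * θ x) + Complex.exp (κ * x) * th x)
        (κ * (κ * (Complex.exp (κ * x) * θ x) + Complex.exp (κ * x) * th x)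
          + -((-κ * Complex.exp (-κ * x)) * E x
            + Complex.exp (-κ * x) * (Complex.exp (κ * x) * η x))) x := by
      refine ((hψd x).const_mul κ).add ?_
      simp only [hsimp]
      exact ((hexpd (-κ) x).mul (hEd x)).neg
    rw [hψd1, h3.deriv, hsimp, ← mul_assoc (Complex.exp (-κ * x)), ← Complex.exp_add]
    have : -κ * (x : ℂ) + κ * x = 0 := by ring
    rw [this, Complex.exp_zero]
    ring
  · have hm1 := h1 x hx
    have hm2 := h2 x hx
    have he := Real.exp_pos (κ.re * x)
    constructor
    · rw [norm_mul, norm_cexp_mul_real, mul_comm]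
      have : ‖θ x‖ ≤ (‖κ‖ + 1) * M₁ + M₂ := by nlinarith [norm_nonneg κ]
      gcongr
    · rw [hψd1]
      refine (norm_add_le _ _).trans ?_
      rw [norm_mul, norm_mul, norm_mul, norm_cexp_mul_real]
      have : ‖κ‖ * ‖θ x‖ + ‖th x‖ ≤ (‖κ‖ + 1) * M₁ + M₂ := by
        have := mul_le_mul_of_nonneg_left hm1 (norm_nonneg κ)
        linarith
      calc _ = (‖κ‖ * ‖θ x‖ + ‖th x‖) * Real.exp (κ.re * x) := by ring
        _ ≤ _ := by gcongr

theorem exists_smooth_cutoff : ∃ f : ℝ → ℝ, ContDiff ℝ ∞ f ∧ HasCompactSupport f ∧ f 0 = 1 := by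
  let f : ContDiffBump (0 : ℝ) := ⟨1, 2, one_pos, one_lt_two⟩
  exact ⟨f, f.contDiff, f.hasCompactSupport, f.one_of_mem_closedBall (by simpa using f.rIn_pos.le)⟩

/-- The decaying solution ψ of κ²ψ - ψ'' = η is not compactly supported. The slow cutoff f(x/(N+1))
makes it admissible; the commutator terms carry a factor 1/(N+1), and everything is dominated by a
multiple of the integrable function e^{Re κ x}|m|. -/
theorem integral_mode_test_eq_zero {m : ℝ → ℂ} {κ : ℂ} {R : ℝ}
    (hm : IntegrableOn (fun x => Real.exp (κ.re * x) * m x) (Set.Iio R))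
    (h : ∀ ψ : ℝ → ℂ, ContDiff ℝ ∞ ψ → HasCompactSupport ψ → ψ R = 0 →
      ∫ x in Set.Iio R, m x * (κ ^ 2 * ψ x - deriv (deriv ψ) x) = 0)
    {η : ℝ → ℂ} (hη : ContDiff ℝ ∞ η) (hs : HasCompactSupport η) :
    ∫ x in Set.Iio R, m x * η x = 0 := by
  obtain ⟨ψ, hψ, hψR, hψeq, C, hC, hCb⟩ := exists_mode_solution κ R hη hs
  obtain ⟨f, hf, hfs, hf0⟩ := exists_smooth_cutoff
  have hf1 : ContDiff ℝ ∞ (deriv f) := (contDiff_infty_iff_deriv.1 hf).2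
  have hf2 : ContDiff ℝ ∞ (deriv (deriv f)) := (contDiff_infty_iff_deriv.1 hf1).2
  obtain ⟨M₀, hM₀⟩ := hfs.exists_bound_of_continuous hf.continuous
  obtain ⟨M₁, hM₁⟩ := hfs.deriv.exists_bound_of_continuous hf1.continuous
  obtain ⟨M₂, hM₂⟩ := hfs.deriv.deriv.exists_bound_of_continuous hf2.continuous
  obtain ⟨Mη, hMη⟩ : ∃ M : ℝ, ∀ x, ‖η x‖ ≤ M * Real.exp (κ.re * x) := by
    have hc : Continuous fun x => (Real.exp (-(κ.re * x)) : ℂ) * η x := by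
      have := hη.continuous; fun_prop
    obtain ⟨M, hM⟩ := (hs.mul_left (f := fun x => (Real.exp (-(κ.re * x)) : ℂ))).exists_bound_of_continuous hc
    refine ⟨M, fun x => ?_⟩
    have := hM x
    simp only [Pi.mul_apply] at this
    rw [norm_mul, Complex.norm_real, Real.norm_of_nonneg (Real.exp_pos _).le, Real.exp_neg,
      inv_mul_le_iff₀ (Real.exp_pos _)] at this
    linarith
  let t : ℕ → ℝ := fun N => 1 / ((N : ℝ) + 1)
  have htpos : ∀ N, 0 < t N := fun N => by positivity
  have htle : ∀ N, t N ≤ 1 := fun N => by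
    rw [div_le_one (by positivity)]; linarith [(Nat.cast_nonneg N : (0:ℝ) ≤ N)]
  have ht0 : Filter.Tendsto t Filter.atTop (nhds 0) := tendsto_one_div_add_atTop_nhds_zero_nat
  have hψd : ∀ x, HasDerivAt ψ (deriv ψ x) x := fun x => (hψ.differentiable (by simp) x).hasDerivAt
  have hψ1 : ContDiff ℝ ∞ (deriv ψ) := (contDiff_infty_iff_deriv.1 hψ).2
  have hψdd : ∀ x, HasDerivAt (deriv ψ) (deriv (deriv ψ) x) x :=
    fun x => (hψ1.differentiable (by simp) x).hasDerivAt
  have hscale : ∀ (g : ℝ → ℝ), ContDiff ℝ ∞ g → ∀ N x,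
      HasDerivAt (fun x => ((g (t N * x) : ℝ) : ℂ)) ((t N * deriv g (t N * x) : ℝ) : ℂ) x := by
    intro g hg N x
    have h1 : HasDerivAt (fun x => t N * x) (t N) x := by
      simpa using (hasDerivAt_id x).const_mul (t N)
    have h2 := ((hg.differentiable (by simp) (t N * x)).hasDerivAt.comp x h1)
    rw [mul_comm (t N)]
    exact h2.ofReal_comp
  let Ψ : ℕ → ℝ → ℂ := fun N x => (f (t N * x) : ℂ) * ψ x
  have hΨ : ∀ N, ContDiff ℝ ∞ (Ψ N) := fun N =>
    (Complex.ofRealCLM.contDiff.comp (hf.comp (contDiff_const.mul contDiff_id))).mul hψ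
  have hΨs : ∀ N, HasCompactSupport (Ψ N) := fun N => by
    have h1 : HasCompactSupport fun x => f (t N * x) :=
      hfs.comp_homeomorph (Homeomorph.mulLeft₀ (t N) (htpos N).ne')
    exact (h1.comp_left (g := ((↑) : ℝ → ℂ)) (by simp)).mul_right
  have hΨd : ∀ N, deriv (Ψ N) = fun x => ((t N * deriv f (t N * x) : ℝ) : ℂ) * ψ x
      + (f (t N * x) : ℂ) * deriv ψ x := fun N =>
    funext fun x => ((hscale f hf N x).mul (hψd x)).deriv
  have hΨdd : ∀ N x, deriv (deriv (Ψ N)) x = ((t N * (t N * deriv (deriv f) (t N * x)) : ℝ) : ℂ) * ψ x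
      + 2 * (((t N * deriv f (t N * x) : ℝ) : ℂ) * deriv ψ x)
      + (f (t N * x) : ℂ) * deriv (deriv ψ) x := by
    intro N x
    rw [hΨd]
    have h1 := ((hscale (deriv f) hf1 N x).const_mul (t N : ℂ)).mul (hψd x)
    have h2 := (hscale f hf N x).mul (hψdd x)
    have h3 := (h1.add h2).deriv
    refine Eq.trans ?_ (h3.trans ?_)
    · congr 1; ext y; simp
    · push_cast; ring
  have hL : ∀ N x, κ ^ 2 * Ψ N x - deriv (deriv (Ψ N)) x
      = (f (t N * x) : ℂ) * η x - ((t N * (t N * deriv (deriv f) (t N * x)) : ℝ) : ℂ) * ψ x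
        - 2 * (((t N * deriv f (t N * x) : ℝ) : ℂ) * deriv ψ x) := by
    intro N x
    rw [hΨdd, ← hψeq x]
    simp only [Ψ]
    ring
  have hzero : ∀ N, ∫ x in Set.Iio R, m x * (κ ^ 2 * Ψ N x - deriv (deriv (Ψ N)) x) = 0 :=
    fun N => h (Ψ N) (hΨ N) (hΨs N) (by simp [Ψ, hψR])
  have hmm : AEStronglyMeasurable m (volume.restrict (Set.Iio R)) := by
    have h1 : Continuous fun x : ℝ => (Real.exp (-(κ.re * x)) : ℂ) := by fun_prop
    have h2 := h1.aestronglyMeasurable.mul hm.aestronglyMeasurable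
    refine h2.congr (Filter.Eventually.of_forall fun x => ?_)
    simp only [Pi.mul_apply]
    rw [← mul_assoc, ← Complex.ofReal_mul, ← Real.exp_add]
    simp
  have hMnn : 0 ≤ M₀ := (norm_nonneg _).trans (hM₀ 0)
  have hM1nn : 0 ≤ M₁ := (norm_nonneg _).trans (hM₁ 0)
  have hM2nn : 0 ≤ M₂ := (norm_nonneg _).trans (hM₂ 0)
  have hlim : Filter.Tendsto
      (fun N => ∫ x in Set.Iio R, m x * (κ ^ 2 * Ψ N x - deriv (deriv (Ψ N)) x)) Filter.atTop
      (nhds (∫ x in Set.Iio R, m x * η x)) := by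
    refine tendsto_integral_of_dominated_convergence
      (fun x => (M₀ * Mη + M₂ * C + 2 * (M₁ * C)) * ‖(Real.exp (κ.re * x) : ℂ) * m x‖)
      (fun N => ?_) (hm.norm.const_mul _) (fun N => ?_) ?_
    · refine hmm.mul (Continuous.aestronglyMeasurable ?_)
      simp only [hL]
      have := hη.continuous
      have := hψ.continuous
      have := hψ1.continuous
      have := hf.continuous
      have := hf1.continuous
      have := hf2.continuous
      fun_prop
    · refine (ae_restrict_iff' measurableSet_Iio).2 (Filter.Eventually.of_forall fun x hx => ?_)
      have hx' : x ≤ R := le_of_lt hx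
      rw [hL, norm_mul, norm_mul, Complex.norm_real, Real.norm_of_nonneg (Real.exp_pos _).le]
      have hb : ‖(f (t N * x) : ℂ) * η x
          - ((t N * (t N * deriv (deriv f) (t N * x)) : ℝ) : ℂ) * ψ x
          - 2 * (((t N * deriv f (t N * x) : ℝ) : ℂ) * deriv ψ x)‖
          ≤ (M₀ * Mη + M₂ * C + 2 * (M₁ * C)) * Real.exp (κ.re * x) := by
        have e1 : ‖(f (t N * x) : ℂ) * η x‖ ≤ M₀ * (Mη * Real.exp (κ.re * x)) := by
          rw [norm_mul, Complex.norm_real]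
          exact mul_le_mul (hM₀ _) (hMη x) (norm_nonneg _) hMnn
        have e2 : ‖((t N * (t N * deriv (deriv f) (t N * x)) : ℝ) : ℂ) * ψ x‖
            ≤ M₂ * (C * Real.exp (κ.re * x)) := by
          rw [norm_mul, Complex.norm_real]
          refine mul_le_mul ?_ (hCb x hx').1 (norm_nonneg _) hM2nn
          rw [norm_mul, norm_mul, Real.norm_of_nonneg (htpos N).le]
          exact (mul_le_of_le_one_left (by have := htpos N; positivity) (htle N)).trans
            ((mul_le_of_le_one_left (norm_nonneg _) (htle N)).trans (hM₂ _))
        have e3 : ‖((t N * deriv f (t N * x) : ℝ) : ℂ) * deriv ψ x‖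
            ≤ M₁ * (C * Real.exp (κ.re * x)) := by
          rw [norm_mul, Complex.norm_real]
          refine mul_le_mul ?_ (hCb x hx').2 (norm_nonneg _) hM1nn
          rw [norm_mul, Real.norm_of_nonneg (htpos N).le]
          exact (mul_le_of_le_one_left (norm_nonneg _) (htle N)).trans (hM₁ _)
        refine (norm_sub_le _ _).trans ?_
        refine (add_le_add (norm_sub_le _ _) le_rfl).trans ?_
        rw [norm_mul (2 : ℂ), Complex.norm_ofNat]
        linarith
      calc _ ≤ ‖m x‖ * ((M₀ * Mη + M₂ * C + 2 * (M₁ * C)) * Real.exp (κ.re * x)) := by gcongr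
        _ = _ := by ring
    · refine Filter.Eventually.of_forall fun x => ?_
      simp only [hL]
      have htx : Filter.Tendsto (fun N => t N * x) Filter.atTop (nhds 0) := by
        simpa using ht0.mul_const x
      have c0 : Filter.Tendsto (fun N => f (t N * x)) Filter.atTop (nhds 1) := by
        rw [← hf0]; exact (hf.continuous.tendsto 0).comp htx
      have c1 : Filter.Tendsto (fun N => deriv f (t N * x)) Filter.atTop (nhds (deriv f 0)) :=
        (hf1.continuous.tendsto 0).comp htx
      have c2 : Filter.Tendsto (fun N => deriv (deriv f) (t N * x)) Filter.atTop
          (nhds (deriv (deriv f) 0)) := (hf2.continuous.tendsto 0).comp htx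
      have d0 := (Complex.continuous_ofReal.tendsto _).comp c0
      have d1 := (Complex.continuous_ofReal.tendsto _).comp (ht0.mul c1)
      have d2 := (Complex.continuous_ofReal.tendsto _).comp (ht0.mul (ht0.mul c2))
      have := (((d0.mul_const (η x)).sub (d2.mul_const (ψ x))).sub
        ((d1.mul_const (deriv ψ x)).const_mul 2)).const_mul (m x)
      simpa using this
  simp only [hzero] at hlim
  exact (tendsto_nhds_unique hlim tendsto_const_nhds)

/-- Functions orthogonal to the range of the operator of a single mode vanish. -/
theorem ae_eq_zero_of_mode_orthogonal {m : ℝ → ℂ} {κ : ℂ} {β R : ℝ} (hβ : β < κ.re)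
    (hm : MemLp (fun x => (Real.exp (β * x) : ℂ) * m x) 2 (volume.restrict (Set.Iio R)))
    (h : ∀ ψ : ℝ → ℂ, ContDiff ℝ ∞ ψ → HasCompactSupport ψ → ψ R = 0 →
      ∫ x in Set.Iio R, m x * (κ ^ 2 * ψ x - deriv (deriv ψ) x) = 0) :
    ∀ᵐ x ∂(volume.restrict (Set.Iio R)), m x = 0 := by
  -- Here β < Re κ enters: this exponential is square integrable at -∞, and e^{Re κ x} m is its
  -- product with another L² function.
  have hexp : MemLp (fun x => (Real.exp ((κ.re - β) * x) : ℂ)) 2 (volume.restrict (Set.Iio R)) := by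
    rw [memLp_two_iff_integrable_sq_norm
      (by fun_prop : Continuous fun x : ℝ => (Real.exp ((κ.re - β) * x) : ℂ)).aestronglyMeasurable]
    have := (integrableOn_exp_mul_Iic (a := 2 * (κ.re - β)) (by linarith) R).mono_set
      Set.Iio_subset_Iic_self
    refine this.congr_fun (fun x _ => ?_) measurableSet_Iio
    simp only [Complex.norm_real, Real.norm_of_nonneg (Real.exp_pos _).le]
    rw [← Real.exp_nat_mul]
    congr 1; push_cast; ring
  have hint : IntegrableOn (fun x => (Real.exp (κ.re * x) : ℂ) * m x) (Set.Iio R) := by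
    refine (hexp.integrable_mul hm).congr (Filter.Eventually.of_forall fun x => ?_)
    simp only [Pi.mul_apply]
    rw [← mul_assoc, ← Complex.ofReal_mul, ← Real.exp_add]
    congr 3; ring
  have key : ∀ᵐ x : ℝ, x ∈ Set.Iio R → (Real.exp (κ.re * x) : ℂ) * m x = 0 := by
    refine isOpen_Iio.ae_eq_zero_of_integral_contDiff_smul_eq_zero
      (locallyIntegrableOn_of_locallyIntegrable_restrict hint.locallyIntegrable) ?_
    intro g hg hgs hgt
    rw [← setIntegral_eq_integral_of_forall_compl_eq_zero (s := Set.Iio R)]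
    -- Testing e^{Re κ x} m against g is testing m against η = e^{Re κ x} g.
    · have hη : ContDiff ℝ ∞ fun x : ℝ => ((Real.exp (κ.re * x) * g x : ℝ) : ℂ) :=
        Complex.ofRealCLM.contDiff.comp
          ((Real.contDiff_exp.comp (contDiff_const.mul contDiff_id)).mul hg)
      have hηs : HasCompactSupport fun x : ℝ => ((Real.exp (κ.re * x) * g x : ℝ) : ℂ) :=
        (hgs.mul_left (f := fun x => Real.exp (κ.re * x))).comp_left (g := ((↑) : ℝ → ℂ)) (by simp)
      rw [← integral_mode_test_eq_zero hint h hη hηs]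
      refine integral_congr_ae (Filter.Eventually.of_forall fun x => ?_)
      simp only [Complex.real_smul]
      push_cast
      ring
    · intro x hx
      have : g x = 0 := image_eq_zero_of_notMem_tsupport fun h' => hx (hgt h')
      simp [this]
  rw [ae_restrict_iff' measurableSet_Iio]
  filter_upwards [key] with x hx hxR
  have := hx hxR
  rcases mul_eq_zero.1 this with h0 | h0
  · exact absurd h0 (by exact_mod_cast (Real.exp_pos _).ne')
  · exact h0

end ModeDensity

/-! ### Sections, mode coefficients and Parseval on the half-cylinder -/

section Slices

variable {n : ℕ} {Ω : Set (EuclideanSpace ℝ (Fin n))}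

theorem lintegral_weightedMeasure (β R : ℝ) (Ω : Set (EuclideanSpace ℝ (Fin n)))
    {g : ℝ × EuclideanSpace ℝ (Fin n) → ENNReal}
    (hg : AEMeasurable g (volume.restrict (semiCylinder R Ω))) :
    ∫⁻ p, g p ∂(weightedMeasure β R Ω)
      = ∫⁻ x in Set.Iio R, ENNReal.ofReal (Real.exp (-2 * β * x)) * ∫⁻ y in Ω, g (x, y) := by
  have hw : Measurable fun p : ℝ × EuclideanSpace ℝ (Fin n) =>
      ENNReal.ofReal (Real.exp (-2 * β * p.1)) := by fun_prop
  rw [weightedMeasure, lintegral_withDensity_eq_lintegral_mul₀ hw.aemeasurable hg]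
  have hr : (volume : Measure (ℝ × EuclideanSpace ℝ (Fin n))).restrict (semiCylinder R Ω)
      = (volume.restrict (Set.Iio R)).prod (volume.restrict Ω) := by
    rw [Measure.prod_restrict]; rfl
  have hg' : AEMeasurable (fun p : ℝ × EuclideanSpace ℝ (Fin n) =>
      ENNReal.ofReal (Real.exp (-2 * β * p.1)) * g p) (volume.restrict (semiCylinder R Ω)) :=
    hw.aemeasurable.mul hg
  rw [hr] at hg' ⊢
  rw [lintegral_prod _ (by exact hg')]
  refine lintegral_congr fun x => ?_
  simp only [Pi.mul_apply]
  rw [lintegral_const_mul' _ _ ENNReal.ofReal_ne_top]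

theorem weightedMeasure_zero (R : ℝ) (Ω : Set (EuclideanSpace ℝ (Fin n))) :
    weightedMeasure 0 R Ω = volume.restrict (semiCylinder R Ω) := by
  simp [weightedMeasure]

/-- The density is positive, so all weights have the same null sets and equations may be compared
across weights. -/
theorem ae_weightedMeasure_iff (β R : ℝ) (Ω : Set (EuclideanSpace ℝ (Fin n)))
    {P : ℝ × EuclideanSpace ℝ (Fin n) → Prop} :
    (∀ᵐ p ∂(weightedMeasure β R Ω), P p) ↔ ∀ᵐ p ∂(volume.restrict (semiCylinder R Ω)), P p := by
  have h1 : weightedMeasure β R Ω ≪ volume.restrict (semiCylinder R Ω) :=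
    withDensity_absolutelyContinuous _ _
  have h2 : volume.restrict (semiCylinder R Ω) ≪ weightedMeasure β R Ω := by
    refine withDensity_absolutelyContinuous' (Measurable.aemeasurable (by fun_prop)) ?_
    exact Filter.Eventually.of_forall fun p =>
      (ENNReal.ofReal_pos.2 (Real.exp_pos _)).ne'
  exact ⟨fun h => h2.ae_le h, fun h => h1.ae_le h⟩

instance (β R : ℝ) (Ω : Set (EuclideanSpace ℝ (Fin n))) :
    IsLocallyFiniteMeasure (weightedMeasure β R Ω) :=
  IsLocallyFiniteMeasure.withDensity_ofReal (by fun_prop)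

theorem hasCompactSupport_slice {F : ℝ × EuclideanSpace ℝ (Fin n) → ℂ} (hs : HasCompactSupport F)
    (x : ℝ) : HasCompactSupport fun y => F (x, y) := by
  refine HasCompactSupport.intro (hs.isCompact.image continuous_snd) fun y hy => ?_
  exact image_eq_zero_of_notMem_tsupport fun h => hy ⟨_, h, rfl⟩

open Classical in
/-- The section `F(x, ·)` as an element of `L²(Ω)`. -/
noncomputable def slice (Ω : Set (EuclideanSpace ℝ (Fin n)))
    (F : ℝ × EuclideanSpace ℝ (Fin n) → ℂ) (x : ℝ) : Lp ℂ 2 (volume.restrict Ω) :=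
  if h : MemLp (fun y => F (x, y)) 2 (volume.restrict Ω) then h.toLp _ else 0

theorem slice_ae_of_memLp {F : ℝ × EuclideanSpace ℝ (Fin n) → ℂ} {x : ℝ}
    (h : MemLp (fun y => F (x, y)) 2 (volume.restrict Ω)) :
    slice Ω F x =ᵐ[volume.restrict Ω] fun y => F (x, y) := by
  rw [slice, dif_pos h]
  exact h.coeFn_toLp

theorem slice_ae {F : ℝ × EuclideanSpace ℝ (Fin n) → ℂ} (hF : Continuous F)
    (hs : HasCompactSupport F) (x : ℝ) :
    slice Ω F x =ᵐ[volume.restrict Ω] fun y => F (x, y) :=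
  slice_ae_of_memLp ((by fun_prop : Continuous fun y => F (x, y)).memLp_of_hasCompactSupport
    (hasCompactSupport_slice hs x))

theorem enorm_sq_eq_lintegral {X : Type*} [MeasurableSpace X] {μ : Measure X} {f : Lp ℂ 2 μ}
    {φ : X → ℂ} (hf : f =ᵐ[μ] φ) : ‖f‖ₑ ^ 2 = ∫⁻ x, ‖φ x‖ₑ ^ 2 ∂μ := by
  rw [Lp.enorm_def, eLpNorm_congr_ae hf,
    eLpNorm_eq_lintegral_rpow_enorm_toReal (by norm_num) (by norm_num)]
  simp only [ENNReal.toReal_ofNat, ENNReal.rpow_ofNat, one_div]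
  rw [← ENNReal.rpow_natCast, ← ENNReal.rpow_mul]
  norm_num

/-- The coefficient of `F(x, ·)` along `h`. -/
noncomputable def modeCoeff (h : Lp ℂ 2 (volume.restrict Ω))
    (F : ℝ × EuclideanSpace ℝ (Fin n) → ℂ) (x : ℝ) : ℂ :=
  inner ℂ h (slice Ω F x)

theorem modeCoeff_eq_integral (h : Lp ℂ 2 (volume.restrict Ω))
    {F : ℝ × EuclideanSpace ℝ (Fin n) → ℂ} (hF : Continuous F) (hs : HasCompactSupport F)
    (x : ℝ) : modeCoeff h F x = ∫ y in Ω, starRingEnd ℂ (h y) * F (x, y) :=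
  L2_inner_eq_integral_of_ae (Filter.EventuallyEq.refl _ _) (slice_ae hF hs x)

/-- The weighted energy of a scalar function on a half-line. -/
noncomputable def modeEnergy (β R : ℝ) (f : ℝ → ℂ) : ENNReal :=
  ∫⁻ x in Set.Iio R, ENNReal.ofReal (Real.exp (-2 * β * x)) * ‖f x‖ₑ ^ 2

theorem HilbertBasis.enorm_sq_eq_tsum {ι H : Type*} [NormedAddCommGroup H] [InnerProductSpace ℂ H]
    (b : HilbertBasis ι ℂ H) (x : H) : ‖x‖ₑ ^ 2 = ∑' k, ‖(inner ℂ (b k) x : ℂ)‖ₑ ^ 2 := by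
  have h := b.hasSum_inner_mul_inner x x
  have h1 : HasSum (fun k => ‖(inner ℂ (b k) x : ℂ)‖ ^ 2) (‖x‖ ^ 2) := by
    have h2 := Complex.hasSum_re h
    have h3 : (fun k => (inner ℂ x (b k) * inner ℂ (b k) x : ℂ).re)
        = fun k => ‖(inner ℂ (b k) x : ℂ)‖ ^ 2 := by
      ext k
      rw [← inner_conj_symm x (b k), Complex.conj_mul']
      exact_mod_cast rfl
    rw [h3] at h2
    have h4 : (inner ℂ x x : ℂ).re = ‖x‖ ^ 2 := by
      rw [inner_self_eq_norm_sq_to_K]; exact_mod_cast rfl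
    rwa [h4] at h2
  have h5 : ∀ z : ℂ, ‖z‖ₑ ^ 2 = ENNReal.ofReal (‖z‖ ^ 2) := fun z => by
    rw [ENNReal.ofReal_pow (norm_nonneg _), ofReal_norm]
  have h6 : ‖x‖ₑ ^ 2 = ENNReal.ofReal (‖x‖ ^ 2) := by
    rw [ENNReal.ofReal_pow (norm_nonneg _), ofReal_norm]
  simp only [h5]
  rw [h6, ← h1.tsum_eq, ENNReal.ofReal_tsum_of_nonneg (fun k => by positivity) h1.summable]

theorem continuous_modeCoeff [IsFiniteMeasure (volume.restrict Ω)]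
    (h : Lp ℂ 2 (volume.restrict Ω)) {F : ℝ × EuclideanSpace ℝ (Fin n) → ℂ} (hF : Continuous F)
    (hs : HasCompactSupport F) : Continuous (modeCoeff h F) := by
  rw [show modeCoeff h F = fun x => ∫ y in Ω, starRingEnd ℂ (h y) * F (x, y) from
    funext (modeCoeff_eq_integral h hF hs)]
  obtain ⟨C, hC⟩ := hs.exists_bound_of_continuous hF
  have hi : Integrable h (volume.restrict Ω) := (Lp.memLp h).integrable (by norm_num)
  have hst : AEStronglyMeasurable (fun y => starRingEnd ℂ (h y)) (volume.restrict Ω) :=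
    (Lp.memLp h).starRingEnd.aestronglyMeasurable
  refine continuous_of_dominated (bound := fun y => ‖h y‖ * C) (fun x => ?_) (fun x => ?_)
    (hi.norm.mul_const C) ?_
  · exact hst.mul (by fun_prop : Continuous fun y => F (x, y)).aestronglyMeasurable
  · refine Filter.Eventually.of_forall fun y => ?_
    rw [norm_mul, RCLike.norm_conj]
    gcongr
    exact hC _
  · exact Filter.Eventually.of_forall fun y => by fun_prop

theorem hasDerivAt_slice {F : ℝ × EuclideanSpace ℝ (Fin n) → ℂ} (hF : ContDiff ℝ ∞ F) (x : ℝ)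
    (y : EuclideanSpace ℝ (Fin n)) :
    HasDerivAt (fun x => F (x, y)) (dirDeriv (1, 0) F (x, y)) x := by
  have h1 : HasFDerivAt F (fderiv ℝ F (x, y)) (x, y) :=
    (hF.differentiable (by simp) (x, y)).hasFDerivAt
  have h2 : HasDerivAt (fun x : ℝ => (x, y)) ((1 : ℝ), (0 : EuclideanSpace ℝ (Fin n))) x :=
    (hasDerivAt_id x).prodMk (hasDerivAt_const x y)
  exact h1.comp_hasDerivAt x h2

/-- Differentiation under the integral sign. On a set of finite measure `h` is integrable, and |h|
sup|∂ₓF| dominates. -/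
theorem hasDerivAt_modeCoeff [IsFiniteMeasure (volume.restrict Ω)]
    (h : Lp ℂ 2 (volume.restrict Ω)) {F : ℝ × EuclideanSpace ℝ (Fin n) → ℂ} (hF : ContDiff ℝ ∞ F)
    (hs : HasCompactSupport F) (x : ℝ) :
    HasDerivAt (modeCoeff h F) (modeCoeff h (dirDeriv (1, 0) F) x) x := by
  have hF' := (hF.dirDeriv (1, 0)).continuous
  have hs' := hs.dirDeriv (1, 0)
  rw [show modeCoeff h F = fun x => ∫ y in Ω, starRingEnd ℂ (h y) * F (x, y) from
    funext (modeCoeff_eq_integral h hF.continuous hs), modeCoeff_eq_integral h hF' hs']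
  obtain ⟨C, hC⟩ := hs'.exists_bound_of_continuous hF'
  obtain ⟨C₀, hC₀⟩ := hs.exists_bound_of_continuous hF.continuous
  have hFc := hF.continuous
  have hi : Integrable h (volume.restrict Ω) := (Lp.memLp h).integrable (by norm_num)
  have hst : AEStronglyMeasurable (fun y => starRingEnd ℂ (h y)) (volume.restrict Ω) :=
    (Lp.memLp h).starRingEnd.aestronglyMeasurable
  have hmeas : ∀ x, AEStronglyMeasurable (fun y => starRingEnd ℂ (h y) * F (x, y))
      (volume.restrict Ω) := fun x =>
    hst.mul (by fun_prop : Continuous fun y => F (x, y)).aestronglyMeasurable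
  refine (hasDerivAt_integral_of_dominated_loc_of_deriv_le (bound := fun y => ‖h y‖ * C)
    (F := fun x y => starRingEnd ℂ (h y) * F (x, y))
    (F' := fun x y => starRingEnd ℂ (h y) * dirDeriv (1, 0) F (x, y)) Filter.univ_mem
    (Filter.Eventually.of_forall hmeas) ?_ ?_ ?_ (hi.norm.mul_const C) ?_).2
  · refine (hi.norm.mul_const C₀).mono' (hmeas x) (Filter.Eventually.of_forall fun y => ?_)
    rw [norm_mul, RCLike.norm_conj]
    gcongr
    exact hC₀ _
  · exact hst.mul (by fun_prop :
      Continuous fun y => dirDeriv (1, 0) F (x, y)).aestronglyMeasurable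
  · refine Filter.Eventually.of_forall fun y x _ => ?_
    rw [norm_mul, RCLike.norm_conj]
    gcongr
    exact hC _
  · exact Filter.Eventually.of_forall fun y x _ => (hasDerivAt_slice hF x y).const_mul _

theorem hasCompactSupport_modeCoeff (h : Lp ℂ 2 (volume.restrict Ω))
    {F : ℝ × EuclideanSpace ℝ (Fin n) → ℂ} (hF : Continuous F) (hs : HasCompactSupport F) :
    HasCompactSupport (modeCoeff h F) := by
  refine HasCompactSupport.intro (hs.isCompact.image continuous_fst) fun x hx => ?_
  rw [modeCoeff_eq_integral h hF hs]
  have : ∀ y, F (x, y) = 0 := fun y =>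
    image_eq_zero_of_notMem_tsupport fun h => hx ⟨_, h, rfl⟩
  simp [this]

/-- Parseval's identity for the weighted energy on the half-cylinder. -/
theorem lintegral_weighted_eq_tsum_modeEnergy [IsFiniteMeasure (volume.restrict Ω)] (β R : ℝ)
    {ι : Type*} [Countable ι] (b : HilbertBasis ι ℂ (Lp ℂ 2 (volume.restrict Ω)))
    {F : ℝ × EuclideanSpace ℝ (Fin n) → ℂ} (hF : Continuous F) (hs : HasCompactSupport F) :
    ∫⁻ p, ‖F p‖ₑ ^ 2 ∂(weightedMeasure β R Ω) = ∑' k, modeEnergy β R (modeCoeff (b k) F) := by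
  rw [lintegral_weightedMeasure β R Ω (by fun_prop)]
  simp only [modeEnergy]
  rw [← lintegral_tsum]
  · refine lintegral_congr fun x => ?_
    rw [← enorm_sq_eq_lintegral (slice_ae hF hs x), b.enorm_sq_eq_tsum, ENNReal.tsum_mul_left]
    rfl
  · intro k
    have := continuous_modeCoeff (b k) hF hs
    fun_prop

theorem lintegral_weighted_eq_lintegral_slice (β R : ℝ)
    {F : ℝ × EuclideanSpace ℝ (Fin n) → ℂ} (hF : Continuous F) (hs : HasCompactSupport F) :
    ∫⁻ p, ‖F p‖ₑ ^ 2 ∂(weightedMeasure β R Ω)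
      = ∫⁻ x in Set.Iio R, ENNReal.ofReal (Real.exp (-2 * β * x)) * ‖slice Ω F x‖ₑ ^ 2 := by
  rw [lintegral_weightedMeasure β R Ω (by fun_prop)]
  refine lintegral_congr fun x => ?_
  rw [← enorm_sq_eq_lintegral (slice_ae hF hs x)]

theorem modeEnergy_eq_ofReal (β R : ℝ) {f : ℝ → ℂ} (hf : Continuous f)
    (hs : HasCompactSupport f) :
    modeEnergy β R f
      = ENNReal.ofReal (∫ x in Set.Iic R, Real.exp (-2 * β * x) * ‖f x‖ ^ 2) := by
  rw [modeEnergy, ofReal_integral_eq_lintegral_ofReal, setLIntegral_congr Iio_ae_eq_Iic]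
  · refine lintegral_congr fun x => ?_
    rw [ENNReal.ofReal_mul (Real.exp_pos _).le, ENNReal.ofReal_pow (norm_nonneg _), ofReal_norm]
  · exact integrableOn_exp_mul (by fun_prop) (hs.comp_left (g := fun z : ℂ => ‖z‖ ^ 2) (by simp))
      β _
  · exact Filter.Eventually.of_forall fun x => by positivity

theorem modeEnergy_congr {β R : ℝ} {f g : ℝ → ℂ} (h : ∀ x < R, f x = g x) :
    modeEnergy β R f = modeEnergy β R g :=
  setLIntegral_congr_fun measurableSet_Iio fun x hx => by simp only [h x hx]

/-- The a priori estimate for a single mode of the model equation. -/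
theorem modeEnergy_estimate {lam κ : ℂ} {a β q r : ℝ} (hlam : 1 + lam ≠ 0) (hβ : 0 ≤ β)
    (hκ : κ ^ 2 = a * (1 + lam) ^ 2) (hp : 0 < κ.re) (hq : q < 1) (hβq : β ≤ q * κ.re)
    (hr : ‖κ‖ ≤ r * κ.re) {c c₁ c₂ : ℝ → ℂ}
    (hc : ∀ x, HasDerivAt c (c₁ x) x) (hc₁ : ∀ x, HasDerivAt c₁ (c₂ x) x)
    (hc₂ : Continuous c₂) (hs : HasCompactSupport c) {R : ℝ} (hR : c R = 0) :
    modeEnergy β R (fun x => a * c x) + ENNReal.ofReal |a| * modeEnergy β R c₁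
        + modeEnergy β R c₂
      ≤ ENNReal.ofReal ((5 * (r / (1 - q)) ^ 2 + 2) * ‖1 + lam‖ ^ 4
          * (‖1 + lam‖⁻¹ ^ 4 + ‖1 + lam‖⁻¹ ^ 2 + 1))
        * modeEnergy β R (fun x => a * c x - ((1 + lam) ^ 2)⁻¹ * c₂ x) := by
  have hcc : Continuous c := continuous_iff_continuousAt.2 fun x => (hc x).continuousAt
  have hcc₁ : Continuous c₁ := continuous_iff_continuousAt.2 fun x => (hc₁ x).continuousAt
  have hs₁ : HasCompactSupport c₁ := by
    have : c₁ = deriv c := funext fun x => (hc x).deriv.symm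
    rw [this]; exact hs.deriv
  have hs₂ : HasCompactSupport c₂ := by
    have : c₂ = deriv c₁ := funext fun x => (hc₁ x).deriv.symm
    rw [this]; exact hs₁.deriv
  set l := ‖1 + lam‖ with hl
  have hl0 : 0 < l := norm_pos_iff.2 hlam
  have key := mode_estimate hβ hp hq hβq hr hc hc₁ hc₂ hs hR
  set N : (ℝ → ℂ) → ℝ := fun f => ∫ x in Set.Iic R, Real.exp (-2 * β * x) * ‖f x‖ ^ 2 with hN
  have hNnn : ∀ f, 0 ≤ N f := fun f => integral_nonneg fun x => by positivity
  have hNmul : ∀ (w : ℂ) (f : ℝ → ℂ), N (fun x => w * f x) = ‖w‖ ^ 2 * N f := fun w f => by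
    simp only [hN]
    rw [← integral_const_mul]
    refine integral_congr_ae (Filter.Eventually.of_forall fun x => ?_)
    simp only [norm_mul]
    ring
  have hk : ‖κ‖ ^ 2 = |a| * l ^ 2 := by
    rw [← norm_pow, hκ, norm_mul, norm_pow, Complex.norm_real, Real.norm_eq_abs]
  have hk4 : ‖κ‖ ^ 4 = |a| ^ 2 * l ^ 4 := by
    calc ‖κ‖ ^ 4 = (‖κ‖ ^ 2) ^ 2 := by ring
      _ = _ := by rw [hk]; ring
  have hg : (fun x => κ ^ 2 * c x - c₂ x)
      = fun x => (1 + lam) ^ 2 * (a * c x - ((1 + lam) ^ 2)⁻¹ * c₂ x) := by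
    ext x
    rw [hκ]
    field_simp
  have hgN : N (fun x => κ ^ 2 * c x - c₂ x)
      = l ^ 4 * N (fun x => a * c x - ((1 + lam) ^ 2)⁻¹ * c₂ x) := by
    rw [hg, hNmul, norm_pow]
    ring
  have key' : ‖κ‖ ^ 4 * N c + ‖κ‖ ^ 2 * N c₁ + N c₂
      ≤ (5 * (r / (1 - q)) ^ 2 + 2) * N (fun x => κ ^ 2 * c x - c₂ x) := key
  rw [hk, hk4, hgN] at key'
  have h1 : N (fun x => a * c x) + |a| * N c₁ + N c₂
      ≤ (5 * (r / (1 - q)) ^ 2 + 2) * l ^ 4 * (l⁻¹ ^ 4 + l⁻¹ ^ 2 + 1)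
        * N (fun x => a * c x - ((1 + lam) ^ 2)⁻¹ * c₂ x) := by
    rw [hNmul, Complex.norm_real, Real.norm_eq_abs]
    -- In terms of a, the three energies carry the factors l⁴, l² and 1. The sum l⁻⁴ + l⁻² + 1
    -- dominates the inverse of each, which normalizes all three at once.
    have h2 := mul_le_mul_of_nonneg_left key' (by positivity : 0 ≤ l⁻¹ ^ 4 + l⁻¹ ^ 2 + 1)
    have e1 : (l⁻¹ ^ 4 + l⁻¹ ^ 2 + 1) * (|a| ^ 2 * l ^ 4 * N c + |a| * l ^ 2 * N c₁ + N c₂)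
        = (|a| ^ 2 * N c + |a| * N c₁ + N c₂) + (|a| ^ 2 * N c * (l ^ 4 + l ^ 2)
          + |a| * N c₁ * (l ^ 2 + l⁻¹ ^ 2) + N c₂ * (l⁻¹ ^ 4 + l⁻¹ ^ 2)) := by
      field_simp
      ring
    have h3 : 0 ≤ |a| ^ 2 * N c * (l ^ 4 + l ^ 2)
          + |a| * N c₁ * (l ^ 2 + l⁻¹ ^ 2) + N c₂ * (l⁻¹ ^ 4 + l⁻¹ ^ 2) := by
      have := hNnn c
      have := hNnn c₁
      have := hNnn c₂
      positivity
    rw [e1] at h2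
    linarith
  have hs0 : HasCompactSupport fun x => (a : ℂ) * c x := hs.mul_left
  have hsg : HasCompactSupport fun x => (a : ℂ) * c x - ((1 + lam) ^ 2)⁻¹ * c₂ x :=
    HasCompactSupport.sub hs0 hs₂.mul_left
  rw [modeEnergy_eq_ofReal β R (by fun_prop) hs0, modeEnergy_eq_ofReal β R hcc₁ hs₁,
    modeEnergy_eq_ofReal β R hc₂ hs₂, modeEnergy_eq_ofReal β R (by fun_prop) hsg,
    ← ENNReal.ofReal_mul (abs_nonneg a), ← ENNReal.ofReal_add (hNnn _)
      (mul_nonneg (abs_nonneg a) (hNnn c₁)),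
    ← ENNReal.ofReal_add (add_nonneg (hNnn _) (mul_nonneg (abs_nonneg a) (hNnn c₁))) (hNnn c₂),
    ← ENNReal.ofReal_mul (by positivity)]
  exact ENNReal.ofReal_le_ofReal h1

end Slices

/-! ### Splitting derivatives into x- and y-directions -/

section MultiIndices

/-- The restriction of a multi-index to all variables but the first one. -/
def MultiIndex.tail {n : ℕ} (a : MultiIndex (n + 1)) : MultiIndex n :=
  ⟨fun i => a.1 i.succ, by
    have := a.2
    rw [Fin.sum_univ_succ] at this
    exact (Nat.le_add_left _ _).trans this⟩

theorem MultiIndex.eq_none_of_sum {n : ℕ} {a : MultiIndex n} (h : ∑ i, (a.1 i : ℕ) = 0) :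
    a = MultiIndex.none n := by
  rw [Finset.sum_eq_zero_iff] at h
  exact Subtype.ext (funext fun i => Fin.ext (h i (Finset.mem_univ i)))

theorem MultiIndex.eq_first_of_sum {n : ℕ} {a : MultiIndex n} (h : ∑ i, (a.1 i : ℕ) ≤ 1) :
    a = MultiIndex.none n ∨ ∃ i, a = MultiIndex.first i := by
  by_cases h0 : ∑ i, (a.1 i : ℕ) = 0
  · exact Or.inl (MultiIndex.eq_none_of_sum h0)
  right
  have h1 : ∑ i, (a.1 i : ℕ) ≠ 0 := h0
  rw [Ne, Finset.sum_eq_zero_iff] at h1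
  push Not at h1
  obtain ⟨i, -, hi⟩ := h1
  rw [← Finset.add_sum_erase _ _ (Finset.mem_univ i)] at h
  refine ⟨i, Subtype.ext (funext fun j => ?_)⟩
  by_cases hj : j = i
  · subst hj
    apply Fin.ext
    simp [MultiIndex.first]
    omega
  · have h2 : ∑ j ∈ Finset.univ.erase i, (a.1 j : ℕ) = 0 := by omega
    rw [Finset.sum_eq_zero_iff] at h2
    have h3 := h2 j (by simp [hj])
    apply Fin.ext
    simp [MultiIndex.first, hj, h3]

theorem MultiIndex.sum_tail {n : ℕ} (a : MultiIndex (n + 1)) :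
    (a.1 0 : ℕ) + ∑ i, (a.tail.1 i : ℕ) ≤ 2 := by
  have := a.2
  rwa [Fin.sum_univ_succ] at this

variable {n : ℕ}

theorem dirDeriv_section {F : ℝ × EuclideanSpace ℝ (Fin n) → ℂ} (hF : ContDiff ℝ ∞ F)
    (v : EuclideanSpace ℝ (Fin n)) (x : ℝ) :
    (fun y => dirDeriv (0, v) F (x, y)) = dirDeriv v fun y => F (x, y) := by
  ext y
  have h1 : HasFDerivAt F (fderiv ℝ F (x, y)) (x, y) :=
    (hF.differentiable (by simp) (x, y)).hasFDerivAt
  have h2 : HasFDerivAt (fun y : EuclideanSpace ℝ (Fin n) => (x, y))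
      (ContinuousLinearMap.inr ℝ ℝ (EuclideanSpace ℝ (Fin n))) y :=
    hasFDerivAt_prodMk_right x y
  have h3 := (h1.comp y h2).fderiv
  have h4 : (F ∘ fun y => (x, y)) = fun y => F (x, y) := rfl
  rw [h4] at h3
  simp [dirDeriv, h3]

theorem dirDeriv_foldr_comm {V : Type*} [NormedAddCommGroup V] [NormedSpace ℝ V] {d : ℕ}
    (e : Fin d → V) (k : Fin d → ℕ) (v : V) {F : V → ℂ} (hF : ContDiff ℝ ∞ F)
    (l : List (Fin d)) :
    dirDeriv v (l.foldr (fun i g => (dirDeriv (e i))^[k i] g) F)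
      = l.foldr (fun i g => (dirDeriv (e i))^[k i] g) (dirDeriv v F) := by
  have step : ∀ (w : V) (m : ℕ) {G : V → ℂ}, ContDiff ℝ ∞ G →
      dirDeriv v ((dirDeriv w)^[m] G) = (dirDeriv w)^[m] (dirDeriv v G) := by
    intro w m G hG
    induction m with
    | zero => rfl
    | succ m ih =>
      rw [Function.iterate_succ_apply', Function.iterate_succ_apply', ← ih,
        dirDeriv_comm (contDiff_dirDeriv_iterate hG w m)]
  induction l with
  | nil => rfl
  | cons i l ih =>
    rw [List.foldr_cons, List.foldr_cons, ← ih, step]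
    exact foldr_dirDeriv_induction e _ (fun φ => ContDiff ℝ ∞ φ) (fun _ _ h => h.dirDeriv _) hF _

/-- The x-derivatives are outermost in the fold. Since derivatives commute they can be applied
first, and the remaining ones act on the section only. -/
theorem partialDeriv_section {F : ℝ × EuclideanSpace ℝ (Fin n) → ℂ} (hF : ContDiff ℝ ∞ F)
    (a : MultiIndex (n + 1)) (x : ℝ) :
    (fun y => partialDeriv (xyDir n) a F (x, y))
      = partialDeriv (yDir n) a.tail fun y => (dirDeriv (1, 0))^[(a.1 0 : ℕ)] F (x, y) := by
  have h0 : partialDeriv (xyDir n) a F = (List.finRange n).foldr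
      (fun i g => (dirDeriv ((0 : ℝ), yDir n i))^[(a.tail.1 i : ℕ)] g)
      ((dirDeriv (1, 0))^[(a.1 0 : ℕ)] F) := by
    have h1 : ∀ m : ℕ, ∀ G : ℝ × EuclideanSpace ℝ (Fin n) → ℂ, ContDiff ℝ ∞ G →
        (dirDeriv (1, 0))^[m] ((List.finRange n).foldr
          (fun i g => (dirDeriv ((0 : ℝ), yDir n i))^[(a.tail.1 i : ℕ)] g) G)
        = (List.finRange n).foldr
          (fun i g => (dirDeriv ((0 : ℝ), yDir n i))^[(a.tail.1 i : ℕ)] g)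
          ((dirDeriv (1, 0))^[m] G) := by
      intro m
      induction m with
      | zero => intro G _; rfl
      | succ m ih =>
        intro G hG
        rw [Function.iterate_succ_apply, Function.iterate_succ_apply, ← ih _ (hG.dirDeriv _),
          dirDeriv_foldr_comm (fun i => ((0 : ℝ), yDir n i)) (fun i => (a.tail.1 i : ℕ)) _ hG]
    rw [← h1 _ F hF, partialDeriv, List.finRange_succ, List.foldr_cons, List.foldr_map]
    rfl
  rw [h0, partialDeriv]
  have hG : ContDiff ℝ ∞ ((dirDeriv (1, 0))^[(a.1 0 : ℕ)] F) := contDiff_dirDeriv_iterate hF _ _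
  generalize (dirDeriv (1, 0))^[(a.1 0 : ℕ)] F = G at hG
  have step : ∀ (v : EuclideanSpace ℝ (Fin n)) (m : ℕ) {G : ℝ × EuclideanSpace ℝ (Fin n) → ℂ},
      ContDiff ℝ ∞ G → (fun y => (dirDeriv ((0 : ℝ), v))^[m] G (x, y))
        = (dirDeriv v)^[m] fun y => G (x, y) := by
    intro v m G hG
    induction m with
    | zero => rfl
    | succ m ih =>
      rw [Function.iterate_succ_apply', Function.iterate_succ_apply', ← ih,
        dirDeriv_section (contDiff_dirDeriv_iterate hG _ _)]
  induction List.finRange n with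
  | nil => rfl
  | cons i l ih =>
    rw [List.foldr_cons, List.foldr_cons, ← ih, step]
    exact foldr_dirDeriv_induction (fun i => ((0 : ℝ), yDir n i)) _ (fun φ => ContDiff ℝ ∞ φ)
      (fun _ _ h => h.dirDeriv _) hG _

theorem xyDir_zero (n : ℕ) : xyDir n 0 = (1, 0) := rfl

theorem xyDir_succ {n : ℕ} (i : Fin n) : xyDir n i.succ = (0, yDir n i) := rfl

end MultiIndices

/-! ### The model operator on smooth functions -/

section TestEstimate

variable {n : ℕ} {Ω : Set (EuclideanSpace ℝ (Fin n))}

/-- `(Δ_Ω - μ) F` for a smooth function `F` on the cylinder. -/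
noncomputable def cylinderCross (μ : ℂ) (F : ℝ × EuclideanSpace ℝ (Fin n) → ℂ) :
    ℝ × EuclideanSpace ℝ (Fin n) → ℂ :=
  fun p => -(∑ i, dirDeriv (0, yDir n i) (dirDeriv (0, yDir n i) F) p) - μ * F p

/-- `(Δ_Ω - z ∂ₓ² - μ) F` for a smooth function `F` on the cylinder. -/
noncomputable def cylinderModel (z μ : ℂ) (F : ℝ × EuclideanSpace ℝ (Fin n) → ℂ) :
    ℝ × EuclideanSpace ℝ (Fin n) → ℂ :=
  fun p => cylinderCross μ F p - z * dirDeriv (1, 0) (dirDeriv (1, 0) F) p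

theorem continuous_cylinderCross (μ : ℂ) {F : ℝ × EuclideanSpace ℝ (Fin n) → ℂ}
    (hF : ContDiff ℝ ∞ F) : Continuous (cylinderCross μ F) := by
  have h : ∀ i, Continuous (dirDeriv (0, yDir n i) (dirDeriv (0, yDir n i) F)) := fun i =>
    ((hF.dirDeriv _).dirDeriv _).continuous
  have := hF.continuous
  unfold cylinderCross
  fun_prop

theorem hasCompactSupport_cylinderCross (μ : ℂ) {F : ℝ × EuclideanSpace ℝ (Fin n) → ℂ}
    (hs : HasCompactSupport F) : HasCompactSupport (cylinderCross μ F) := by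
  refine HasCompactSupport.intro hs.isCompact fun p hp => ?_
  have h : ∀ i, dirDeriv (0, yDir n i) (dirDeriv (0, yDir n i) F) p = 0 := fun i =>
    image_eq_zero_of_notMem_tsupport fun h =>
      hp (tsupport_dirDeriv_subset _ _ (tsupport_dirDeriv_subset _ _ h))
  simp [cylinderCross, h, image_eq_zero_of_notMem_tsupport hp]

theorem continuous_cylinderModel (z μ : ℂ) {F : ℝ × EuclideanSpace ℝ (Fin n) → ℂ}
    (hF : ContDiff ℝ ∞ F) : Continuous (cylinderModel z μ F) := by
  have h : Continuous (dirDeriv (1, 0) (dirDeriv (1, 0) F)) :=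
    ((hF.dirDeriv _).dirDeriv _).continuous
  have := continuous_cylinderCross μ hF
  unfold cylinderModel
  fun_prop

theorem hasCompactSupport_cylinderModel (z μ : ℂ) {F : ℝ × EuclideanSpace ℝ (Fin n) → ℂ}
    (hs : HasCompactSupport F) : HasCompactSupport (cylinderModel z μ F) :=
  HasCompactSupport.sub (hasCompactSupport_cylinderCross μ hs)
    (HasCompactSupport.mul_left (((hs.dirDeriv (1, 0)).dirDeriv (1, 0))))

/-- The jet of a section `F(x, ·)` vanishing on the boundary of `Ω`. -/
theorem exists_sliceJet (μ : ℂ) {F : ℝ × EuclideanSpace ℝ (Fin n) → ℂ} (hF : ContDiff ℝ ∞ F)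
    (hs : HasCompactSupport F) {x : ℝ} (h0 : ∀ y ∈ frontier Ω, F (x, y) = 0) :
    ∃ U ∈ H20CrossSection Ω,
      (∀ a, U a =ᵐ[volume.restrict Ω] partialDeriv (yDir n) a fun y => F (x, y)) ∧
      U (MultiIndex.none n) = slice Ω F x ∧
      crossLaplacianSub μ U = slice Ω (cylinderCross μ F) x := by
  have ht : IsDirichletTest Ω fun y => F (x, y) :=
    ⟨hF.comp (contDiff_const.prodMk contDiff_id), hasCompactSupport_slice hs x, h0⟩
  obtain ⟨U, hU, hUa⟩ := exists_testJet (yDir n) (volume.restrict Ω) ht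
  refine ⟨U, hU, hUa, ?_, ?_⟩
  · refine Lp.ext ((hUa _).trans ?_)
    rw [partialDeriv_none]
    exact (slice_ae hF.continuous hs x).symm
  · refine Lp.ext ?_
    refine Filter.EventuallyEq.trans ?_
      (slice_ae (continuous_cylinderCross μ hF) (hasCompactSupport_cylinderCross μ hs) x).symm
    have h1 := hUa (MultiIndex.none n)
    rw [partialDeriv_none] at h1
    have h2 : ∀ᵐ y ∂(volume.restrict Ω), ∀ i, U (MultiIndex.second i) y
        = dirDeriv (0, yDir n i) (dirDeriv (0, yDir n i) F) (x, y) := by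
      rw [ae_all_iff]
      intro i
      have h3 := hUa (MultiIndex.second i)
      rw [partialDeriv_second, ← dirDeriv_section hF, ← dirDeriv_section (hF.dirDeriv _)] at h3
      exact h3
    rw [crossLaplacianSub]
    filter_upwards [h1, h2, Lp.coeFn_sub (-∑ i, U (MultiIndex.second i))
      (μ • U (MultiIndex.none n)), Lp.coeFn_neg (∑ i, U (MultiIndex.second i)),
      Lp.coeFn_smul μ (U (MultiIndex.none n)),
      Lp.coeFn_finsetSum Finset.univ fun i => U (MultiIndex.second i)] with y g1 g2 g3 g4 g5 g6
    rw [g3, Pi.sub_apply, g4, Pi.neg_apply, g5, Pi.smul_apply, g6, Finset.sum_apply]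
    simp [cylinderCross, g1, g2]

end TestEstimate

/-- Subadditivity on finite sums, passed to the limit. No sign of the terms is required, since
truncating negative terms only enlarges the right side. -/
theorem ENNReal.ofReal_tsum_le_tsum_ofReal {ι : Type*} {f : ι → ℝ} (hf : Summable f) :
    ENNReal.ofReal (∑' k, f k) ≤ ∑' k, ENNReal.ofReal (f k) := by
  refine le_of_tendsto ((ENNReal.continuous_ofReal.tendsto _).comp hf.hasSum)
    (Filter.Eventually.of_forall fun s => ?_)
  refine le_trans ?_ (ENNReal.sum_le_tsum s)
  exact Finset.le_sum_of_subadditive ENNReal.ofReal ENNReal.ofReal_zero.le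
    (fun _ _ => ENNReal.ofReal_add_le) s f

/-! ### A priori estimate for test functions -/

section TestEstimate

variable {n : ℕ} {Ω : Set (EuclideanSpace ℝ (Fin n))} {μ₀ : ℝ} {lam : ℂ} {β : ℝ}
  {T : Lp ℂ 2 (volume.restrict Ω) →L[ℂ] Lp ℂ 2 (volume.restrict Ω)}

namespace ModeData

variable (D : ModeData Ω T lam β)

theorem a_ne_zero (k : D.ι) : D.a k ≠ 0 := by
  have := D.δ_pos
  intro h
  have h2 : D.δ ≤ |D.a k| := D.le_abs_a k
  rw [h, abs_zero] at h2
  linarith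

theorem inner_crossLaplacianSub (hT : IsDirichletResolvent Ω μ₀ T) (hΩ : IsOpen Ω) (k : D.ι)
    {U : Jet n (volume.restrict Ω)} (hU : U ∈ H20CrossSection Ω) :
    inner ℂ (D.b k) (crossLaplacianSub μ₀ U) = D.a k * inner ℂ (D.b k) (U (MultiIndex.none n)) := by
  rw [← hT.left_inv U hU]
  have h := hT.isSymmetric hΩ (D.b k) (crossLaplacianSub μ₀ U)
  have ha : (D.a k : ℂ) ≠ 0 := by exact_mod_cast D.a_ne_zero k
  have h' : inner ℂ (D.b k) (T (crossLaplacianSub μ₀ U))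
      = inner ℂ (T (D.b k)) (crossLaplacianSub μ₀ U) := h.symm
  rw [h', D.apply_b, inner_smul_left, map_inv₀, Complex.conj_ofReal, mul_inv_cancel_left₀ ha]

/-- The coefficients of `(Δ_Ω - μ₀) F(x, ·)`. -/
theorem modeCoeff_cylinderCross (hT : IsDirichletResolvent Ω μ₀ T) (hΩ : IsOpen Ω) (k : D.ι)
    {F : ℝ × EuclideanSpace ℝ (Fin n) → ℂ} (hF : ContDiff ℝ ∞ F) (hs : HasCompactSupport F)
    {x : ℝ} (h0 : ∀ y ∈ frontier Ω, F (x, y) = 0) :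
    modeCoeff (D.b k) (cylinderCross μ₀ F) x = D.a k * modeCoeff (D.b k) F x := by
  obtain ⟨U, hU, -, h1, h2⟩ := exists_sliceJet (μ₀ : ℂ) hF hs h0
  rw [modeCoeff, modeCoeff, ← h1, ← h2, D.inner_crossLaplacianSub hT hΩ k hU]

/-- The first order part of the energy identity in terms of the modes. -/
theorem enorm_sq_le_tsum (hT : IsDirichletResolvent Ω μ₀ T) (hΩ : IsOpen Ω)
    {U : Jet n (volume.restrict Ω)} (hU : U ∈ H20CrossSection Ω) {t : MultiIndex n}
    (ht : t = MultiIndex.none n ∨ ∃ i, t = MultiIndex.first i) :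
    ‖U t‖ₑ ^ 2 ≤ ENNReal.ofReal (1 + (|μ₀| + 1) / D.δ)
      * ∑' k, ENNReal.ofReal |D.a k| * ‖(inner ℂ (D.b k) (U (MultiIndex.none n)) : ℂ)‖ₑ ^ 2 := by
  set x : D.ι → ℂ := fun k => inner ℂ (D.b k) (U (MultiIndex.none n)) with hx
  have hre : ∀ f : Lp ℂ 2 (volume.restrict Ω), (inner ℂ f f : ℂ).re = ‖f‖ ^ 2 := fun f => by
    rw [inner_self_eq_norm_sq_to_K]; exact_mod_cast rfl
  have hsum : ∀ c : ℝ, ∀ V, (∀ k, inner ℂ (D.b k) V = (c + D.a k : ℂ) * x k) →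
      HasSum (fun k => (c + D.a k) * ‖x k‖ ^ 2) (inner ℂ (U (MultiIndex.none n)) V : ℂ).re := by
    intro c V hV
    have h := Complex.hasSum_re (D.b.hasSum_inner_mul_inner (U (MultiIndex.none n)) V)
    have e : (fun k => (inner ℂ (U (MultiIndex.none n)) (D.b k) * inner ℂ (D.b k) V : ℂ).re)
        = fun k => (c + D.a k) * ‖x k‖ ^ 2 := by
      ext k
      rw [hV, ← inner_conj_symm _ (D.b k), mul_left_comm]
      change ((c + D.a k : ℂ) * (starRingEnd ℂ (x k) * x k)).re = _
      rw [Complex.conj_mul']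
      norm_cast
    rwa [e] at h
  -- Written as (Δ_Ω - μ₀) + (μ₀ + 1), the operator Δ_Ω + 1 has eigenvalues μ₀ + 1 + a, and its form
  -- is the squared H¹ norm.
  have h1 := hsum (μ₀ + 1) (crossLaplacianSub μ₀ U + ((μ₀ : ℂ) + 1) • U (MultiIndex.none n))
    fun k => by
      rw [inner_add_right, inner_smul_right, D.inner_crossLaplacianSub hT hΩ k hU]
      push_cast
      ring
  rw [inner_add_right, inner_smul_right, _root_.inner_crossLaplacianSub hΩ _ hU hU] at h1
  have h2 : (∑ i, inner ℂ (U (MultiIndex.first i)) (U (MultiIndex.first i))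
      - (μ₀ : ℂ) * inner ℂ (U (MultiIndex.none n)) (U (MultiIndex.none n))
      + ((μ₀ : ℂ) + 1) * inner ℂ (U (MultiIndex.none n)) (U (MultiIndex.none n))).re
      = ∑ i, ‖U (MultiIndex.first i)‖ ^ 2 + ‖U (MultiIndex.none n)‖ ^ 2 := by
    rw [sub_add, ← sub_mul, sub_add_cancel_left, neg_mul, sub_neg_eq_add, one_mul, Complex.add_re,
      Complex.re_sum, hre]
    simp only [hre]
  rw [h2] at h1
  have h3 : ‖U t‖ ^ 2 ≤ ∑ i, ‖U (MultiIndex.first i)‖ ^ 2 + ‖U (MultiIndex.none n)‖ ^ 2 := by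
    rcases ht with rfl | ⟨i, rfl⟩
    · have : 0 ≤ ∑ i, ‖U (MultiIndex.first i)‖ ^ 2 := Finset.sum_nonneg fun i _ => by positivity
      linarith
    · have := Finset.single_le_sum (f := fun i => ‖U (MultiIndex.first i)‖ ^ 2)
        (fun i _ => by positivity) (Finset.mem_univ i)
      have h4 : 0 ≤ ‖U (MultiIndex.none n)‖ ^ 2 := by positivity
      linarith
  -- The lower bound δ ≤ |a| absorbs the constant μ₀ + 1 into |a|.
  have h5 : ∀ k, (μ₀ + 1 + D.a k) * ‖x k‖ ^ 2
      ≤ (1 + (|μ₀| + 1) / D.δ) * (|D.a k| * ‖x k‖ ^ 2) := by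
    intro k
    have g1 := D.le_abs_a k
    have g2 := D.δ_pos
    have g3 : |μ₀| + 1 ≤ (|μ₀| + 1) / D.δ * |D.a k| := by
      rw [div_mul_eq_mul_div, le_div_iff₀ g2]
      gcongr
    have g4 := le_abs_self μ₀
    have g5 := le_abs_self (D.a k)
    rw [← mul_assoc]
    gcongr
    linarith
  calc ‖U t‖ₑ ^ 2 = ENNReal.ofReal (‖U t‖ ^ 2) := by
        rw [ENNReal.ofReal_pow (norm_nonneg _), ofReal_norm]
    _ ≤ ENNReal.ofReal (∑' k, (μ₀ + 1 + D.a k) * ‖x k‖ ^ 2) := by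
        rw [h1.tsum_eq]; exact ENNReal.ofReal_le_ofReal h3
    _ ≤ ∑' k, ENNReal.ofReal ((μ₀ + 1 + D.a k) * ‖x k‖ ^ 2) :=
        ENNReal.ofReal_tsum_le_tsum_ofReal h1.summable
    _ ≤ ∑' k, ENNReal.ofReal (1 + (|μ₀| + 1) / D.δ) * (ENNReal.ofReal |D.a k| * ‖x k‖ₑ ^ 2) := by
        refine ENNReal.tsum_le_tsum fun k => (ENNReal.ofReal_le_ofReal (h5 k)).trans_eq ?_
        have := D.δ_pos
        rw [ENNReal.ofReal_mul (by positivity), ENNReal.ofReal_mul (abs_nonneg _),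
          ENNReal.ofReal_pow (norm_nonneg _), ofReal_norm]
    _ = _ := ENNReal.tsum_mul_left

end ModeData

theorem frontier_semiCylinder_of_lt {R x : ℝ} (hx : x ≤ R) {y : EuclideanSpace ℝ (Fin n)}
    (hy : y ∈ frontier Ω) : (x, y) ∈ frontier (semiCylinder R Ω) := by
  rw [semiCylinder, frontier_prod_eq]
  exact Or.inl ⟨by simpa using hx, hy⟩

theorem mem_frontier_semiCylinder {R : ℝ} {y : EuclideanSpace ℝ (Fin n)}
    (hy : y ∈ closure Ω) : (R, y) ∈ frontier (semiCylinder R Ω) := by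
  rw [semiCylinder, frontier_prod_eq]
  exact Or.inr ⟨by simp, hy⟩

/-- Lets the x-derivative inherit the lateral Dirichlet condition, so that its sections lie in
H²₀(Ω) for x < R. -/
theorem dirDeriv_eq_zero_of_forall_le {F : ℝ × EuclideanSpace ℝ (Fin n) → ℂ}
    (hF : ContDiff ℝ ∞ F) {R x : ℝ} (hx : x < R) {y : EuclideanSpace ℝ (Fin n)}
    (h0 : ∀ x ≤ R, F (x, y) = 0) : dirDeriv (1, 0) F (x, y) = 0 := by
  refine (hasDerivAt_slice hF x y).unique ?_
  refine (hasDerivAt_const x (0 : ℂ)).congr_of_eventuallyEq ?_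
  filter_upwards [Iio_mem_nhds hx] with s hs
  exact h0 s (le_of_lt hs)

theorem modeCoeff_sub_mul [IsFiniteMeasure (volume.restrict Ω)]
    (h : Lp ℂ 2 (volume.restrict Ω)) {F G : ℝ × EuclideanSpace ℝ (Fin n) → ℂ}
    (hF : Continuous F) (hFs : HasCompactSupport F) (hG : Continuous G)
    (hGs : HasCompactSupport G) (z : ℂ) (x : ℝ) :
    modeCoeff h (fun p => F p - z * G p) x = modeCoeff h F x - z * modeCoeff h G x := by
  have e : slice Ω (fun p => F p - z * G p) x = slice Ω F x - z • slice Ω G x := by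
    have hs : HasCompactSupport fun p => F p - z * G p :=
      HasCompactSupport.sub hFs hGs.mul_left
    refine Lp.ext ((slice_ae (by fun_prop) hs x).trans ?_)
    filter_upwards [slice_ae hF hFs x, slice_ae hG hGs x, Lp.coeFn_sub (slice Ω F x)
      (z • slice Ω G x), Lp.coeFn_smul z (slice Ω G x)] with y h1 h2 h3 h4
    rw [h3, Pi.sub_apply, h4, Pi.smul_apply, h1, h2, smul_eq_mul]
  rw [modeCoeff, e, inner_sub_right, inner_smul_right]
  rfl

/-- The a priori estimate of the model problem for test functions. -/
theorem ModeData.exists_test_estimate [IsFiniteMeasure (volume.restrict Ω)]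
    (D : ModeData Ω T lam β) (hβ : 0 ≤ β) (hlam : 1 + lam ≠ 0)
    (hT : IsDirichletResolvent Ω μ₀ T) (hΩ : IsOpen Ω) :
    ∃ C : ℝ, ∀ (R : ℝ) (F : ℝ × EuclideanSpace ℝ (Fin n) → ℂ),
      IsDirichletTest (semiCylinder R Ω) F → ∀ a,
        ∫⁻ p, ‖partialDeriv (xyDir n) a F p‖ₑ ^ 2 ∂(weightedMeasure β R Ω)
          ≤ ENNReal.ofReal C
            * ∫⁻ p, ‖cylinderModel ((1 + lam) ^ 2)⁻¹ μ₀ F p‖ₑ ^ 2 ∂(weightedMeasure β R Ω) := by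
  obtain ⟨C₁, hC₁, hreg⟩ := hT.exists_norm_le hΩ
  have := D.countable
  set A : ℝ := (5 * (D.r / (1 - D.q)) ^ 2 + 2) * ‖1 + lam‖ ^ 4
          * (‖1 + lam‖⁻¹ ^ 4 + ‖1 + lam‖⁻¹ ^ 2 + 1) with hA
  set K : ℝ := 1 + (|μ₀| + 1) / D.δ with hK
  have hK1 : 1 ≤ K := by
    have := D.δ_pos
    have : 0 ≤ (|μ₀| + 1) / D.δ := by positivity
    linarith
  have hA0 : 0 ≤ A := by positivity
  -- The factor C₁² serves derivatives in y only, K those with one x-derivative, and K ≥ 1 covers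
  -- the second x-derivative.
  refine ⟨(C₁ ^ 2 + K) * A, fun R F hF a => ?_⟩
  obtain ⟨hFs, hFc, hF0⟩ := hF
  have hF1s := hFs.dirDeriv (1, 0)
  have hF1c := hFc.dirDeriv (1, 0)
  have hF2s := hF1s.dirDeriv (1, 0)
  have hF2c := hF1c.dirDeriv (1, 0)
  set F₁ := dirDeriv (1, 0) F with hF₁
  set F₂ := dirDeriv (1, 0) F₁ with hF₂
  have hx0 : ∀ x ≤ R, ∀ y ∈ frontier Ω, F (x, y) = 0 := fun x hx y hy =>
    hF0 _ (frontier_semiCylinder_of_lt hx hy)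
  have hx1 : ∀ x < R, ∀ y ∈ frontier Ω, F₁ (x, y) = 0 := fun x hx y hy =>
    dirDeriv_eq_zero_of_forall_le hFs hx fun s hs => hx0 s hs y hy
  have hXs : ContDiff ℝ ∞ (partialDeriv (xyDir n) a F) := hFs.partialDeriv _ _
  have hXc : HasCompactSupport (partialDeriv (xyDir n) a F) := hFc.partialDeriv _ _
  have hE0 := continuous_cylinderCross (μ₀ : ℂ) hFs
  have hE0c := hasCompactSupport_cylinderCross (μ₀ : ℂ) hFc
  set z : ℂ := ((1 + lam) ^ 2)⁻¹ with hz
  set S := ∑' k, modeEnergy β R (modeCoeff (D.b k) (cylinderModel z μ₀ F)) with hS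
  have hmain : ∑' k, (modeEnergy β R (fun x => D.a k * modeCoeff (D.b k) F x)
      + ENNReal.ofReal |D.a k| * modeEnergy β R (modeCoeff (D.b k) F₁)
      + modeEnergy β R (modeCoeff (D.b k) F₂)) ≤ ENNReal.ofReal A * S := by
    rw [hS, ← ENNReal.tsum_mul_left]
    refine ENNReal.tsum_le_tsum fun k => ?_
    have hR : modeCoeff (D.b k) F R = 0 := by
      rw [modeCoeff_eq_integral _ hFs.continuous hFc]
      refine setIntegral_eq_zero_of_forall_eq_zero fun y hy => ?_
      rw [hF0 _ (mem_frontier_semiCylinder (subset_closure hy)), mul_zero]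
    have h := modeEnergy_estimate hlam hβ (D.κ_sq k) (D.re_pos k) D.q_lt_one (D.le_re k)
      (D.norm_le k) (hasDerivAt_modeCoeff (D.b k) hFs hFc)
      (hasDerivAt_modeCoeff (D.b k) hF1s hF1c)
      (continuous_modeCoeff (D.b k) hF2s.continuous hF2c)
      (hasCompactSupport_modeCoeff (D.b k) hFs.continuous hFc) hR
    refine h.trans_eq ?_
    rw [modeEnergy_congr (f := modeCoeff (D.b k) (cylinderModel z μ₀ F))]
    intro x hx
    rw [← D.modeCoeff_cylinderCross hT hΩ k hFs hFc (hx0 x hx.le)]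
    exact modeCoeff_sub_mul (D.b k) hE0 hE0c hF2s.continuous hF2c z x
  have hparts : (∑' k, modeEnergy β R (fun x => D.a k * modeCoeff (D.b k) F x)
        ≤ ENNReal.ofReal A * S) ∧
      (∑' k, ENNReal.ofReal |D.a k| * modeEnergy β R (modeCoeff (D.b k) F₁)
        ≤ ENNReal.ofReal A * S) ∧
      (∑' k, modeEnergy β R (modeCoeff (D.b k) F₂) ≤ ENNReal.ofReal A * S) := by
    refine ⟨le_trans (ENNReal.tsum_le_tsum fun k => ?_) hmain,
      le_trans (ENNReal.tsum_le_tsum fun k => ?_) hmain,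
      le_trans (ENNReal.tsum_le_tsum fun k => ?_) hmain⟩
    · rw [add_assoc]; exact le_self_add
    · exact le_add_right le_add_self
    · exact le_add_self
  obtain ⟨p0, p1, p2⟩ := hparts
  rw [lintegral_weighted_eq_tsum_modeEnergy β R D.b (continuous_cylinderModel z μ₀ hFs)
    (hasCompactSupport_cylinderModel z μ₀ hFc), ENNReal.ofReal_mul (by positivity), mul_assoc]
  have hC1 : ENNReal.ofReal (C₁ ^ 2) ≤ ENNReal.ofReal (C₁ ^ 2 + K) :=
    ENNReal.ofReal_le_ofReal (by linarith)
  have hC2 : ENNReal.ofReal K ≤ ENNReal.ofReal (C₁ ^ 2 + K) :=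
    ENNReal.ofReal_le_ofReal (by nlinarith)
  have hC3 : 1 ≤ ENNReal.ofReal (C₁ ^ 2 + K) := by
    rw [← ENNReal.ofReal_one]
    exact ENNReal.ofReal_le_ofReal (by nlinarith)
  have hsum := a.sum_tail
  have hsec := fun x => partialDeriv_section hFs a x
  have hX : ∀ x, slice Ω (partialDeriv (xyDir n) a F) x =ᵐ[volume.restrict Ω]
      partialDeriv (yDir n) a.tail fun y => (dirDeriv (1, 0))^[(a.1 0 : ℕ)] F (x, y) := fun x => by
    rw [← hsec]
    exact slice_ae hXs.continuous hXc x
  -- The number of x-derivatives selects the tool: H² regularity on each section, the quadratic form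
  -- applied to sections of ∂ₓF, or Parseval for ∂ₓ²F alone.
  rcases (by omega : (a.1 0 : ℕ) = 0 ∨ (a.1 0 : ℕ) = 1 ∨ (a.1 0 : ℕ) = 2) with h0 | h0 | h0
  · simp only [h0, Function.iterate_zero, id] at hX
    calc ∫⁻ p, ‖partialDeriv (xyDir n) a F p‖ₑ ^ 2 ∂(weightedMeasure β R Ω)
        ≤ ENNReal.ofReal (C₁ ^ 2)
          * ∫⁻ p, ‖cylinderCross μ₀ F p‖ₑ ^ 2 ∂(weightedMeasure β R Ω) := by
          rw [lintegral_weighted_eq_lintegral_slice β R hXs.continuous hXc,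
            lintegral_weighted_eq_lintegral_slice β R hE0 hE0c,
            ← lintegral_const_mul' _ _ ENNReal.ofReal_ne_top]
          refine setLIntegral_mono' measurableSet_Iio fun x hx => ?_
          rw [mul_left_comm]
          gcongr
          obtain ⟨U, hU, hUa, -, hU2⟩ := exists_sliceJet (μ₀ : ℂ) hFs hFc (hx0 x hx.le)
          have e : slice Ω (partialDeriv (xyDir n) a F) x = U a.tail :=
            Lp.ext ((hX x).trans (hUa _).symm)
          rw [e, ← hU2, ← ofReal_norm, ← ofReal_norm, ← ENNReal.ofReal_pow (norm_nonneg _),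
            ← ENNReal.ofReal_pow (norm_nonneg _), ← ENNReal.ofReal_mul (by positivity)]
          refine ENNReal.ofReal_le_ofReal ?_
          rw [← mul_pow]
          have h1 : ‖U a.tail‖ ≤ ‖U‖ := PiLp.norm_apply_le U _
          exact pow_le_pow_left₀ (norm_nonneg _) (h1.trans (hreg U hU)) 2
      _ = ENNReal.ofReal (C₁ ^ 2)
          * ∑' k, modeEnergy β R (fun x => D.a k * modeCoeff (D.b k) F x) := by
          rw [lintegral_weighted_eq_tsum_modeEnergy β R D.b hE0 hE0c]
          congr 1
          refine tsum_congr fun k => modeEnergy_congr fun x hx => ?_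
          exact D.modeCoeff_cylinderCross hT hΩ k hFs hFc (hx0 x hx.le)
      _ ≤ _ := mul_le_mul' hC1 p0
  · simp only [h0, Function.iterate_one] at hX
    have ht := MultiIndex.eq_first_of_sum (a := a.tail) (by omega)
    calc ∫⁻ p, ‖partialDeriv (xyDir n) a F p‖ₑ ^ 2 ∂(weightedMeasure β R Ω)
        ≤ ENNReal.ofReal K
          * ∑' k, ENNReal.ofReal |D.a k| * modeEnergy β R (modeCoeff (D.b k) F₁) := by
          rw [lintegral_weighted_eq_lintegral_slice β R hXs.continuous hXc]
          have e : ∑' k, ENNReal.ofReal |D.a k| * modeEnergy β R (modeCoeff (D.b k) F₁)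
              = ∫⁻ x in Set.Iio R, ENNReal.ofReal (Real.exp (-2 * β * x))
                * ∑' k, ENNReal.ofReal |D.a k| * ‖modeCoeff (D.b k) F₁ x‖ₑ ^ 2 := by
            simp only [← ENNReal.tsum_mul_left]
            rw [lintegral_tsum]
            · refine tsum_congr fun k => ?_
              rw [modeEnergy, ← lintegral_const_mul' _ _ ENNReal.ofReal_ne_top]
              exact lintegral_congr fun x => mul_left_comm _ _ _
            · intro k
              have := continuous_modeCoeff (D.b k) hF1s.continuous hF1c
              fun_prop
          rw [e, ← lintegral_const_mul' _ _ ENNReal.ofReal_ne_top]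
          refine setLIntegral_mono' measurableSet_Iio fun x hx => ?_
          rw [mul_left_comm]
          gcongr
          obtain ⟨U, hU, hUa, hU0, -⟩ := exists_sliceJet (μ₀ : ℂ) hF1s hF1c (hx1 x hx)
          have e : slice Ω (partialDeriv (xyDir n) a F) x = U a.tail :=
            Lp.ext ((hX x).trans (hUa _).symm)
          rw [e]
          have := D.enorm_sq_le_tsum hT hΩ hU ht
          rw [hU0] at this
          exact this
      _ ≤ _ := mul_le_mul' hC2 p1
  · have ht := MultiIndex.eq_none_of_sum (a := a.tail) (by omega)
    have e : partialDeriv (xyDir n) a F = F₂ := by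
      ext p
      have := congrFun (hsec p.1) p.2
      rw [h0, ht, partialDeriv_none] at this
      exact this
    rw [e, lintegral_weighted_eq_tsum_modeEnergy β R D.b hF2s.continuous hF2c]
    calc _ ≤ ENNReal.ofReal A * S := p2
      _ ≤ _ := le_mul_of_one_le_left' hC3

end TestEstimate

/-! ### The a priori estimate on the weighted Sobolev space -/

section ModelOperator

variable {n : ℕ} {Ω : Set (EuclideanSpace ℝ (Fin n))} {μ₀ : ℝ} {lam : ℂ} {β R : ℝ}
  {T : Lp ℂ 2 (volume.restrict Ω) →L[ℂ] Lp ℂ 2 (volume.restrict Ω)}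

/-- `Δ_Ω - z ∂ₓ² - μ` as a continuous linear map on jets. -/
noncomputable def modelCLM (ν : Measure (ℝ × EuclideanSpace ℝ (Fin n))) (z μ : ℂ) :
    Jet (n + 1) ν →L[ℂ] Lp ℂ 2 ν :=
  -(∑ i : Fin n, PiLp.proj 2 _ (MultiIndex.second i.succ))
    - z • PiLp.proj 2 _ (MultiIndex.second 0) - μ • PiLp.proj 2 _ (MultiIndex.none (n + 1))

theorem modelCLM_ae {ν : Measure (ℝ × EuclideanSpace ℝ (Fin n))} (z μ : ℂ)
    (U : Jet (n + 1) ν) :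
    modelCLM ν z μ U =ᵐ[ν] fun p => -(∑ i : Fin n, U (MultiIndex.second i.succ) p)
      - z * U (MultiIndex.second 0) p - μ * U (MultiIndex.none (n + 1)) p := by
  have e : modelCLM ν z μ U = -(∑ i : Fin n, U (MultiIndex.second i.succ))
      - z • U (MultiIndex.second 0) - μ • U (MultiIndex.none (n + 1)) := by
    simp [modelCLM]
  rw [e]
  filter_upwards [Lp.coeFn_sub (-(∑ i : Fin n, U (MultiIndex.second i.succ))
      - z • U (MultiIndex.second 0)) (μ • U (MultiIndex.none (n + 1))),
    Lp.coeFn_sub (-(∑ i : Fin n, U (MultiIndex.second i.succ))) (z • U (MultiIndex.second 0)),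
    Lp.coeFn_neg (∑ i : Fin n, U (MultiIndex.second i.succ)),
    Lp.coeFn_smul z (U (MultiIndex.second 0)), Lp.coeFn_smul μ (U (MultiIndex.none (n + 1))),
    Lp.coeFn_finsetSum Finset.univ fun i : Fin n => U (MultiIndex.second i.succ)]
    with p h1 h2 h3 h4 h5 h6
  rw [h1, Pi.sub_apply, h2, Pi.sub_apply, h3, Pi.neg_apply, h4, h5, h6]
  simp

theorem modelCLM_test {ν : Measure (ℝ × EuclideanSpace ℝ (Fin n))} (z μ : ℂ)
    {U : Jet (n + 1) ν} {F : ℝ × EuclideanSpace ℝ (Fin n) → ℂ}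
    (hU : ∀ a, U a =ᵐ[ν] partialDeriv (xyDir n) a F) :
    modelCLM ν z μ U =ᵐ[ν] cylinderModel z μ F := by
  have h : ∀ᵐ p ∂ν, ∀ a, U a p = partialDeriv (xyDir n) a F p := ae_all_iff.2 hU
  filter_upwards [modelCLM_ae z μ U, h] with p h1 h2
  rw [h1]
  simp only [h2, partialDeriv_second, partialDeriv_none, xyDir_zero, xyDir_succ, cylinderModel,
    cylinderCross]
  ring

/-- The a priori estimate of the model problem. -/
theorem ModeData.exists_norm_le [IsFiniteMeasure (volume.restrict Ω)]
    (D : ModeData Ω T lam β) (hβ : 0 ≤ β) (hlam : 1 + lam ≠ 0)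
    (hT : IsDirichletResolvent Ω μ₀ T) (hΩ : IsOpen Ω) :
    ∃ C : NNReal, ∀ (R : ℝ), ∀ U ∈ H20Weighted β R Ω,
      ‖U‖ ≤ C * ‖modelCLM (weightedMeasure β R Ω) ((1 + lam) ^ 2)⁻¹ μ₀ U‖ := by
  obtain ⟨C, hC⟩ := D.exists_test_estimate hβ hlam hT hΩ
  set N : ℕ := Fintype.card (MultiIndex (n + 1))
  -- Each of the N components of the jet has squared norm at most C‖f‖².
  refine ⟨NNReal.sqrt (N * C.toNNReal), fun R U hU => ?_⟩
  refine H20_induction (P := fun U => ‖U‖ ≤ NNReal.sqrt (N * C.toNNReal)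
    * ‖modelCLM (weightedMeasure β R Ω) ((1 + lam) ^ 2)⁻¹ μ₀ U‖) ?_ ?_ hU
  · exact isClosed_le (by fun_prop) (by fun_prop)
  intro U F hF hUF
  set f := modelCLM (weightedMeasure β R Ω) ((1 + lam) ^ 2)⁻¹ μ₀ U with hf
  have hfF := modelCLM_test (((1 + lam) ^ 2)⁻¹) (μ₀ : ℂ) hUF
  have h1 : ∀ a, ‖U a‖ ^ 2 ≤ C.toNNReal * ‖f‖ ^ 2 := by
    intro a
    have h2 := hC R F hF a
    rw [← enorm_sq_eq_lintegral (hUF a), ← enorm_sq_eq_lintegral hfF] at h2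
    rw [← ofReal_norm, ← ofReal_norm, ← ENNReal.ofReal_pow (norm_nonneg _),
      ← ENNReal.ofReal_pow (norm_nonneg _), ← ENNReal.ofReal_mul' (by positivity)] at h2
    rw [Real.coe_toNNReal']
    by_cases h0 : 0 ≤ C * ‖f‖ ^ 2
    · refine ((ENNReal.ofReal_le_ofReal_iff h0).1 h2).trans ?_
      gcongr
      exact le_max_left _ _
    · rw [ENNReal.ofReal_of_nonpos (not_le.1 h0).le] at h2
      have h3 : ‖U a‖ ^ 2 ≤ 0 := by simpa using h2
      exact h3.trans (by positivity)
  have h2 : ‖U‖ ^ 2 ≤ (N * C.toNNReal) * ‖f‖ ^ 2 := by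
    rw [PiLp.norm_sq_eq_of_L2]
    refine (Finset.sum_le_sum fun a _ => h1 a).trans_eq ?_
    simp [N, mul_assoc]
  refine (sq_le_sq₀ (norm_nonneg _) (by positivity)).1 ?_
  rw [mul_pow]
  refine h2.trans_eq ?_
  congr 1
  have : (NNReal.sqrt (N * C.toNNReal)) ^ 2 = N * C.toNNReal := NNReal.sq_sqrt _
  exact_mod_cast this.symm

end ModelOperator

/-! ### Tensor products and mode coefficients in the weighted space -/

section Tensor

variable {n : ℕ} {Ω : Set (EuclideanSpace ℝ (Fin n))} {β R : ℝ}

theorem restrict_semiCylinder (R : ℝ) (Ω : Set (EuclideanSpace ℝ (Fin n))) :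
    (volume : Measure (ℝ × EuclideanSpace ℝ (Fin n))).restrict (semiCylinder R Ω)
      = (volume.restrict (Set.Iio R)).prod (volume.restrict Ω) := by
  rw [Measure.prod_restrict]; rfl

theorem weightedMeasure_absolutelyContinuous (β R : ℝ) (Ω : Set (EuclideanSpace ℝ (Fin n))) :
    weightedMeasure β R Ω ≪ (volume.restrict (Set.Iio R)).prod (volume.restrict Ω) := by
  rw [← restrict_semiCylinder]
  exact withDensity_absolutelyContinuous _ _

theorem absolutelyContinuous_weightedMeasure (β R : ℝ) (Ω : Set (EuclideanSpace ℝ (Fin n))) :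
    (volume.restrict (Set.Iio R)).prod (volume.restrict Ω) ≪ weightedMeasure β R Ω := by
  rw [← restrict_semiCylinder]
  refine withDensity_absolutelyContinuous' (Measurable.aemeasurable (by fun_prop)) ?_
  exact Filter.Eventually.of_forall fun p => (ENNReal.ofReal_pos.2 (Real.exp_pos _)).ne'

theorem modeEnergy_lt_top (β R : ℝ) {ψ : ℝ → ℂ} (hψ : Continuous ψ) (hs : HasCompactSupport ψ) :
    modeEnergy β R ψ < ⊤ := by
  rw [modeEnergy_eq_ofReal β R hψ hs]
  exact ENNReal.ofReal_lt_top

theorem lintegral_tensor {ψ : ℝ → ℂ} (hψ : Continuous ψ) (h : Lp ℂ 2 (volume.restrict Ω)) :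
    ∫⁻ p, ‖ψ p.1 * h p.2‖ₑ ^ 2 ∂(weightedMeasure β R Ω) = modeEnergy β R ψ * ‖h‖ₑ ^ 2 := by
  have hm : AEStronglyMeasurable (fun p : ℝ × EuclideanSpace ℝ (Fin n) => ψ p.1 * h p.2)
      (volume.restrict (semiCylinder R Ω)) := by
    rw [restrict_semiCylinder]
    exact (by fun_prop : Continuous fun p : ℝ × EuclideanSpace ℝ (Fin n) =>
      ψ p.1).aestronglyMeasurable.mul (Lp.aestronglyMeasurable h).comp_snd
  rw [lintegral_weightedMeasure β R Ω (by fun_prop), modeEnergy,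
    ← lintegral_mul_const' _ _ (by finiteness)]
  refine lintegral_congr fun x => ?_
  simp only [enorm_mul, mul_pow]
  rw [lintegral_const_mul' _ _ (by finiteness),
    ← enorm_sq_eq_lintegral (Filter.EventuallyEq.refl _ h)]
  ring

theorem memLp_tensor {ψ : ℝ → ℂ} (hψ : Continuous ψ) (hs : HasCompactSupport ψ)
    (h : Lp ℂ 2 (volume.restrict Ω)) :
    MemLp (fun p : ℝ × EuclideanSpace ℝ (Fin n) => ψ p.1 * h p.2) 2 (weightedMeasure β R Ω) := by
  refine ⟨?_, ?_⟩
  · refine AEStronglyMeasurable.mono_ac (weightedMeasure_absolutelyContinuous β R Ω) ?_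
    exact (by fun_prop : Continuous fun p : ℝ × EuclideanSpace ℝ (Fin n) =>
      ψ p.1).aestronglyMeasurable.mul (Lp.aestronglyMeasurable h).comp_snd
  · rw [eLpNorm_lt_top_iff_lintegral_rpow_enorm_lt_top (by norm_num) (by norm_num)]
    simp only [ENNReal.toReal_ofNat, ENNReal.rpow_ofNat]
    rw [lintegral_tensor hψ]
    exact ENNReal.mul_lt_top (modeEnergy_lt_top β R hψ hs) (by finiteness)

theorem ae_weightedMeasure_snd {P : EuclideanSpace ℝ (Fin n) → Prop}
    (h : ∀ᵐ y ∂(volume.restrict Ω), P y) : ∀ᵐ p ∂(weightedMeasure β R Ω), P p.2 :=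
  (weightedMeasure_absolutelyContinuous β R Ω).ae_le
    (Measure.quasiMeasurePreserving_snd.ae h)

/-- The linear map `h ↦ ψ ⊗ h`. -/
noncomputable def tensorLM (β R : ℝ) (Ω : Set (EuclideanSpace ℝ (Fin n))) {ψ : ℝ → ℂ}
    (hψ : Continuous ψ) (hs : HasCompactSupport ψ) :
    Lp ℂ 2 (volume.restrict Ω) →ₗ[ℂ] L2Weighted β R Ω where
  toFun h := (memLp_tensor hψ hs h).toLp _
  map_add' h h' := by
    rw [← MemLp.toLp_add]
    refine MemLp.toLp_congr _ _ ?_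
    filter_upwards [ae_weightedMeasure_snd (Lp.coeFn_add h h')] with p hp
    simp only [Pi.add_apply] at hp ⊢
    rw [hp]
    ring
  map_smul' c h := by
    rw [RingHom.id_apply, ← MemLp.toLp_const_smul]
    refine MemLp.toLp_congr _ _ ?_
    filter_upwards [ae_weightedMeasure_snd (Lp.coeFn_smul c h)] with p hp
    simp only [Pi.smul_apply, smul_eq_mul] at hp ⊢
    rw [hp]
    ring

theorem tensorLM_ae {ψ : ℝ → ℂ} (hψ : Continuous ψ) (hs : HasCompactSupport ψ)
    (h : Lp ℂ 2 (volume.restrict Ω)) :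
    tensorLM β R Ω hψ hs h =ᵐ[weightedMeasure β R Ω] fun p => ψ p.1 * h p.2 :=
  (memLp_tensor hψ hs h).coeFn_toLp

theorem norm_tensorLM_le {ψ : ℝ → ℂ} (hψ : Continuous ψ) (hs : HasCompactSupport ψ)
    (h : Lp ℂ 2 (volume.restrict Ω)) :
    ‖tensorLM β R Ω hψ hs h‖ ≤ Real.sqrt (modeEnergy β R ψ).toReal * ‖h‖ := by
  refine (sq_le_sq₀ (norm_nonneg _) (by positivity)).1 ?_
  have h1 := enorm_sq_eq_lintegral (tensorLM_ae (β := β) (R := R) hψ hs h)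
  rw [lintegral_tensor hψ] at h1
  have h2 := congrArg ENNReal.toReal h1
  rw [ENNReal.toReal_mul, ENNReal.toReal_pow, ENNReal.toReal_pow, toReal_enorm,
    toReal_enorm] at h2
  rw [mul_pow, Real.sq_sqrt ENNReal.toReal_nonneg]
  exact h2.le

/-- The continuous linear map `h ↦ ψ ⊗ h`. -/
noncomputable def tensorCLM (β R : ℝ) (Ω : Set (EuclideanSpace ℝ (Fin n))) {ψ : ℝ → ℂ}
    (hψ : Continuous ψ) (hs : HasCompactSupport ψ) :
    Lp ℂ 2 (volume.restrict Ω) →L[ℂ] L2Weighted β R Ω :=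
  (tensorLM β R Ω hψ hs).mkContinuous _ (norm_tensorLM_le hψ hs)

theorem tensorCLM_ae {ψ : ℝ → ℂ} (hψ : Continuous ψ) (hs : HasCompactSupport ψ)
    (h : Lp ℂ 2 (volume.restrict Ω)) :
    tensorCLM β R Ω hψ hs h =ᵐ[weightedMeasure β R Ω] fun p => ψ p.1 * h p.2 :=
  tensorLM_ae hψ hs h

theorem lintegral_enorm_lt_top (v : L2Weighted β R Ω) :
    ∫⁻ p, ‖v p‖ₑ ^ 2 ∂(weightedMeasure β R Ω) < ⊤ := by
  rw [← enorm_sq_eq_lintegral (Filter.EventuallyEq.refl _ v)]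
  finiteness

theorem aestronglyMeasurable_prod (v : L2Weighted β R Ω) :
    AEStronglyMeasurable v ((volume.restrict (Set.Iio R)).prod (volume.restrict Ω)) :=
  (Lp.aestronglyMeasurable v).mono_ac (absolutelyContinuous_weightedMeasure β R Ω)

/-- By Tonelli the weighted integral of the squared norms of the sections is finite. The weight is
positive, so almost every section has finite norm. -/
theorem ae_memLp_section (v : L2Weighted β R Ω) :
    ∀ᵐ x ∂(volume.restrict (Set.Iio R)), MemLp (fun y => v (x, y)) 2 (volume.restrict Ω) := by
  have hm := aestronglyMeasurable_prod v
  have h1 := lintegral_enorm_lt_top v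
  have hm2 : AEMeasurable (fun p => ‖v p‖ₑ ^ 2)
      ((volume.restrict (Set.Iio R)).prod (volume.restrict Ω)) := by fun_prop
  have hm3 : AEMeasurable (fun x => ∫⁻ y in Ω, ‖v (x, y)‖ₑ ^ 2) (volume.restrict (Set.Iio R)) :=
    hm2.lintegral_prod_right'
  rw [lintegral_weightedMeasure β R Ω (by rw [restrict_semiCylinder]; exact hm2)] at h1
  have h2 := ae_lt_top' (by fun_prop) h1.ne
  filter_upwards [h2, hm.prodMk_left] with x hx hmx
  refine ⟨hmx, ?_⟩
  rw [eLpNorm_lt_top_iff_lintegral_rpow_enorm_lt_top (by norm_num) (by norm_num)]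
  simp only [ENNReal.toReal_ofNat, ENNReal.rpow_ofNat]
  by_contra h3
  rw [not_lt, top_le_iff] at h3
  rw [h3, ENNReal.mul_top (ENNReal.ofReal_pos.2 (Real.exp_pos _)).ne'] at hx
  exact lt_irrefl _ hx

theorem ae_modeCoeff_eq_integral (h : Lp ℂ 2 (volume.restrict Ω)) (v : L2Weighted β R Ω) :
    ∀ᵐ x ∂(volume.restrict (Set.Iio R)),
      modeCoeff h v x = ∫ y in Ω, starRingEnd ℂ (h y) * v (x, y) := by
  filter_upwards [ae_memLp_section v] with x hx
  exact L2_inner_eq_integral_of_ae (Filter.EventuallyEq.refl _ _) (slice_ae_of_memLp hx)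

theorem aestronglyMeasurable_modeCoeff (h : Lp ℂ 2 (volume.restrict Ω)) (v : L2Weighted β R Ω) :
    AEStronglyMeasurable (modeCoeff h v) (volume.restrict (Set.Iio R)) := by
  have hst : AEStronglyMeasurable (fun y => starRingEnd ℂ (h y)) (volume.restrict Ω) :=
    (Lp.memLp h).starRingEnd.aestronglyMeasurable
  have h1 : AEStronglyMeasurable (fun p : ℝ × EuclideanSpace ℝ (Fin n) =>
      starRingEnd ℂ (h p.2) * v p) ((volume.restrict (Set.Iio R)).prod (volume.restrict Ω)) :=
    hst.comp_snd.mul (aestronglyMeasurable_prod v)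
  exact h1.integral_prod_right'.congr
    (Filter.EventuallyEq.symm (ae_modeCoeff_eq_integral h v))

/-- Cauchy–Schwarz on each section, then Tonelli. -/
theorem modeEnergy_modeCoeff_lt_top (h : Lp ℂ 2 (volume.restrict Ω)) (v : L2Weighted β R Ω) :
    modeEnergy β R (modeCoeff h v) < ⊤ := by
  have hm := aestronglyMeasurable_prod v
  have h1 := lintegral_enorm_lt_top v
  rw [lintegral_weightedMeasure β R Ω (by rw [restrict_semiCylinder]; fun_prop)] at h1
  have h2 : modeEnergy β R (modeCoeff h v) ≤ ∫⁻ x in Set.Iio R, ‖h‖ₑ ^ 2 *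
      (ENNReal.ofReal (Real.exp (-2 * β * x)) * ∫⁻ y in Ω, ‖v (x, y)‖ₑ ^ 2) := by
    refine lintegral_mono_ae ?_
    filter_upwards [ae_memLp_section v] with x hx
    rw [← enorm_sq_eq_lintegral (slice_ae_of_memLp hx), mul_left_comm, ← mul_pow]
    gcongr
    rw [modeCoeff, ← ofReal_norm, ← ofReal_norm, ← ofReal_norm,
      ← ENNReal.ofReal_mul (norm_nonneg _)]
    exact ENNReal.ofReal_le_ofReal (norm_inner_le_norm _ _)
  refine h2.trans_lt ?_
  rw [lintegral_const_mul' _ _ (by finiteness)]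
  exact ENNReal.mul_lt_top (by finiteness) h1

theorem integral_weightedMeasure {g : ℝ × EuclideanSpace ℝ (Fin n) → ℂ}
    (hg : Integrable g (weightedMeasure β R Ω)) :
    ∫ p, g p ∂(weightedMeasure β R Ω)
      = ∫ x in Set.Iio R, ∫ y in Ω, (Real.exp (-2 * β * x) : ℂ) * g (x, y) := by
  have hw : Measurable fun p : ℝ × EuclideanSpace ℝ (Fin n) =>
      ENNReal.ofReal (Real.exp (-2 * β * p.1)) := by fun_prop
  rw [weightedMeasure] at hg ⊢
  rw [integrable_withDensity_iff_integrable_smul' hw (by simp)] at hg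
  rw [integral_withDensity_eq_integral_toReal_smul hw (by simp)]
  rw [restrict_semiCylinder] at hg ⊢
  rw [integral_prod _ hg]
  simp only [ENNReal.toReal_ofReal (Real.exp_pos _).le, Complex.real_smul]

/-- Reduces orthogonality in the weighted space to one variable. The weight goes with the
coefficient, so the function to annihilate is e^{-2βx} times the conjugate coefficient. -/
theorem inner_tensorCLM {ψ : ℝ → ℂ} (hψ : Continuous ψ) (hs : HasCompactSupport ψ)
    (h : Lp ℂ 2 (volume.restrict Ω)) (v : L2Weighted β R Ω) :
    inner ℂ (tensorCLM β R Ω hψ hs h) v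
      = ∫ x in Set.Iio R, (Real.exp (-2 * β * x) : ℂ) * starRingEnd ℂ (ψ x) * modeCoeff h v x := by
  rw [L2_inner_eq_integral_of_ae (tensorCLM_ae hψ hs h) (Filter.EventuallyEq.refl _ v)]
  have hint : Integrable (fun p : ℝ × EuclideanSpace ℝ (Fin n) =>
      starRingEnd ℂ (ψ p.1 * h p.2) * v p) (weightedMeasure β R Ω) :=
    (memLp_tensor hψ hs h).starRingEnd.integrable_mul (Lp.memLp v)
  rw [integral_weightedMeasure hint]
  refine integral_congr_ae ?_
  filter_upwards [ae_modeCoeff_eq_integral h v] with x hx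
  rw [hx, ← integral_const_mul]
  refine integral_congr_ae (Filter.Eventually.of_forall fun y => ?_)
  simp only [map_mul]
  ring

end Tensor

/-! ### Density of the range of the model operator -/

section Density

variable {n : ℕ} {Ω : Set (EuclideanSpace ℝ (Fin n))} {μ₀ : ℝ} {lam : ℂ} {β R : ℝ}
  {T : Lp ℂ 2 (volume.restrict Ω) →L[ℂ] Lp ℂ 2 (volume.restrict Ω)}

theorem ContDiff.tensor {ψ : ℝ → ℂ} {χ : EuclideanSpace ℝ (Fin n) → ℂ} (hψ : ContDiff ℝ ∞ ψ)
    (hχ : ContDiff ℝ ∞ χ) :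
    ContDiff ℝ ∞ fun p : ℝ × EuclideanSpace ℝ (Fin n) => ψ p.1 * χ p.2 :=
  (hψ.comp contDiff_fst).mul (hχ.comp contDiff_snd)

theorem IsDirichletTest.tensor {ψ : ℝ → ℂ} {χ : EuclideanSpace ℝ (Fin n) → ℂ}
    (hψ : ContDiff ℝ ∞ ψ) (hs : HasCompactSupport ψ) (hR : ψ R = 0) (hχ : IsDirichletTest Ω χ) :
    IsDirichletTest (semiCylinder R Ω)
      fun p : ℝ × EuclideanSpace ℝ (Fin n) => ψ p.1 * χ p.2 := by
  refine ⟨hψ.tensor hχ.1, ?_, ?_⟩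
  · refine HasCompactSupport.intro (hs.isCompact.prod hχ.2.1.isCompact) fun p hp => ?_
    by_cases h1 : p.1 ∈ tsupport ψ
    · rw [image_eq_zero_of_notMem_tsupport (f := χ) fun h2 => hp ⟨h1, h2⟩, mul_zero]
    · rw [image_eq_zero_of_notMem_tsupport h1, zero_mul]
  · intro p hp
    rw [semiCylinder, frontier_prod_eq] at hp
    rcases hp with ⟨-, h⟩ | ⟨h, -⟩
    · beta_reduce
      rw [hχ.2.2 _ h, mul_zero]
    · rw [frontier_Iio, Set.mem_singleton_iff] at h
      beta_reduce
      rw [h, hR, zero_mul]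

theorem dirDeriv_tensor_snd {ψ : ℝ → ℂ} {χ : EuclideanSpace ℝ (Fin n) → ℂ}
    (hψ : ContDiff ℝ ∞ ψ) (hχ : ContDiff ℝ ∞ χ) (v : EuclideanSpace ℝ (Fin n)) :
    dirDeriv (0, v) (fun p : ℝ × EuclideanSpace ℝ (Fin n) => ψ p.1 * χ p.2)
      = fun p => ψ p.1 * dirDeriv v χ p.2 := by
  ext p
  have h := congrFun (dirDeriv_section (hψ.tensor hχ) v p.1) p.2
  have e : (fun y => ψ p.1 * χ y) = ψ p.1 • χ := rfl
  simp only at h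
  rw [e, dirDeriv_smul] at h
  exact h

theorem dirDeriv_tensor_fst {ψ : ℝ → ℂ} {χ : EuclideanSpace ℝ (Fin n) → ℂ}
    (hψ : ContDiff ℝ ∞ ψ) (hχ : ContDiff ℝ ∞ χ) :
    dirDeriv (1, 0) (fun p : ℝ × EuclideanSpace ℝ (Fin n) => ψ p.1 * χ p.2)
      = fun p => deriv ψ p.1 * χ p.2 := by
  ext p
  have h := hasDerivAt_slice (hψ.tensor hχ) p.1 p.2
  exact h.unique ((hψ.differentiable (by simp) p.1).hasDerivAt.mul_const (χ p.2))

theorem crossLaplacianSub_test (μ : ℂ) {U : Jet n (volume.restrict Ω)}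
    {χ : EuclideanSpace ℝ (Fin n) → ℂ}
    (hU : ∀ a, U a =ᵐ[volume.restrict Ω] partialDeriv (yDir n) a χ) :
    crossLaplacianSub μ U =ᵐ[volume.restrict Ω]
      fun y => -(∑ i, dirDeriv (yDir n i) (dirDeriv (yDir n i) χ) y) - μ * χ y := by
  have h : ∀ᵐ y ∂(volume.restrict Ω), ∀ a, U a y = partialDeriv (yDir n) a χ y := ae_all_iff.2 hU
  rw [crossLaplacianSub]
  filter_upwards [h, Lp.coeFn_sub (-∑ i, U (MultiIndex.second i))
    (μ • U (MultiIndex.none n)), Lp.coeFn_neg (∑ i, U (MultiIndex.second i)),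
    Lp.coeFn_smul μ (U (MultiIndex.none n)),
    Lp.coeFn_finsetSum Finset.univ fun i => U (MultiIndex.second i)] with y g1 g3 g4 g5 g6
  rw [g3, Pi.sub_apply, g4, Pi.neg_apply, g5, Pi.smul_apply, g6, Finset.sum_apply]
  simp only [g1, partialDeriv_second, partialDeriv_none, smul_eq_mul]

theorem contDiff_deriv {ψ : ℝ → ℂ} (hψ : ContDiff ℝ ∞ ψ) : ContDiff ℝ ∞ (deriv ψ) :=
  ((contDiff_infty_iff_deriv (𝕜 := ℝ)).1 hψ).2

/-- The model operator on tensor products, tested against an element of `L²_β` orthogonal to its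
range. -/
theorem inner_tensor_eq_of_orthogonal {z μ : ℂ} {v : L2Weighted β R Ω}
    (hv : ∀ U ∈ H20Weighted β R Ω, inner ℂ (modelCLM (weightedMeasure β R Ω) z μ U) v = 0)
    {ψ : ℝ → ℂ} (hψ : ContDiff ℝ ∞ ψ) (hs : HasCompactSupport ψ) (hR : ψ R = 0)
    {U : Jet n (volume.restrict Ω)} (hU : U ∈ H20CrossSection Ω) :
    inner ℂ (tensorCLM β R Ω hψ.continuous hs (crossLaplacianSub μ U)
      - z • tensorCLM β R Ω (contDiff_deriv (contDiff_deriv hψ)).continuous hs.deriv.deriv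
        (U (MultiIndex.none n))) v = 0 := by
  have hψ1 := contDiff_deriv hψ
  have hψ2 := contDiff_deriv hψ1
  -- Eigenfunctions are only known to lie in H²₀(Ω), so the identity is checked on test functions χ,
  -- where ψ ⊗ χ is admissible, and extended by continuity.
  refine H20_induction (P := fun U => inner ℂ (tensorCLM β R Ω hψ.continuous hs
    (crossLaplacianSub μ U) - z • tensorCLM β R Ω hψ2.continuous hs.deriv.deriv
        (U (MultiIndex.none n))) v = 0) ?_ ?_ hU
  · simp only [← crossLaplacianSubCLM_apply]
    exact isClosed_eq (by fun_prop) (by fun_prop)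
  intro U χ hχ hUχ
  obtain ⟨W, hW, hWa⟩ := exists_testJet (xyDir n) (weightedMeasure β R Ω)
    (IsDirichletTest.tensor (R := R) hψ hs hR hχ)
  rw [← hv W hW]
  congr 1
  have h1 := hUχ (MultiIndex.none n)
  rw [partialDeriv_none] at h1
  refine Lp.ext ?_
  filter_upwards [modelCLM_test z μ hWa, ae_weightedMeasure_snd h1,
    ae_weightedMeasure_snd (crossLaplacianSub_test μ hUχ),
    tensorCLM_ae (β := β) (R := R) hψ.continuous hs (crossLaplacianSub μ U),
    tensorCLM_ae (β := β) (R := R) hψ2.continuous hs.deriv.deriv (U (MultiIndex.none n)),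
    Lp.coeFn_sub (tensorCLM β R Ω hψ.continuous hs (crossLaplacianSub μ U))
      (z • tensorCLM β R Ω hψ2.continuous hs.deriv.deriv (U (MultiIndex.none n))),
    Lp.coeFn_smul z (tensorCLM β R Ω hψ2.continuous hs.deriv.deriv (U (MultiIndex.none n)))]
    with p g1 g2 g3 g4 g5 g6 g7
  rw [g1, g6, Pi.sub_apply, g7, Pi.smul_apply, g4, g5, g2, g3]
  simp only [cylinderModel, cylinderCross, dirDeriv_tensor_fst hψ hχ.1,
    dirDeriv_tensor_fst hψ1 hχ.1, dirDeriv_tensor_snd hψ hχ.1,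
    dirDeriv_tensor_snd hψ (hχ.1.dirDeriv _), smul_eq_mul, ← Finset.mul_sum]
  ring

theorem ModeData.eq_zero_of_orthogonal [IsFiniteMeasure (volume.restrict Ω)]
    (D : ModeData Ω T lam β) (hlam : 1 + lam ≠ 0)
    (hT : IsDirichletResolvent Ω μ₀ T) {v : L2Weighted β R Ω}
    (hv : ∀ U ∈ H20Weighted β R Ω,
      inner ℂ (modelCLM (weightedMeasure β R Ω) ((1 + lam) ^ 2)⁻¹ μ₀ U) v = 0) : v = 0 := by
  have hcount := D.countable
  have hzero : ∀ k, ∀ᵐ x ∂(volume.restrict (Set.Iio R)), modeCoeff (D.b k) v x = 0 := by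
    intro k
    set c := modeCoeff (D.b k) v with hc
    have hβκ : β < (D.κ k).re := by
      have h1 := D.le_re k
      have h2 := D.re_pos k
      have h3 := D.q_lt_one
      nlinarith
    -- With m = e^{-2βx} c̄, the product e^{βx} m = e^{-βx} c̄ is square integrable because `v` lies
    -- in L²_β.
    have hm : MemLp (fun x => (Real.exp (β * x) : ℂ)
        * ((Real.exp (-2 * β * x) : ℂ) * starRingEnd ℂ (c x))) 2
        (volume.restrict (Set.Iio R)) := by
      have hcm := aestronglyMeasurable_modeCoeff (D.b k) v
      have hcm' : AEStronglyMeasurable (fun x => starRingEnd ℂ (c x))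
          (volume.restrict (Set.Iio R)) :=
        Complex.continuous_conj.comp_aestronglyMeasurable hcm
      refine ⟨?_, ?_⟩
      · refine AEStronglyMeasurable.mul ?_ (AEStronglyMeasurable.mul ?_ hcm')
        · exact (by fun_prop : Continuous fun x : ℝ =>
            (Real.exp (β * x) : ℂ)).aestronglyMeasurable
        · exact (by fun_prop : Continuous fun x : ℝ =>
            (Real.exp (-2 * β * x) : ℂ)).aestronglyMeasurable
      · rw [eLpNorm_lt_top_iff_lintegral_rpow_enorm_lt_top (by norm_num) (by norm_num)]
        simp only [ENNReal.toReal_ofNat, ENNReal.rpow_ofNat]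
        refine lt_of_eq_of_lt (lintegral_congr fun x => ?_)
          (modeEnergy_modeCoeff_lt_top (D.b k) v)
        rw [← ofReal_norm, ← ofReal_norm, ← ENNReal.ofReal_pow (norm_nonneg _),
          ← ENNReal.ofReal_pow (norm_nonneg _), ← ENNReal.ofReal_mul (Real.exp_pos _).le]
        congr 1
        rw [norm_mul, norm_mul, RCLike.norm_conj, Complex.norm_real, Complex.norm_real,
          Real.norm_eq_abs, Real.norm_eq_abs, Real.abs_exp, Real.abs_exp, ← mul_assoc,
          ← Real.exp_add, mul_pow, ← Real.exp_nat_mul]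
        congr 2
        push_cast
        ring
    have key := ae_eq_zero_of_mode_orthogonal hβκ hm ?_
    · filter_upwards [key] with x hx
      have h1 : (Real.exp (-2 * β * x) : ℂ) ≠ 0 := by exact_mod_cast (Real.exp_pos _).ne'
      simpa [h1] using hx
    intro ψ hψ hs hR
    have hψ1 := contDiff_deriv hψ
    have hψ2 := contDiff_deriv hψ1
    -- U represents the eigenfunction divided by its eigenvalue a, with (Δ_Ω - μ₀)U equal to the
    -- eigenfunction.
    obtain ⟨U, hU, hU0, hU1⟩ := hT.right_inv (D.b k)
    have h1 := inner_tensor_eq_of_orthogonal hv hψ hs hR hU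
    rw [hU1, hU0, D.apply_b] at h1
    have hcont : Continuous fun x => D.κ k ^ 2 * ψ x - deriv (deriv ψ) x := by
      have := hψ.continuous
      have := hψ2.continuous
      fun_prop
    have hsupp : HasCompactSupport fun x => D.κ k ^ 2 * ψ x - deriv (deriv ψ) x :=
      HasCompactSupport.sub hs.mul_left hs.deriv.deriv
    -- The coefficients agree because κ² (1+λ)⁻² a⁻¹ = 1.
    have e : tensorCLM β R Ω hcont hsupp (D.b k) = D.κ k ^ 2 • (tensorCLM β R Ω hψ.continuous hs
        (D.b k) - ((1 + lam) ^ 2)⁻¹ • tensorCLM β R Ω hψ2.continuous hs.deriv.deriv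
          (((D.a k : ℂ)⁻¹) • D.b k)) := by
      rw [map_smul]
      refine Lp.ext ?_
      set A := tensorCLM β R Ω hψ.continuous hs (D.b k)
      set B := tensorCLM β R Ω hψ2.continuous hs.deriv.deriv (D.b k)
      rw [smul_smul]
      filter_upwards [tensorCLM_ae (β := β) (R := R) hcont hsupp (D.b k),
        (tensorCLM_ae hψ.continuous hs (D.b k) : A =ᵐ[weightedMeasure β R Ω] _),
        (tensorCLM_ae hψ2.continuous hs.deriv.deriv (D.b k) : B =ᵐ[weightedMeasure β R Ω] _),
        Lp.coeFn_smul (D.κ k ^ 2) (A - (((1 + lam) ^ 2)⁻¹ * (D.a k : ℂ)⁻¹) • B),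
        Lp.coeFn_sub A ((((1 + lam) ^ 2)⁻¹ * (D.a k : ℂ)⁻¹) • B),
        Lp.coeFn_smul (((1 + lam) ^ 2)⁻¹ * (D.a k : ℂ)⁻¹) B] with p g1 g2 g3 g4 g5 g6
      rw [g1, g4, Pi.smul_apply, g5, Pi.sub_apply, g6, Pi.smul_apply, g2, g3, D.κ_sq]
      have ha : (D.a k : ℂ) ≠ 0 := by exact_mod_cast D.a_ne_zero k
      simp only [smul_eq_mul]
      field_simp
    have h2 : inner ℂ (tensorCLM β R Ω hcont hsupp (D.b k)) v = 0 := by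
      rw [e, inner_smul_left, h1, mul_zero]
    rw [inner_tensorCLM] at h2
    have h3 := congrArg (starRingEnd ℂ) h2
    rw [map_zero, ← integral_conj] at h3
    rw [← h3]
    refine integral_congr_ae (Filter.Eventually.of_forall fun x => ?_)
    simp only [map_mul, Complex.conj_conj, Complex.conj_ofReal, hc]
    ring
  -- Countability of the modes permits one null set for all coefficients.
  have hall : ∀ᵐ x ∂(volume.restrict (Set.Iio R)), slice Ω v x = 0 := by
    filter_upwards [ae_all_iff.2 hzero] with x hx
    have h1 := D.b.enorm_sq_eq_tsum (slice Ω v x)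
    have h2 : ∀ k, inner ℂ (D.b k) (slice Ω v x) = 0 := hx
    simp only [h2] at h1
    simpa using h1
  have h1 := enorm_sq_eq_lintegral (Filter.EventuallyEq.refl _ v)
  have hm := aestronglyMeasurable_prod v
  rw [lintegral_weightedMeasure β R Ω (by rw [restrict_semiCylinder]; fun_prop)] at h1
  have h2 : ∫⁻ x in Set.Iio R, ENNReal.ofReal (Real.exp (-2 * β * x))
      * ∫⁻ y in Ω, ‖v (x, y)‖ₑ ^ 2 = ∫⁻ x in Set.Iio R, 0 := by
    refine lintegral_congr_ae ?_
    filter_upwards [hall, ae_memLp_section v] with x hx hxm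
    rw [← enorm_sq_eq_lintegral (slice_ae_of_memLp hxm), hx]
    simp
  rw [h2, lintegral_zero] at h1
  simpa using h1

end Density

/-! ### Inclusions between spaces with comparable weights -/

section ChangeOfMeasure

variable {X : Type*} [MeasurableSpace X] {μ ν : Measure X} {c : ENNReal}

/-- The linear inclusion `L²(ν) → L²(μ)` for `μ ≤ c • ν`. -/
noncomputable def changeMeasureLM (hc : c ≠ ⊤) (h : μ ≤ c • ν) : Lp ℂ 2 ν →ₗ[ℂ] Lp ℂ 2 μ where
  toFun f := ((Lp.memLp f).of_measure_le_smul hc h).toLp f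
  map_add' f g := by
    rw [← MemLp.toLp_add]
    exact MemLp.toLp_congr _ _
      ((Measure.absolutelyContinuous_of_le_smul h).ae_le (Lp.coeFn_add f g))
  map_smul' z f := by
    rw [RingHom.id_apply, ← MemLp.toLp_const_smul]
    exact MemLp.toLp_congr _ _
      ((Measure.absolutelyContinuous_of_le_smul h).ae_le (Lp.coeFn_smul z f))

theorem changeMeasureLM_ae (hc : c ≠ ⊤) (h : μ ≤ c • ν) (f : Lp ℂ 2 ν) :
    changeMeasureLM hc h f =ᵐ[μ] f :=
  ((Lp.memLp f).of_measure_le_smul hc h).coeFn_toLp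

theorem norm_changeMeasureLM_le (hc : c ≠ ⊤) (h : μ ≤ c • ν) (f : Lp ℂ 2 ν) :
    ‖changeMeasureLM hc h f‖ ≤ Real.sqrt c.toReal * ‖f‖ := by
  refine (sq_le_sq₀ (norm_nonneg _) (by positivity)).1 ?_
  have h1 : ‖changeMeasureLM hc h f‖ₑ ^ 2 ≤ c * ‖f‖ₑ ^ 2 := by
    rw [enorm_sq_eq_lintegral (changeMeasureLM_ae hc h f),
      enorm_sq_eq_lintegral (Filter.EventuallyEq.refl _ f)]
    refine (lintegral_mono' h le_rfl).trans_eq ?_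
    rw [lintegral_smul_measure, smul_eq_mul]
  have h2 := ENNReal.toReal_mono (by finiteness) h1
  rw [ENNReal.toReal_mul, ENNReal.toReal_pow, ENNReal.toReal_pow, toReal_enorm,
    toReal_enorm] at h2
  rwa [mul_pow, Real.sq_sqrt ENNReal.toReal_nonneg]

theorem H20_exists_ae_eq {V : Type*} [NormedAddCommGroup V] [NormedSpace ℝ V] [MeasurableSpace V]
    {d : ℕ} {e : Fin d → V} {μ ν : Measure V} {G : Set V} (hc : c ≠ ⊤) (h : μ ≤ c • ν)
    {W : Jet d ν} (hW : W ∈ H20 e ν G) : ∃ U ∈ H20 e μ G, ∀ a, U a =ᵐ[μ] W a := by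
  let j : Lp ℂ 2 ν →L[ℂ] Lp ℂ 2 μ :=
    (changeMeasureLM hc h).mkContinuous _ (norm_changeMeasureLM_le hc h)
  have hj : ∀ f, j f =ᵐ[μ] f := changeMeasureLM_ae hc h
  let J : Jet d ν → Jet d μ := fun U => WithLp.toLp 2 fun a => j (U a)
  have hJ : Continuous J := by
    refine (PiLp.continuous_toLp 2 _).comp (continuous_pi fun a => ?_)
    fun_prop
  refine ⟨J W, map_mem_closure hJ hW ?_, fun a => hj (W a)⟩
  rintro U ⟨φ, hφ, hU⟩
  exact ⟨φ, hφ, fun a => (hj (U a)).trans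
    ((Measure.absolutelyContinuous_of_le_smul h).ae_le (hU a))⟩

end ChangeOfMeasure

/-! ### Solvability of the model problem -/

section Model

variable {n : ℕ} {Ω : Set (EuclideanSpace ℝ (Fin n))} {μ₀ : ℝ} {lam : ℂ} {β R : ℝ}
  {T : Lp ℂ 2 (volume.restrict Ω) →L[ℂ] Lp ℂ 2 (volume.restrict Ω)}

theorem weightedMeasure_zero_le (hβ : 0 ≤ β) (hΩ : IsOpen Ω) :
    weightedMeasure 0 R Ω ≤ ENNReal.ofReal (Real.exp (2 * β * R)) • weightedMeasure β R Ω := by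
  have hG : MeasurableSet (semiCylinder R Ω) := measurableSet_Iio.prod hΩ.measurableSet
  rw [weightedMeasure_zero, weightedMeasure, ← withDensity_smul _ (by fun_prop)]
  conv_lhs => rw [← withDensity_one (μ := volume.restrict (semiCylinder R Ω))]
  refine withDensity_mono ?_
  filter_upwards [ae_restrict_mem hG] with p hp
  rw [Pi.one_apply, Pi.smul_apply, smul_eq_mul, ← ENNReal.ofReal_mul (Real.exp_pos _).le,
    ← Real.exp_add, ← ENNReal.ofReal_one]
  refine ENNReal.ofReal_le_ofReal (Real.one_le_exp ?_)
  have h : p.1 < R := hp.1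
  nlinarith

/-- Surjectivity of the model operator. -/
theorem ModeData.exists_solution [IsFiniteMeasure (volume.restrict Ω)]
    (D : ModeData Ω T lam β) (hlam : 1 + lam ≠ 0) (hT : IsDirichletResolvent Ω μ₀ T)
    {C : NNReal}
    (hC : ∀ U ∈ H20Weighted β R Ω,
      ‖U‖ ≤ C * ‖modelCLM (weightedMeasure β R Ω) ((1 + lam) ^ 2)⁻¹ μ₀ U‖)
    (f : L2Weighted β R Ω) : ∃ U ∈ H20Weighted β R Ω,
      modelCLM (weightedMeasure β R Ω) ((1 + lam) ^ 2)⁻¹ μ₀ U = f := by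
  let X := H20Submodule (xyDir n) (weightedMeasure β R Ω) (semiCylinder R Ω)
  let S : X →L[ℂ] L2Weighted β R Ω :=
    (modelCLM (weightedMeasure β R Ω) ((1 + lam) ^ 2)⁻¹ μ₀).comp X.subtypeL
  have : CompleteSpace X := (testJets _ _ _).isClosed_topologicalClosure.completeSpace_coe
  -- The a priori estimate bounds the operator below on a complete space, so its range is closed; a
  -- trivial orthogonal complement then makes it everything.
  have hS : AntilipschitzWith C S :=
    ContinuousLinearMap.antilipschitz_of_bound S fun U => hC U.1 U.2
  have hcl : IsClosed (S.range : Set (L2Weighted β R Ω)) :=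
    hS.isClosed_range S.uniformContinuous
  have hperp : S.rangeᗮ = ⊥ := by
    rw [Submodule.eq_bot_iff]
    intro v hv
    rw [Submodule.mem_orthogonal] at hv
    exact D.eq_zero_of_orthogonal hlam hT fun U hU => hv _ ⟨⟨U, hU⟩, rfl⟩
  have htop : S.range = ⊤ := by
    rw [← hcl.submodule_topologicalClosure_eq, Submodule.topologicalClosure_eq_top_iff, hperp]
  obtain ⟨U, hU⟩ : f ∈ S.range := htop ▸ Submodule.mem_top
  exact ⟨U.1, U.2, hU⟩

theorem solvesModel_iff {β₁ β₂ : ℝ} {U : Jet (n + 1) (weightedMeasure β₁ R Ω)}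
    {f : L2Weighted β₂ R Ω} :
    SolvesModel lam μ₀ U f ↔
      modelCLM (weightedMeasure β₁ R Ω) ((1 + lam) ^ 2)⁻¹ μ₀ U
        =ᵐ[volume.restrict (semiCylinder R Ω)] f := by
  have h := (ae_weightedMeasure_iff β₁ R Ω).1 (modelCLM_ae (((1 + lam) ^ 2)⁻¹) (μ₀ : ℂ) U)
  constructor
  · intro h1
    filter_upwards [h, h1] with p g1 g2
    rw [g1, g2]
  · intro h1
    filter_upwards [h, h1] with p g1 g2
    rw [← g1, g2]

end Model

/-! ### Unique solvability with a bound uniform in R -/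

theorem lemma8 (n : ℕ) (hn : 1 ≤ n) (Ω : Set (EuclideanSpace ℝ (Fin n)))
    (hΩo : IsOpen Ω) (hΩc : IsConnected Ω) (hΩb : Bornology.IsBounded Ω)
    (hΩs : HasSmoothBoundary Ω)
    (α : ℝ) (hα₀ : 0 < α) (hα : α < Real.pi / 4)
    (lam : ℂ) (hlam : lam ∈ scalingDisk α) (him : lam.im ≠ 0)
    (μ₀ : ℝ) (hμ₀ : (μ₀ : ℂ) ∉ dirichletSpectrum Ω)
    (β : ℝ) (hβ₀ : 0 ≤ β)
    (hβ : ∀ ν ∈ dirichletSpectrum Ω,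
      β < |((1 + lam) * ((μ₀ : ℂ) - ν) ^ (1 / 2 : ℂ)).im|) :
    ∃ C : ℝ, ∀ (R : ℝ) (f : L2Weighted β R Ω),
      ∃ U : Jet (n + 1) (weightedMeasure 0 R Ω),
        (U ∈ H20Weighted 0 R Ω ∧ SolvesModel lam μ₀ U f) ∧
        (∀ U' ∈ H20Weighted 0 R Ω, SolvesModel lam μ₀ U' f → U' = U) ∧
        ∃ W ∈ H20Weighted β R Ω,
          (∀ a, W a =ᵐ[volume.restrict (semiCylinder R Ω)] U a) ∧ ‖W‖ ≤ C * ‖f‖ := by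

  have hl : ‖lam‖ < 1 := lt_of_lt_of_le hlam (Real.sin_le_one α)
  have hl1 : 1 + lam ≠ 0 := by
    intro h
    rw [← neg_eq_iff_add_eq_zero] at h
    rw [← h, norm_neg, norm_one] at hl
    exact lt_irrefl _ hl
  have hfin : IsFiniteMeasure (volume.restrict Ω) :=
    isFiniteMeasure_restrict.2 hΩb.measure_lt_top.ne
  obtain ⟨T, hT⟩ := notMem_dirichletSpectrum_iff.1 hμ₀
  obtain ⟨D⟩ := exists_modeData hT hΩo hΩb hl him hβ₀ hβ
  -- Mode data for the weight 0, needed for uniqueness in the unweighted space.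
  obtain ⟨D₀⟩ := exists_modeData hT hΩo hΩb hl him le_rfl
    fun ν hν => hβ₀.trans_lt (hβ ν hν)
  obtain ⟨C, hC⟩ := D.exists_norm_le hβ₀ hl1 hT hΩo
  obtain ⟨C₀, hC₀⟩ := D₀.exists_norm_le le_rfl hl1 hT hΩo
  refine ⟨C, fun R f => ?_⟩
  obtain ⟨W, hW, hWf⟩ := D.exists_solution hl1 hT (hC R) f
  -- The weighted solution also lies in the unweighted space, as e^{-2βx} ≥ e^{-2βR} for x < R. The
  -- embedding constant depends on R but does not enter the final bound.
  obtain ⟨U, hU, hUW⟩ := H20_exists_ae_eq ENNReal.ofReal_ne_top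
    (weightedMeasure_zero_le (R := R) hβ₀ hΩo) hW
  simp only [Filter.EventuallyEq, ae_weightedMeasure_iff] at hUW
  have hWs : SolvesModel lam μ₀ W f := solvesModel_iff.2 (by rw [hWf])
  have hUs : SolvesModel lam μ₀ U f := by
    have h : ∀ᵐ p ∂(volume.restrict (semiCylinder R Ω)), ∀ a, U a p = W a p := ae_all_iff.2 hUW
    rw [SolvesModel] at hWs ⊢
    filter_upwards [h, hWs] with p g1 g2
    simpa only [g1] using g2
  refine ⟨U, ⟨hU, hUs⟩, fun U' hU' hs' => ?_, W, hW, fun a => ?_, ?_⟩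
  · have hsub : U' - U ∈ H20Weighted 0 R Ω :=
      (H20Submodule (xyDir n) (weightedMeasure 0 R Ω) (semiCylinder R Ω)).sub_mem hU' hU
    have h0 := hC₀ R _ hsub
    have heq : modelCLM (weightedMeasure 0 R Ω) ((1 + lam) ^ 2)⁻¹ μ₀ U'
        = modelCLM (weightedMeasure 0 R Ω) ((1 + lam) ^ 2)⁻¹ μ₀ U :=
      Lp.ext ((ae_weightedMeasure_iff 0 R Ω).2
        ((solvesModel_iff.1 hs').trans (solvesModel_iff.1 hUs).symm))
    rw [map_sub, heq, sub_self, norm_zero, mul_zero] at h0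
    exact sub_eq_zero.1 (norm_le_zero_iff.1 h0)
  · exact Filter.EventuallyEq.symm (hUW a)
  · rw [← hWf]
    exact hC R W hW
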